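/- All algorithms are algorithms on a Word-RAM with words of $O(\log n)$ bits, either deterministic or randomized with two-sided error at most $1/3$; fix one of these two kinds of algorithms. Solving a problem with size parameter $n$ \emph{requires $T(n)^{1-o(1)}$ time} if for no constant $\varepsilon>0$ there is an algorithm of the fixed kind that solves it in $O(T(n)^{1-\varepsilon})$ time. For positive integers $a,b,c$ let $\omega(a,b,c)$ be the smallest real number (infimum) such that the product of an $n^a\times n^b$ matrix and an $n^b\times n^c$ matrix (with integer entries of $O(\log n)$ bits) can be computed by a deterministic algorithm in $n^{\omega(a,b,c)+o(1)}$ time, and for a real $x\ge 0$ and an integer $k\ge 3$ let \[ C(x,k)=x^{\,\omega(\lfloor k/3\rfloor,\ \lceil (k-1)/3\rceil,\ \lceil k/3\rceil)} . \] In the $k$-Clique problem one is given a $k$-partite graph with vertex set $V_1\sqcup\dots\sqcup V_k$, where each part has $n$ vertices (by its adjacency matrix), and has to decide whether it contains $k$ mutually adjacent vertices. The $k$-Clique Hypothesis states that for every integer constant $k\ge 3$, solving $k$-Clique requires $C(n,k)^{1-o(1)}$ time. In the $k$-Disjoint Shortest Paths problem ($k$-DSP) on unweighted DAGs one is given a directed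 acyclic graph on $n$ vertices (by the list of its edges) with sources $s_1,\dots,s_k$ and targets $t_1,\dots,t_k$, and has to decide whether there are paths $P_1,\dots,P_k$, where each $P_i$ is a shortest path from $s_i$ to $t_i$ (one with the fewest edges), that are pairwise internally vertex-disjoint (a vertex that lies on $P_i$ and on $P_j$, $i\ne j$, is an endpoint of both). \textbf{Corollary.} Assume the $k$-Clique Hypothesis. Then for every integer constant $k\ge 3$, solving $k$-DSP on unweighted DAGs with $n$ vertices requires $C(n^{1/2},k)^{1-o(1)}$ time. (This holds for deterministic algorithms, and likewise for randomized algorithms, with the hypothesis and the conclusion about the same kind of algorithms.) -/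

import Mathlib

namespace FineGrained

/-! ### The Word-RAM -/

/-- The unit-cost operations on words. Subtraction is truncated at `0`. -/
inductive Op
  | add | sub | mul | div | mod | and | or | xor | shl | shr | eq | lt

/-- The value of an operation, before any restriction to the word size. -/
def Op.eval : Op → ℕ → ℕ → ℕ
  | .add, x, y => x + y
  | .sub, x, y => x - y
  | .mul, x, y => x * y
  | .div, x, y => x / y
  | .mod, x, y => x % y
  | .and, x, y => x &&& y
  | .or, x, y => x ||| y
  | .xor, x, y => x ^^^ y
  | .shl, x, y => x <<< y
  | .shr, x, y => x >>> y
  | .eq, x, y => if x = y then 1 else 0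
  | .lt, x, y => if x < y then 1 else 0

/-- Instructions. `R` denotes the registers (a program mentions only finitely many of them) and `M`
the memory. -/
inductive Instr
  /-- `R[r] := v` -/
  | const (r v : ℕ)
  /-- `R[r] := R[x] o R[y]` -/
  | op (o : Op) (r x y : ℕ)
  /-- `R[r] := M[R[x]]` -/
  | load (r x : ℕ)
  /-- `M[R[x]] := R[r]` -/
  | store (x r : ℕ)
  /-- go to instruction number `l` -/
  | jump (l : ℕ)
  /-- go to instruction number `l` if `R[r] = 0` -/
  | jumpIfZero (r l : ℕ)
  /-- `R[r] :=` a fresh uniformly random bit -/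
  | flip (r : ℕ)

/-- A program is a finite list of instructions, numbered from `0`. -/
abbrev Program := List Instr

/-- A configuration: program counter, registers, memory, number of random bits used so far. -/
structure Config where
  pc : ℕ
  reg : ℕ → ℕ
  mem : ℕ → ℕ
  coins : ℕ

/-- The effect of one instruction; `ω i` is the `i`-th random bit. -/
def Instr.exec (ω : ℕ → Bool) (s : Config) : Instr → Config
  | .const r v => { s with pc := s.pc + 1, reg := Function.update s.reg r v }
  | .op o r x y =>
      { s with pc := s.pc + 1, reg := Function.update s.reg r (o.eval (s.reg x) (s.reg y)) }
  | .load r x => { s with pc := s.pc + 1, reg := Function.update s.reg r (s.mem (s.reg x)) }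
  | .store x r => { s with pc := s.pc + 1, mem := Function.update s.mem (s.reg x) (s.reg r) }
  | .jump l => { s with pc := l }
  | .jumpIfZero r l => { s with pc := if s.reg r = 0 then l else s.pc + 1 }
  | .flip r =>
      { s with
        pc := s.pc + 1
        reg := Function.update s.reg r (ω s.coins).toNat
        coins := s.coins + 1 }

/-- One step of the machine. It has halted once the program counter leaves the program, and then
the configuration no longer changes. -/
def step (p : Program) (ω : ℕ → Bool) (s : Config) : Config :=
  match p[s.pc]? with
  | some i => i.exec ω s
  | none => s

/-- The initial configuration: the input stands in the memory cells `0, 1, 2, …`, and all other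
cells and all registers hold `0`. -/
def init (input : List ℕ) : Config where
  pc := 0
  reg := fun _ => 0
  mem := fun a => input.getD a 0
  coins := 0

/-- The configuration after `t` steps. -/
def run (p : Program) (input : List ℕ) (ω : ℕ → Bool) (t : ℕ) : Config :=
  (step p ω)^[t] (init input)

/-- The machine has halted after at most `t` steps. -/
def HaltedAt (p : Program) (input : List ℕ) (ω : ℕ → Bool) (t : ℕ) : Prop :=
  p.length ≤ (run p input ω t).pc

/-! ### Problems and running times -/

/-- A computational problem: instances, their size parameter `n`, their encoding as a sequence of
words, and which final configurations hold a correct answer to an instance. -/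
structure Problem where
  Instance : Type
  size : Instance → ℕ
  encode : Instance → List ℕ
  Correct : Instance → Config → Prop

/-- The decision problem with the given yes-instances: the answer is read off register `0`, where
a nonzero value means yes. -/
def Problem.decision (I : Type) (size : I → ℕ) (encode : I → List ℕ) (Yes : I → Prop) :
    Problem where
  Instance := I
  size := size
  encode := encode
  Correct := fun x s => s.reg 0 ≠ 0 ↔ Yes x

/-- Deterministic algorithms, or randomized ones with two-sided error at most `1/3`. -/
inductive Mode
  | deterministic
  | randomized

/-- The distribution of a sequence of independent fair coin tosses. -/
noncomputable def coinMeasure : MeasureTheory.Measure (ℕ → Bool) :=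
  MeasureTheory.Measure.infinitePi fun _ => (PMF.uniformOfFintype Bool).toMeasure

/-- On every instance of size `n`, all words that occur have at most `c * (⌊log₂ n⌋ + 1)` bits. -/
def RespectsWordSize (P : Problem) (p : Program) (c : ℕ) : Prop :=
  ∀ (x : P.Instance) (ω : ℕ → Bool) (t a : ℕ),
    (run p (P.encode x) ω t).reg a < 2 ^ (c * (Nat.log 2 (P.size x) + 1)) ∧
    (run p (P.encode x) ω t).mem a < 2 ^ (c * (Nat.log 2 (P.size x) + 1))

/-- The program always halts, and on instances of size `n` it does so after `O(T n)` steps. -/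
def RunsInTime (P : Problem) (p : Program) (T : ℕ → ℝ) : Prop :=
  (∀ (x : P.Instance) (ω : ℕ → Bool), ∃ t, HaltedAt p (P.encode x) ω t) ∧
  ∃ (C : ℝ) (n₀ : ℕ), ∀ (x : P.Instance) (ω : ℕ → Bool), n₀ ≤ P.size x →
    ∃ t : ℕ, (t : ℝ) ≤ C * T (P.size x) ∧ HaltedAt p (P.encode x) ω t

/-- For the random bits `ω`, the program halts on `x` with a correct answer. -/
def Answers (P : Problem) (p : Program) (x : P.Instance) (ω : ℕ → Bool) : Prop :=
  ∃ t, HaltedAt p (P.encode x) ω t ∧ P.Correct x (run p (P.encode x) ω t)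

/-- The program is an algorithm for `P` of the given mode. -/
def Solves (P : Problem) (p : Program) : Mode → Prop
  | .deterministic =>
      (∀ r, Instr.flip r ∉ p) ∧ ∀ (x : P.Instance) (ω : ℕ → Bool), Answers P p x ω
  | .randomized => ∀ x : P.Instance, 2 / 3 ≤ coinMeasure {ω | Answers P p x ω}

/-- `P` can be solved in `O(T n)` time on a Word-RAM with words of `O(log n)` bits. -/
def SolvableInTime (mode : Mode) (P : Problem) (T : ℕ → ℝ) : Prop :=
  ∃ p : Program, (∃ c, RespectsWordSize P p c) ∧ RunsInTime P p T ∧ Solves P p mode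

/-- Solving `P` requires `T(n) ^ (1 - o(1))` time: for no constant `ε > 0` can `P` be solved in
`O(T(n) ^ (1 - ε))` time. -/
def RequiresTime (mode : Mode) (P : Problem) (T : ℕ → ℝ) : Prop :=
  ∀ ε : ℝ, 0 < ε → ¬ SolvableInTime mode P fun n => T n ^ (1 - ε)

/-! ### Matrix multiplication and the clique running time -/

/-- The entries of a matrix in row-major order. -/
def rowMajor {α : Type} {r s : ℕ} (A : Matrix (Fin r) (Fin s) α) : List α :=
  (List.ofFn fun i => List.ofFn fun j => A i j).flatten

/-- An integer as a word, in the order `0, -1, 1, -2, 2, …`. -/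
def intWord (z : ℤ) : ℕ := Equiv.intEquivNat z

/-- A pair of integer matrices of shapes `n^a × n^b` and `n^b × n^c` with entries of absolute value
at most `n^d`. -/
structure MatMulInstance (a b c d : ℕ) where
  n : ℕ
  A : Matrix (Fin (n ^ a)) (Fin (n ^ b)) ℤ
  B : Matrix (Fin (n ^ b)) (Fin (n ^ c)) ℤ
  hA : ∀ i j, |A i j| ≤ (n : ℤ) ^ d
  hB : ∀ i j, |B i j| ≤ (n : ℤ) ^ d

/-- Multiplying such matrices; the product is to be written to the memory from cell `0` on. -/
def matMul (a b c d : ℕ) : Problem where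
  Instance := MatMulInstance a b c d
  size := fun x => x.n
  encode := fun x => x.n :: ((rowMajor x.A).map intWord ++ (rowMajor x.B).map intWord)
  Correct := fun x s =>
    ∀ (i : ℕ) (h : i < ((rowMajor (x.A * x.B)).map intWord).length),
      s.mem i = ((rowMajor (x.A * x.B)).map intWord)[i]

/-- `ω(a, b, c)`: the smallest `τ` such that an `n^a × n^b` and an `n^b × n^c` matrix, with integer
entries of `O(log n)` bits, can be multiplied in `n^(τ + o(1))` time. -/
noncomputable def matMulExponent (a b c : ℕ) : ℝ :=
  sInf {τ : ℝ | ∀ d : ℕ, ∀ ε : ℝ, 0 < ε →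
    SolvableInTime .deterministic (matMul a b c d) fun n => (n : ℝ) ^ (τ + ε)}

/-- The clique running time `C(x, k)`. -/
noncomputable def cliqueTime (x : ℝ) (k : ℕ) : ℝ :=
  x ^ matMulExponent ⌊(k : ℚ) / 3⌋₊ ⌈((k : ℚ) - 1) / 3⌉₊ ⌈(k : ℚ) / 3⌉₊

/-! ### `k`-Clique -/

/-- A `k`-partite graph whose parts have `n` vertices each; the vertex `(i, u)` lies in part `i`. -/
structure CliqueInstance (k : ℕ) where
  n : ℕ
  G : SimpleGraph (Fin k × Fin n)
  partite : ∀ u v, G.Adj u v → u.1 ≠ v.1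

open Classical in
/-- The adjacency matrix, with the parts one after the other. -/
noncomputable def CliqueInstance.adjacency {k : ℕ} (x : CliqueInstance k) :
    Matrix (Fin (k * x.n)) (Fin (k * x.n)) ℕ :=
  fun u v => if x.G.Adj (finProdFinEquiv.symm u) (finProdFinEquiv.symm v) then 1 else 0

/-- The `k`-Clique problem, on graphs given by `n` and the adjacency matrix. -/
noncomputable def kClique (k : ℕ) : Problem :=
  Problem.decision (CliqueInstance k) (fun x => x.n) (fun x => x.n :: rowMajor x.adjacency)
    (fun x => ∃ s : Finset (Fin k × Fin x.n), x.G.IsNClique k s)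

/-- The `k`-Clique Hypothesis, for deterministic or for randomized algorithms. -/
def KCliqueHypothesis (mode : Mode) : Prop :=
  ∀ k : ℕ, 3 ≤ k → RequiresTime mode (kClique k) fun n => cliqueTime n k

/-! ### `k`-Disjoint Shortest Paths on unweighted DAGs -/

/-- A simple directed acyclic graph on `n` vertices, given by the list of its edges, with `k`
sources and `k` targets. -/
structure DSPInstance (k : ℕ) where
  n : ℕ
  edges : List (Fin n × Fin n)
  nodup : edges.Nodup
  acyclic : ∀ v, ¬ Relation.TransGen (fun u w => (u, w) ∈ edges) v v
  source : Fin k → Fin n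
  target : Fin k → Fin n

namespace DSPInstance

variable {k : ℕ} (x : DSPInstance k)

/-- `P` is the sequence of vertices of a path from `u` to `v`. -/
def IsPath (P : List (Fin x.n)) (u v : Fin x.n) : Prop :=
  P.IsChain (fun a b => (a, b) ∈ x.edges) ∧ P.Nodup ∧ P.head? = some u ∧ P.getLast? = some v

/-- `P` is a path from `u` to `v` with the least number of edges. -/
def IsShortestPath (P : List (Fin x.n)) (u v : Fin x.n) : Prop :=
  x.IsPath P u v ∧ ∀ Q, x.IsPath Q u v → P.length ≤ Q.length

/-- There are shortest paths from each source to its target that are pairwise internally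
vertex-disjoint: a vertex on two of the paths is an endpoint of both. -/
def HasDisjointShortestPaths : Prop :=
  ∃ P : Fin k → List (Fin x.n),
    (∀ i, x.IsShortestPath (P i) (x.source i) (x.target i)) ∧
    ∀ i j, i ≠ j → ∀ v, v ∈ P i → v ∈ P j →
      (v = x.source i ∨ v = x.target i) ∧ (v = x.source j ∨ v = x.target j)

/-- The encoding: number of vertices, number of edges, sources, targets, and the edges. -/
def encode : List ℕ :=
  x.n :: x.edges.length :: ((List.ofFn fun i => (x.source i : ℕ)) ++
    (List.ofFn fun i => (x.target i : ℕ)) ++ x.edges.flatMap fun e => [(e.1 : ℕ), (e.2 : ℕ)])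

end DSPInstance

/-- The `k`-DSP problem on unweighted DAGs, whose size `n` is the number of vertices. -/
def kDSP (k : ℕ) : Problem :=
  Problem.decision (DSPInstance k) (fun x => x.n) (fun x => x.encode)
    (fun x => x.HasDisjointShortestPaths)

end FineGrained

/-! The reduction draws the clique instance in a plane with a time and a space coordinate. Vertex
`a` of part `i` becomes the line `y = (i + 1) t + k! a - gap (i + 1)²`, whose slope depends only on
the part, and the line is subdivided into a path with `width = O(n)` vertices. All lines of a part
share their first vertex, the source, and their last vertex, the target. Lines of two different
parts get a common vertex at their crossing exactly if the two clique vertices are non-adjacent. The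
factor `k!` makes the crossing times integers. The large `gap` puts crossings with different `i + j`
into disjoint time windows, so that no two identifications interfere.

Shortest paths are controlled by one potential for each part `c`: a linear function of the plane
that equals the position on every line of part `c`. The subdivision is chosen such that one step
along a line of part `i` changes it by `1 - ((i - c) / (i + 1))²` (`potential_succ`), that is by `1`
on lines of part `c` and by less on all others. As a function of points of the plane it is
compatible with the identifications. Hence a path from source `c` to target `c` has at least `width
- 1` edges, and equality forces it to be one line of part `c` (`width_le_length`,
`exists_line_of_isPath`). A system of disjoint shortest paths is therefore a choice of one vertex in
each part such that the chosen vertices are pairwise adjacent (`hasDisjointShortestPaths_iff`).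

The graph has `N = O(n²)` vertices, and an explicit program writes its encoding in `O(n²)` steps. An
algorithm for `k`-DSP with time `N^β`, where `β ≥ 1`, thus solves `k`-Clique in time `n^(2β)`
(`solvableInTime_kClique`). With `τ` the exponent in the clique time, `C(N^(1/2), k)^(1-ε)` is `N^β`
for `β = τ(1-ε)/2`, so that `n^(2β)` contradicts the hypothesis.

If `β < 1`, writing the new instance would already cost too much. Then the hypothesis is not needed:
even a randomized algorithm has to read a linear part of the list of edges
(`not_solvableInTime_kDSP`). -/

namespace FineGrained

/-! ### Runs of the machine through a piece of code -/

/-- All words of a configuration are less than `B`. -/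
def Bounded (B : ℕ) (s : Config) : Prop := ∀ a, s.reg a < B ∧ s.mem a < B

/-- In `t` steps, the machine gets from `s` to `s'`, and all words on the way are less than `B`. -/
structure Reaches (p : Program) (ω : ℕ → Bool) (B : ℕ) (s : Config) (t : ℕ) (s' : Config) :
    Prop where
  eq : (step p ω)^[t] s = s'
  bdd : ∀ i ≤ t, Bounded B ((step p ω)^[i] s)

theorem Reaches.trans {p : Program} {ω : ℕ → Bool} {B : ℕ} {s₁ s₂ s₃ : Config} {t₁ t₂ : ℕ}
    (h₁ : Reaches p ω B s₁ t₁ s₂) (h₂ : Reaches p ω B s₂ t₂ s₃) :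
    Reaches p ω B s₁ (t₁ + t₂) s₃ := by
  refine ⟨?_, fun i hi => ?_⟩
  · rw [add_comm, Function.iterate_add_apply, h₁.eq, h₂.eq]
  · rcases le_total i t₁ with h | h
    · exact h₁.bdd i h
    · obtain ⟨j, rfl⟩ := Nat.exists_eq_add_of_le h
      rw [add_comm, Function.iterate_add_apply, h₁.eq]
      exact h₂.bdd j (by omega)

theorem Reaches.refl {p : Program} {ω : ℕ → Bool} {B : ℕ} {s : Config} (h : Bounded B s) :
    Reaches p ω B s 0 s :=
  ⟨rfl, fun i hi => by obtain rfl : i = 0 := by omega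
                       exact h⟩

theorem Reaches.bounded {p : Program} {ω : ℕ → Bool} {B t : ℕ} {s s' : Config}
    (h : Reaches p ω B s t s') : Bounded B s' := by
  have := h.bdd t le_rfl
  rwa [h.eq] at this

theorem step_of_getElem? {p : Program} {s : Config} {i : Instr} (ω : ℕ → Bool)
    (h : p[s.pc]? = some i) : step p ω s = i.exec ω s := by
  simp [step, h]

theorem Reaches.single {p : Program} {ω : ℕ → Bool} {B : ℕ} {s : Config} {i : Instr}
    (h : p[s.pc]? = some i) (hs : Bounded B s) (hs' : Bounded B (i.exec ω s)) :
    Reaches p ω B s 1 (i.exec ω s) := by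
  refine ⟨by simpa using step_of_getElem? ω h, fun j hj => ?_⟩
  rcases Nat.le_one_iff_eq_zero_or_eq_one.mp hj with rfl | rfl
  · exact hs
  · simpa [step_of_getElem? ω h] using hs'

theorem Bounded.update_reg {B : ℕ} {s : Config} (hs : Bounded B s) (q r w c : ℕ) (hw : w < B) :
    Bounded B ⟨q, Function.update s.reg r w, s.mem, c⟩ := by
  intro a
  refine ⟨?_, (hs a).2⟩
  by_cases h : a = r
  · subst h; simpa using hw
  · simpa [Function.update_of_ne h] using (hs a).1

theorem Bounded.update_mem {B : ℕ} {s : Config} (hs : Bounded B s) (q r w c : ℕ) (hw : w < B) :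
    Bounded B ⟨q, s.reg, Function.update s.mem r w, c⟩ := by
  intro a
  refine ⟨(hs a).1, ?_⟩
  by_cases h : a = r
  · subst h; simpa using hw
  · simpa [Function.update_of_ne h] using (hs a).2

/-- The program `p` contains the code `cs` from instruction number `l` on. -/
def HasCode (p : Program) (l : ℕ) (cs : List Instr) : Prop :=
  ∀ i, i < cs.length → p[l + i]? = cs[i]?

theorem HasCode.left {p : Program} {l : ℕ} {cs ds : List Instr} (h : HasCode p l (cs ++ ds)) :
    HasCode p l cs := by
  intro i hi
  rw [h i (by simp; omega), List.getElem?_append_left hi]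

theorem HasCode.right {p : Program} {l : ℕ} {cs ds : List Instr} (h : HasCode p l (cs ++ ds)) :
    HasCode p (l + cs.length) ds := by
  intro i hi
  rw [add_assoc, h _ (by simp; omega), List.getElem?_append_right (by omega)]
  congr 1; omega

theorem HasCode.head {p : Program} {l : ℕ} {i : Instr} {ds : List Instr}
    (h : HasCode p l (i :: ds)) : p[l]? = some i := by
  simpa using h 0 (by simp)

theorem HasCode.tail {p : Program} {l : ℕ} {i : Instr} {ds : List Instr}
    (h : HasCode p l (i :: ds)) : HasCode p (l + 1) ds :=
  HasCode.right (cs := [i]) h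

/-! ### Arithmetic expressions and their evaluation on a register stack -/

/-- Arithmetic expressions in the registers and the memory. -/
inductive Ex
  | lit (v : ℕ)
  | var (r : ℕ)
  | bin (o : Op) (a b : Ex)
  | get (a : Ex)

/-- The operations that can at most square a word. -/
def Op.Arith : Op → Prop
  | .add | .sub | .mul | .div | .mod | .eq | .lt => True
  | _ => False

/-- Restricting to operations that at most square a word (shifts are excluded) keeps an expression
of constant height polynomial in its inputs, which is what words of `O(log n)` bits require. The
assumption `2 ≤ X` absorbs sums, since `2 X ≤ X * X`. -/
theorem Op.Arith.eval_le {o : Op} (ho : o.Arith) {X x y : ℕ} (hX : 2 ≤ X) (hx : x ≤ X)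
    (hy : y ≤ X) : o.eval x y ≤ X * X := by
  have hXX : 2 * X ≤ X * X := Nat.mul_le_mul_right _ hX
  cases o <;> simp only [Op.Arith, Op.eval] at ho ⊢
  · omega
  · omega
  · exact Nat.mul_le_mul hx hy
  · exact (Nat.div_le_self _ _).trans (by omega)
  · exact (Nat.mod_le _ _).trans (by omega)
  · split <;> omega
  · split <;> omega

namespace Ex

instance : Add Ex := ⟨.bin .add⟩
instance : Sub Ex := ⟨.bin .sub⟩
instance : Mul Ex := ⟨.bin .mul⟩
instance : Div Ex := ⟨.bin .div⟩
instance : Mod Ex := ⟨.bin .mod⟩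

/-- The value of an expression; `v` gives the registers and `m` the memory. -/
def eval (v m : ℕ → ℕ) : Ex → ℕ
  | lit c => c
  | var r => v r
  | bin o a b => o.eval (a.eval v m) (b.eval v m)
  | get a => m (a.eval v m)

@[simp] theorem eval_lit (v m : ℕ → ℕ) (c : ℕ) : (lit c).eval v m = c := rfl
@[simp] theorem eval_var (v m : ℕ → ℕ) (r : ℕ) : (var r).eval v m = v r := rfl
@[simp] theorem eval_get (v m : ℕ → ℕ) (a : Ex) : (get a).eval v m = m (a.eval v m) := rfl
@[simp] theorem eval_add (v m : ℕ → ℕ) (a b : Ex) : (a + b).eval v m = a.eval v m + b.eval v m :=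
  rfl
@[simp] theorem eval_sub (v m : ℕ → ℕ) (a b : Ex) : (a - b).eval v m = a.eval v m - b.eval v m :=
  rfl
@[simp] theorem eval_mul (v m : ℕ → ℕ) (a b : Ex) : (a * b).eval v m = a.eval v m * b.eval v m :=
  rfl
@[simp] theorem eval_div (v m : ℕ → ℕ) (a b : Ex) : (a / b).eval v m = a.eval v m / b.eval v m :=
  rfl
@[simp] theorem eval_mod (v m : ℕ → ℕ) (a b : Ex) : (a % b).eval v m = a.eval v m % b.eval v m :=
  rfl
@[simp] theorem eval_eq (v m : ℕ → ℕ) (a b : Ex) :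
    (bin .eq a b).eval v m = if a.eval v m = b.eval v m then 1 else 0 := rfl
@[simp] theorem eval_lt (v m : ℕ → ℕ) (a b : Ex) :
    (bin .lt a b).eval v m = if a.eval v m < b.eval v m then 1 else 0 := rfl

/-- Code that writes the value of an expression into register `d`, with the registers from `d` on
as a stack. -/
def code : Ex → ℕ → List Instr
  | lit c, d => [.const d c]
  -- There is no move instruction; the bitwise `and` of a word with itself copies it without
  -- creating a larger word.
  | var r, d => [.op .and d r r]
  | bin o a b, d => a.code d ++ (b.code (d + 1) ++ [.op o d d (d + 1)])
  | get a, d => a.code d ++ [.load d d]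

/-- The number of stack registers used beyond the first. -/
def depth : Ex → ℕ
  | lit _ => 0
  | var _ => 0
  | bin _ a b => max a.depth (b.depth + 1)
  | get a => a.depth

/-- The height of an expression as a tree. -/
def height : Ex → ℕ
  | lit _ => 0
  | var _ => 0
  | bin _ a b => max a.height b.height + 1
  | get a => a.height + 1

/-- All intermediate values of the evaluation are less than `B`. -/
def Safe (B : ℕ) (v m : ℕ → ℕ) : Ex → Prop
  | lit c => c < B
  | var r => r < 16 ∧ v r < B
  | bin o a b => a.Safe B v m ∧ b.Safe B v m ∧ o.eval (a.eval v m) (b.eval v m) < B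
  | get a => a.Safe B v m ∧ m (a.eval v m) < B

/-- The expression uses only variables below `16`, literals up to `b` and arithmetic operations. -/
def WF (b : ℕ) : Ex → Prop
  | lit c => c ≤ b
  | var r => r < 16
  | bin o x y => o.Arith ∧ x.WF b ∧ y.WF b
  | get x => x.WF b

@[simp] theorem wf_lit (b c : ℕ) : (lit c).WF b ↔ c ≤ b := Iff.rfl
@[simp] theorem wf_var (b r : ℕ) : (var r).WF b ↔ r < 16 := Iff.rfl
@[simp] theorem wf_get (b : ℕ) (x : Ex) : (get x).WF b ↔ x.WF b := Iff.rfl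
@[simp] theorem wf_add (b : ℕ) (x y : Ex) : (x + y).WF b ↔ x.WF b ∧ y.WF b :=
  ⟨And.right, And.intro trivial⟩
@[simp] theorem wf_sub (b : ℕ) (x y : Ex) : (x - y).WF b ↔ x.WF b ∧ y.WF b :=
  ⟨And.right, And.intro trivial⟩
@[simp] theorem wf_mul (b : ℕ) (x y : Ex) : (x * y).WF b ↔ x.WF b ∧ y.WF b :=
  ⟨And.right, And.intro trivial⟩
@[simp] theorem wf_div (b : ℕ) (x y : Ex) : (x / y).WF b ↔ x.WF b ∧ y.WF b :=
  ⟨And.right, And.intro trivial⟩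
@[simp] theorem wf_mod (b : ℕ) (x y : Ex) : (x % y).WF b ↔ x.WF b ∧ y.WF b :=
  ⟨And.right, And.intro trivial⟩
@[simp] theorem wf_eq (b : ℕ) (x y : Ex) : (bin .eq x y).WF b ↔ x.WF b ∧ y.WF b :=
  ⟨And.right, And.intro trivial⟩
@[simp] theorem wf_lt (b : ℕ) (x y : Ex) : (bin .lt x y).WF b ↔ x.WF b ∧ y.WF b :=
  ⟨And.right, And.intro trivial⟩

/-- Each level of the tree at most squares the bound, which gives `b ^ 2 ^ height`. A memory access
resets it to `b`. -/
theorem WF.eval_le {b : ℕ} {v m : ℕ → ℕ} (hb : 2 ≤ b) (hv : ∀ x < 16, v x ≤ b)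
    (hm : ∀ a, m a ≤ b) : ∀ {e : Ex}, e.WF b → e.eval v m ≤ b ^ 2 ^ e.height
  | lit c, h => by simpa [height, WF] using h
  | var r, h => by simpa [height] using hv r h
  | bin o x y, h => by
      have hx := WF.eval_le hb hv hm h.2.1
      have hy := WF.eval_le hb hv hm h.2.2
      have h1 : ∀ z ≤ max x.height y.height, b ^ 2 ^ z ≤ b ^ 2 ^ max x.height y.height :=
        fun z hz => Nat.pow_le_pow_right (by omega) (Nat.pow_le_pow_right (by omega) hz)
      have h2 : 2 ≤ b ^ 2 ^ max x.height y.height := hb.trans (Nat.le_self_pow (by simp) b)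
      refine (Op.Arith.eval_le h.1 h2 (hx.trans (h1 _ (le_max_left _ _)))
        (hy.trans (h1 _ (le_max_right _ _)))).trans ?_
      rw [← pow_add, height, pow_succ, mul_two]
  | get x, h => (hm _).trans (Nat.le_self_pow (by simp) b)

theorem WF.safe {b S : ℕ} {v m : ℕ → ℕ} (hb : 2 ≤ b) (hv : ∀ x < 16, v x ≤ b)
    (hm : ∀ a, m a ≤ b) : ∀ {e : Ex}, e.WF b → e.height ≤ S → e.Safe (b ^ 2 ^ S + 1) v m := by
  have key : ∀ {e : Ex}, e.WF b → e.height ≤ S → e.eval v m < b ^ 2 ^ S + 1 := fun h hS =>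
    Nat.lt_succ_of_le <| (h.eval_le hb hv hm).trans <|
      Nat.pow_le_pow_right (by omega) (Nat.pow_le_pow_right (by omega) hS)
  intro e h hS
  induction e with
  | lit c => exact key h hS
  | var r => exact ⟨h, key h hS⟩
  | bin o x y ihx ihy =>
    simp only [height] at hS
    exact ⟨ihx h.2.1 (by omega), ihy h.2.2 (by omega), key h hS⟩
  | get x ih =>
    simp only [height] at hS
    exact ⟨ih h (by omega), key (e := get x) h hS⟩

/-- Induction on the expression with a stack discipline. The last clause, that nothing outside `d,
…, d + depth` changes, keeps the value of the left operand in register `d` while the right operand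
is evaluated from `d + 1` on. -/
theorem code_reaches {p : Program} {ω : ℕ → Bool} {B : ℕ} {v m : ℕ → ℕ} :
    ∀ {e : Ex} {d l : ℕ} {s : Config}, HasCode p l (e.code d) → s.pc = l → 16 ≤ d →
      (∀ x < 16, s.reg x = v x) → s.mem = m → Bounded B s → e.Safe B v m →
      ∃ s', Reaches p ω B s (e.code d).length s' ∧ s'.pc = l + (e.code d).length ∧ s'.mem = m ∧
        s'.coins = s.coins ∧ s'.reg d = e.eval v m ∧
        ∀ x, x < d ∨ d + e.depth < x → s'.reg x = s.reg x := by
  intro e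
  induction e with
  | lit c =>
    intro d l s hc hl hd hv hm hs hsafe
    subst hl
    refine ⟨_, Reaches.single hc.head hs (hs.update_reg _ _ _ _ hsafe), rfl, hm, rfl, by
      simp [Instr.exec], fun x hx => ?_⟩
    simp only [depth, Instr.exec] at hx ⊢
    rw [Function.update_of_ne (by omega)]
  | var r =>
    intro d l s hc hl hd hv hm hs hsafe
    subst hl
    have hr := hv r hsafe.1
    refine ⟨_, Reaches.single hc.head hs (hs.update_reg _ _ _ _ ?_), rfl, hm, rfl, by
      simp [Instr.exec, Op.eval, hr], fun x hx => ?_⟩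
    · simpa [Op.eval, hr] using hsafe.2
    simp only [depth, Instr.exec] at hx ⊢
    rw [Function.update_of_ne (by omega)]
  | bin o a b iha ihb =>
    intro d l s hc hl hd hv hm hs hsafe
    simp only [code] at hc
    obtain ⟨s₁, r₁, pc₁, mem₁, c₁, v₁, f₁⟩ := iha hc.left hl hd hv hm hs hsafe.1
    obtain ⟨s₂, r₂, pc₂, mem₂, c₂, v₂, f₂⟩ := ihb hc.right.left pc₁ (by omega)
      (fun x hx => by rw [f₁ x (by omega), hv x hx]) mem₁ r₁.bounded hsafe.2.1
    have hget := hc.right.right.head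
    rw [← pc₂] at hget
    have e1 : s₂.reg d = a.eval v m := by rw [f₂ d (by omega), v₁]
    have e2 : s₂.reg (d + 1) = b.eval v m := v₂
    have r₃ := Reaches.single (ω := ω) hget r₂.bounded
      (r₂.bounded.update_reg _ _ _ _ (by rw [e1, e2]; exact hsafe.2.2))
    have r := r₁.trans (r₂.trans r₃)
    rw [show (a.code d).length + ((b.code (d + 1)).length + 1) = ((bin o a b).code d).length by
      simp [code]] at r
    refine ⟨_, r, ?_, mem₂, c₂.trans c₁, ?_, ?_⟩
    · simp [Instr.exec, pc₂, code]; omega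
    · simp [Instr.exec, e1, e2, eval]
    · intro x hx
      simp only [depth, Instr.exec] at hx ⊢
      rw [Function.update_of_ne (by omega), f₂ x (by omega), f₁ x (by omega)]
  | get a ih =>
    intro d l s hc hl hd hv hm hs hsafe
    simp only [code] at hc
    obtain ⟨s₁, r₁, pc₁, mem₁, c₁, v₁, f₁⟩ := ih hc.left hl hd hv hm hs hsafe.1
    have hget := hc.right.head
    rw [← pc₁] at hget
    have r₂ := Reaches.single (ω := ω) hget r₁.bounded
      (r₁.bounded.update_reg _ _ _ _ (by rw [v₁, mem₁]; exact hsafe.2))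
    have r := r₁.trans r₂
    rw [show (a.code d).length + 1 = ((get a).code d).length by simp [code]] at r
    refine ⟨_, r, ?_, mem₁, c₁, ?_, ?_⟩
    · simp [Instr.exec, pc₁, code]; omega
    · simp [Instr.exec, v₁, mem₁]
    · intro x hx
      simp only [depth, Instr.exec] at hx ⊢
      rw [Function.update_of_ne (by omega), f₁ x (by omega)]

theorem flip_notMem_code (r : ℕ) : ∀ (e : Ex) (d : ℕ), Instr.flip r ∉ e.code d
  | lit _, _ => by simp [code]
  | var _, _ => by simp [code]
  | bin _ a b, d => by simp [code, flip_notMem_code r a, flip_notMem_code r b]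
  | get a, d => by simp [code, flip_notMem_code r a]

end Ex

/-! ### Statements -/

/-- Registers below `16` hold `v`, the memory holds `m`, and registers from `R` on hold `0`. -/
structure St (R : ℕ) (v m : ℕ → ℕ) (s : Config) : Prop where
  var : ∀ x < 16, s.reg x = v x
  mem : s.mem = m
  zero : ∀ x, R ≤ x → s.reg x = 0

/-- Code, depending on the place where it stands. -/
abbrev Code := ℕ → List Instr

/-- One piece of code after the other. -/
def Code.seq (c₁ c₂ : Code) : Code := fun l => c₁ l ++ c₂ (l + (c₁ l).length)

/-- The code takes the registers and memory `v, m` to `v', m'` in at most `T` steps. -/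
def Triple (R B T : ℕ) (c : Code) (v m v' m' : ℕ → ℕ) : Prop :=
  ∀ (p : Program) (l : ℕ) (ω : ℕ → Bool) (s : Config), HasCode p l (c l) → s.pc = l →
    St R v m s → Bounded B s →
    ∃ t ≤ T, ∃ s', Reaches p ω B s t s' ∧ s'.pc = l + (c l).length ∧ s'.coins = s.coins ∧
      St R v' m' s'

theorem Triple.seq {R B T₁ T₂ : ℕ} {c₁ c₂ : Code} {v₁ m₁ v₂ m₂ v₃ m₃ : ℕ → ℕ}
    (h₁ : Triple R B T₁ c₁ v₁ m₁ v₂ m₂) (h₂ : Triple R B T₂ c₂ v₂ m₂ v₃ m₃) :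
    Triple R B (T₁ + T₂) (c₁.seq c₂) v₁ m₁ v₃ m₃ := by
  intro p l ω s hc hl hs hB
  obtain ⟨t₁, ht₁, s₁, r₁, pc₁, co₁, st₁⟩ := h₁ p l ω s hc.left hl hs hB
  obtain ⟨t₂, ht₂, s₂, r₂, pc₂, co₂, st₂⟩ := h₂ p _ ω s₁ hc.right pc₁ st₁ r₁.bounded
  exact ⟨t₁ + t₂, by omega, s₂, r₁.trans r₂, by simp [Code.seq, pc₂, add_assoc],
    co₂.trans co₁, st₂⟩

/-- `R[x] := e`. -/
def Code.assign (x : ℕ) (e : Ex) : Code := fun _ => e.code 16 ++ [.op .and x 16 16]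

/-- `M[ea] := ev`. -/
def Code.store (ea ev : Ex) : Code := fun _ => ea.code 16 ++ (ev.code 17 ++ [.store 16 17])

/-- For `R[0] := 0, …, R[y] - 1` do `M[ea] := ev`. -/
def Code.loop (y : ℕ) (ea ev : Ex) : Code := fun l =>
  -- The exit is the first instruction behind the loop: three instructions precede the body and
  -- three follow it.
  .const 0 0 :: .op .lt 16 0 y :: .jumpIfZero 16 (l + (Code.store ea ev 0).length + 6) ::
    (Code.store ea ev 0 ++ [.const 16 1, .op .add 0 0 16, .jump (l + 1)])

theorem Triple.assign {R B : ℕ} {v m : ℕ → ℕ} {x : ℕ} {e : Ex} (hx : x < 16)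
    (he : e.Safe B v m) (hR : 16 + e.depth < R) :
    Triple R B ((e.code 16).length + 1) (Code.assign x e) v m
      (Function.update v x (e.eval v m)) m := by
  intro p l ω s hc hl hs hB
  obtain ⟨s₁, r₁, pc₁, mem₁, c₁, v₁, f₁⟩ :=
    Ex.code_reaches (ω := ω) hc.left hl le_rfl hs.var hs.mem hB he
  have hget := hc.right.head
  rw [← pc₁] at hget
  have r₂ := Reaches.single (ω := ω) hget r₁.bounded
      (r₁.bounded.update_reg _ _ _ _ (by simpa [Op.eval] using (r₁.bounded _).1))
  refine ⟨_, le_rfl, _, r₁.trans r₂, ?_, c₁, ?_, mem₁, ?_⟩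
  · simp [Instr.exec, pc₁, Code.assign]; omega
  · intro y hy
    by_cases h : y = x
    · subst h; simp [Instr.exec, Op.eval, v₁]
    · simp [Instr.exec, Function.update_of_ne h, f₁ y (by omega), hs.var y hy]
  · intro y hy
    simp only [Instr.exec]
    rw [Function.update_of_ne (by omega), f₁ y (by omega), hs.zero y hy]

theorem Triple.store {R B : ℕ} {v m : ℕ → ℕ} {ea ev : Ex}
    (ha : ea.Safe B v m) (he : ev.Safe B v m) (hRa : 16 + ea.depth < R)
    (hRe : 17 + ev.depth < R) :
    Triple R B (Code.store ea ev 0).length (Code.store ea ev) v m v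
      (Function.update m (ea.eval v m) (ev.eval v m)) := by
  intro p l ω s hc hl hs hB
  obtain ⟨s₁, r₁, pc₁, mem₁, c₁, v₁, f₁⟩ :=
    Ex.code_reaches (ω := ω) hc.left hl le_rfl hs.var hs.mem hB ha
  obtain ⟨s₂, r₂, pc₂, mem₂, c₂, v₂, f₂⟩ :=
    Ex.code_reaches (ω := ω) hc.right.left pc₁ (by omega)
      (fun x hx => by rw [f₁ x (by omega), hs.var x hx]) mem₁ r₁.bounded he
  have hget := hc.right.right.head
  rw [← pc₂] at hget
  have r₃ := Reaches.single (ω := ω) hget r₂.bounded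
      (r₂.bounded.update_mem _ _ _ _ (r₂.bounded _).1)
  have e1 : s₂.reg 16 = ea.eval v m := by rw [f₂ 16 (by omega), v₁]
  have r := r₁.trans (r₂.trans r₃)
  rw [show (ea.code 16).length + ((ev.code 17).length + 1) = (Code.store ea ev 0).length by
    simp [Code.store]] at r
  refine ⟨_, le_rfl, _, r, ?_, c₂.trans c₁, ?_, ?_, ?_⟩
  · simp [Instr.exec, pc₂, Code.store]; omega
  · intro y hy
    simp [Instr.exec, f₂ y (by omega), f₁ y (by omega), hs.var y hy]
  · simp [Instr.exec, mem₂, e1, v₂]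
  · intro y hy
    simp [Instr.exec, f₂ y (by omega), f₁ y (by omega), hs.zero y hy]

/-- The memory after `t` rounds of a loop. -/
def loopMem (ea ev : Ex) (v m : ℕ → ℕ) : ℕ → ℕ → ℕ
  | 0 => m
  | t + 1 => Function.update (loopMem ea ev v m t)
      (ea.eval (Function.update v 0 t) (loopMem ea ev v m t))
      (ev.eval (Function.update v 0 t) (loopMem ea ev v m t))

theorem Triple.loop {R B : ℕ} {v m : ℕ → ℕ} {y : ℕ} {ea ev : Ex} (hy : y < 16) (hy0 : y ≠ 0)
    (hB2 : 1 < B)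
    (ha : ∀ t < v y, ea.Safe B (Function.update v 0 t) (loopMem ea ev v m t))
    (he : ∀ t < v y, ev.Safe B (Function.update v 0 t) (loopMem ea ev v m t))
    (hRa : 16 + ea.depth < R) (hRe : 17 + ev.depth < R) :
    Triple R B (v y * ((Code.store ea ev 0).length + 5) + 3) (Code.loop y ea ev) v m
      (Function.update v 0 (v y)) (loopMem ea ev v m (v y)) := by
  intro p l ω s hc hl hs hB
  set K := (Code.store ea ev 0).length with hK
  have hyB : v y < B := by rw [← hs.var y hy]; exact (hB y).1
  have i0 := hc.head
  have i1 := hc.tail.head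
  have i2 := hc.tail.tail.head
  have hbody := hc.tail.tail.tail.left
  have i3 := hc.tail.tail.tail.right.head
  have i4 := hc.tail.tail.tail.right.tail.head
  have i5 := hc.tail.tail.tail.right.tail.tail.head
  rw [← hK] at i2 i3 i4 i5
  -- Invariant at the test, which stands at `l + 1`. A round costs the test, the conditional jump,
  -- the `K` steps of the body and three closing instructions, hence `K + 5`.
  have head : ∀ t ≤ v y, ∃ T ≤ t * (K + 5) + 1, ∃ s', Reaches p ω B s T s' ∧ s'.pc = l + 1 ∧
      s'.coins = s.coins ∧ St R (Function.update v 0 t) (loopMem ea ev v m t) s' := by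
    intro t
    induction t with
    | zero =>
      intro _
      rw [← hl] at i0
      refine ⟨1, by omega, _, Reaches.single i0 hB (hB.update_reg _ _ _ _ (by omega)),
        by simp [Instr.exec, hl], rfl, fun x hx => ?_, hs.mem, fun x hx => ?_⟩
      · by_cases h : x = 0
        · subst h; simp [Instr.exec]
        · simp [Instr.exec, Function.update_of_ne h, hs.var x hx]
      · simp only [Instr.exec]
        rw [Function.update_of_ne (by omega), hs.zero x hx]
    | succ t ih =>
      intro ht
      obtain ⟨T, hT, s₁, r₁, pc₁, co₁, st₁⟩ := ih (by omega)
      have v0 : s₁.reg 0 = t := by rw [st₁.var 0 (by omega)]; simp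
      have vy : s₁.reg y = v y := by
        rw [st₁.var y hy]; simp [Function.update_of_ne hy0]
      rw [← pc₁] at i1
      have r₂ := Reaches.single (ω := ω) i1 r₁.bounded (r₁.bounded.update_reg _ _ _ _ (by
        simp only [Op.eval]; split_ifs <;> omega))
      have i2' : p[((Instr.op .lt 16 0 y).exec ω s₁).pc]? =
          some (.jumpIfZero 16 (l + K + 6)) := by
        simpa [Instr.exec, pc₁] using i2
      have r₃ := Reaches.single (ω := ω) i2' r₂.bounded r₂.bounded
      have st₃ : St R (Function.update v 0 t) (loopMem ea ev v m t)
          ((Instr.jumpIfZero 16 (l + K + 6)).exec ω ((Instr.op .lt 16 0 y).exec ω s₁)) := by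
        refine ⟨fun x hx => ?_, st₁.mem, fun x hx => ?_⟩
        · simp only [Instr.exec]
          rw [Function.update_of_ne (by omega), st₁.var x hx]
        · simp only [Instr.exec]
          rw [Function.update_of_ne (by omega), st₁.zero x hx]
      obtain ⟨T', hT', s₄, r₄, pc₄, co₄, st₄⟩ :=
        Triple.store (ha t (by omega)) (he t (by omega)) hRa hRe p (l + 1 + 1 + 1) ω _ hbody
        (by
          have : t < v y := by omega
          simp [Instr.exec, v0, vy, Op.eval, pc₁, this]) st₃ r₃.bounded
      have pc₄' : s₄.pc = l + 1 + 1 + 1 + K := pc₄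
      rw [← pc₄'] at i3
      have r₅ := Reaches.single (ω := ω) i3 r₄.bounded
        (r₄.bounded.update_reg _ _ _ _ (by omega))
      have i4' : p[((Instr.const 16 1).exec ω s₄).pc]? = some (.op .add 0 0 16) := by
        simpa [Instr.exec, pc₄'] using i4
      have w0 : s₄.reg 0 = t := by rw [st₄.var 0 (by omega)]; simp
      have r₆ := Reaches.single (ω := ω) i4' r₅.bounded
        (r₅.bounded.update_reg _ _ _ _ (by simp [Instr.exec, Op.eval, w0]; omega))
      have i5' : p[((Instr.op .add 0 0 16).exec ω ((Instr.const 16 1).exec ω s₄)).pc]? =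
          some (.jump (l + 1)) := by
        simpa [Instr.exec, pc₄', add_assoc] using i5
      have r₇ := Reaches.single (ω := ω) i5' r₆.bounded r₆.bounded
      refine ⟨_, ?_, _, r₁.trans (r₂.trans (r₃.trans (r₄.trans (r₅.trans (r₆.trans r₇))))),
        rfl, co₄.trans co₁, fun x hx => ?_, ?_, fun x hx => ?_⟩
      · rw [add_mul]; omega
      · by_cases h : x = 0
        · subst h; simp [Instr.exec, Op.eval, w0]
        · have := st₄.var x hx
          rw [Function.update_of_ne h] at this ⊢
          simp only [Instr.exec]
          rw [Function.update_of_ne h, Function.update_of_ne (by omega), this]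
      · simp [Instr.exec, st₄.mem, loopMem]
      · simp only [Instr.exec]
        rw [Function.update_of_ne (by omega), Function.update_of_ne (by omega), st₄.zero x hx]
  obtain ⟨T, hT, s₁, r₁, pc₁, co₁, st₁⟩ := head (v y) le_rfl
  have v0 : s₁.reg 0 = v y := by rw [st₁.var 0 (by omega)]; simp
  have vy : s₁.reg y = v y := by rw [st₁.var y hy]; simp [Function.update_of_ne hy0]
  rw [← pc₁] at i1
  have r₂ := Reaches.single (ω := ω) i1 r₁.bounded (r₁.bounded.update_reg _ _ _ _ (by
    simp only [Op.eval]; split_ifs <;> omega))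
  have i2' : p[((Instr.op .lt 16 0 y).exec ω s₁).pc]? = some (.jumpIfZero 16 (l + K + 6)) := by
    simpa [Instr.exec, pc₁] using i2
  have r₃ := Reaches.single (ω := ω) i2' r₂.bounded r₂.bounded
  refine ⟨_, ?_, _, r₁.trans (r₂.trans r₃), ?_, co₁, fun x hx => ?_, st₁.mem, fun x hx => ?_⟩
  · omega
  · simp [Instr.exec, v0, vy, Op.eval, Code.loop, ← hK]; omega
  · simp only [Instr.exec]
    rw [Function.update_of_ne (by omega), st₁.var x hx]
  · simp only [Instr.exec]
    rw [Function.update_of_ne (by omega), st₁.zero x hx]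

/-- Code that sets all registers below `R` to `0`. -/
def Code.clear (R : ℕ) : Code := fun _ => (List.range R).map fun r => .const r 0

/-- The simulated program has to start with all registers zero. `St` guarantees this from `R` on,
and the code clears the registers below `R`. -/
theorem Code.clear_reaches {p : Program} {ω : ℕ → Bool} {B : ℕ} {s : Config} {l : ℕ} :
    ∀ {R : ℕ}, HasCode p l (Code.clear R l) → s.pc = l → Bounded B s →
      Reaches p ω B s R ⟨l + R, fun r => if r < R then 0 else s.reg r, s.mem, s.coins⟩ := by
  intro R
  induction R with
  | zero =>
    intro _ hl hB
    subst hl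
    simpa using Reaches.refl hB
  | succ R ih =>
    intro hc hl hB
    have hc' : HasCode p l (Code.clear R l ++ [.const R 0]) := by
      simpa [Code.clear, List.range_succ] using hc
    have r₁ := ih hc'.left hl hB
    have hget : p[l + R]? = some (.const R 0) := by
      simpa [Code.clear] using hc'.right.head
    have r₂ := Reaches.single (ω := ω) hget r₁.bounded
      (r₁.bounded.update_reg _ _ _ _ (by have := (hB 0).1; omega))
    convert r₁.trans r₂ using 1
    simp only [Instr.exec, Config.mk.injEq, and_true]
    refine ⟨by omega, funext fun r => ?_⟩
    by_cases h : r = R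
    · subst h; simp
    · rw [Function.update_of_ne h]
      exact if_congr (by omega) rfl rfl

end FineGrained

namespace FineGrained

/-! ### The graph of the reduction

For every part `i` of the clique instance and every vertex `a` of this part there is a line: a path
with `width` vertices. Lines of different parts have different slopes, and the lines `(i, a)` and
`(j, b)` get a common vertex at their crossing if `(i, a)` and `(j, b)` are not adjacent. -/

namespace Lines

/-- The distance between the zones where the lines of two parts cross. -/
def gap (k n : ℕ) : ℕ := 3 * k.factorial * n

/-- The number of vertices of a line. -/
def width (k n : ℕ) : ℕ := 2 * k.factorial * (k * k * (6 * k + 1) + 2 * k) * n + 3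

/-- The time when the lines `(i, a)` and `(j, b)` cross. -/
def time (k n i a j b : ℕ) : ℕ :=
  gap k n * (i + j + 2) + k.factorial / (j - i) * a - k.factorial / (j - i) * b

/-- The position on the line `(i, a)` at time `τ`. -/
def pos (k i a τ : ℕ) : ℕ := 2 * ((i + 1) * (i + 1) * τ + 2 * (i + 1) * k.factorial * a)

/-- The number of the vertex at position `s` of the line `(i, a)`. -/
def vtx (k n i a s : ℕ) : ℕ := (i * n + a) * width k n + s

theorem width_ge (k n : ℕ) : 3 ≤ width k n := by simp [width]

/-- The last position of a line is then even, so every odd position is an inner one. -/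
theorem width_odd (k n : ℕ) : width k n % 2 = 1 := by
  rw [width, mul_assoc, mul_assoc]; omega

theorem pos_even (k i a τ : ℕ) : pos k i a τ % 2 = 0 := by simp [pos]

/-! ### Crossing times and positions on the lines -/

section Arithmetic

variable {k n i a j b : ℕ}

/-- The lines `(i, a)` and `(j, b)` cross at a time with denominator `j - i`, which divides `k!`;
this is why the lines of a part are `k!` apart. -/
theorem nu_mul (hij : i < j) (hj : j < k) :
    k.factorial / (j - i) * (j - i) = k.factorial :=
  Nat.div_mul_cancel (Nat.dvd_factorial (by omega) (by omega))

theorem nu_pos (hij : i < j) (hj : j < k) : 0 < k.factorial / (j - i) :=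
  Nat.div_pos (Nat.le_of_dvd (Nat.factorial_pos k) (Nat.dvd_factorial (by omega) (by omega)))
    (by omega)

theorem nu_mul_le (c : ℕ) (hc : c ≤ n) : k.factorial / (j - i) * c ≤ k.factorial * n :=
  Nat.mul_le_mul (Nat.div_le_self _ _) hc

/-- The subtraction in `time` does not truncate, because `gap` exceeds every term `k! / (j - i) *
b`. -/
theorem time_add (hb : b ≤ n) :
    time k n i a j b + k.factorial / (j - i) * b =
      gap k n * (i + j + 2) + k.factorial / (j - i) * a := by
  have h := nu_mul_le (k := k) (i := i) (j := j) b hb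
  have h2 : gap k n * 1 ≤ gap k n * (i + j + 2) := Nat.mul_le_mul_left _ (by omega)
  have h3 : gap k n = 3 * (k.factorial * n) := by rw [gap, mul_assoc]
  unfold time
  omega

theorem time_pos (hb : b < n) : 0 < time k n i a j b := by
  have h0 : 0 < k.factorial * n := Nat.mul_pos (Nat.factorial_pos k) (by omega)
  have h := nu_mul_le (k := k) (i := i) (j := j) b hb.le
  have h2 : gap k n * 1 ≤ gap k n * (i + j + 2) := Nat.mul_le_mul_left _ (by omega)
  have h3 : gap k n = 3 * (k.factorial * n) := by rw [gap, mul_assoc]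
  have h4 := time_add (k := k) (i := i) (a := a) (j := j) hb.le
  omega

theorem time_le (hi : i < k) (hj : j < k) (ha : a < n) (hb : b < n) :
    time k n i a j b ≤ k.factorial * n * (6 * k + 1) := by
  have h := nu_mul_le (k := k) (i := i) (j := j) a ha.le
  have h2 : gap k n * (i + j + 2) ≤ gap k n * (2 * k) := Nat.mul_le_mul_left _ (by omega)
  have h3 : gap k n * (2 * k) = k.factorial * n * (6 * k) := by rw [gap]; ring
  have h4 := time_add (k := k) (i := i) (a := a) (j := j) hb.le
  rw [mul_add]
  omega

/-- Each crossing time differs from `gap * (i + j + 2)` by at most `k! * n`, while the centres of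
different windows are at least `gap = 3 * k! * n` apart. -/
theorem time_separates {i' a' j' b' : ℕ} (ha : a < n) (hb : b < n) (ha' : a' < n) (hb' : b' < n)
    (h : time k n i a j b = time k n i' a' j' b') : i + j = i' + j' := by
  have h0 : 0 < k.factorial * n := Nat.mul_pos (Nat.factorial_pos k) (by omega)
  have h3 : gap k n = 3 * (k.factorial * n) := by rw [gap, mul_assoc]
  have e1 := time_add (k := k) (i := i) (a := a) (j := j) hb.le
  have e2 := time_add (k := k) (i := i') (a := a') (j := j') hb'.le
  have l1 := nu_mul_le (k := k) (i := i) (j := j) a ha.le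
  have l2 := nu_mul_le (k := k) (i := i) (j := j) b hb.le
  have l3 := nu_mul_le (k := k) (i := i') (j := j') a' ha'.le
  have l4 := nu_mul_le (k := k) (i := i') (j := j') b' hb'.le
  rcases lt_trichotomy (i + j) (i' + j') with hl | hl | hl
  · have : gap k n * (i + j + 2) + gap k n ≤ gap k n * (i' + j' + 2) := by
      rw [← Nat.mul_succ]; exact Nat.mul_le_mul_left _ (by omega)
    omega
  · exact hl
  · have : gap k n * (i' + j' + 2) + gap k n ≤ gap k n * (i + j + 2) := by
      rw [← Nat.mul_succ]; exact Nat.mul_le_mul_left _ (by omega)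
    omega

theorem pos_pos {τ : ℕ} (h : 0 < τ) : 0 < pos k i a τ := by unfold pos; positivity

/-- The constants in `width` come from here: `(i + 1)²` is at most `k²`, the time is at most `k! n
(6k + 1)`, and the shift of the line is at most `2k · k! n`. The summand `3` leaves room for a
further inner vertex behind every crossing. -/
theorem pos_lt {τ : ℕ} (hi : i < k) (ha : a < n) (hτ : τ ≤ k.factorial * n * (6 * k + 1)) :
    pos k i a τ + 2 < width k n := by
  have h1 : (i + 1) * (i + 1) * τ ≤ k * k * (k.factorial * n * (6 * k + 1)) :=
    Nat.mul_le_mul (Nat.mul_le_mul hi hi) hτ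
  have h2 : 2 * (i + 1) * k.factorial * a ≤ 2 * k * k.factorial * n := by gcongr; exact hi
  have h3 : width k n = 2 * (k * k * (k.factorial * n * (6 * k + 1)) + 2 * k * k.factorial * n)
      + 3 := by unfold width; ring
  unfold pos
  omega

theorem pos_inj {τ τ' : ℕ} (h : pos k i a τ = pos k i a τ') : τ = τ' := by
  unfold pos at h
  have : (i + 1) * (i + 1) * τ = (i + 1) * (i + 1) * τ' := by omega
  exact Nat.eq_of_mul_eq_mul_left (by positivity) this

theorem vtx_lt {s : ℕ} (hi : i < k) (ha : a < n) (hs : s < width k n) :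
    vtx k n i a s < k * n * width k n := by
  have h1 : i * n + a + 1 ≤ k * n := by
    have := Nat.mul_le_mul_right n (show i + 1 ≤ k from hi)
    rw [add_mul] at this
    omega
  have h2 := Nat.mul_le_mul_right (width k n) h1
  rw [add_mul] at h2
  unfold vtx
  omega

theorem vtx_div {s : ℕ} (hs : s < width k n) : vtx k n i a s / width k n = i * n + a := by
  rw [vtx, mul_comm, Nat.mul_add_div (by omega), Nat.div_eq_of_lt hs, add_zero]

theorem vtx_mod {s : ℕ} (hs : s < width k n) : vtx k n i a s % width k n = s := by
  rw [vtx, mul_comm, Nat.mul_add_mod, Nat.mod_eq_of_lt hs]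

theorem line_div (ha : a < n) : (i * n + a) / n = i := by
  rw [mul_comm, Nat.mul_add_div (by omega), Nat.div_eq_of_lt ha, add_zero]

theorem line_mod (ha : a < n) : (i * n + a) % n = a := by
  rw [mul_comm, Nat.mul_add_mod, Nat.mod_eq_of_lt ha]

theorem vtx_inj {i' a' s s' : ℕ} (ha : a < n) (ha' : a' < n) (hs : s < width k n)
    (hs' : s' < width k n) (h : vtx k n i a s = vtx k n i' a' s') : i = i' ∧ a = a' ∧ s = s' := by
  have h1 := vtx_div (i := i) (a := a) hs
  have h2 := vtx_mod (i := i) (a := a) hs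
  rw [h, vtx_div hs'] at h1
  rw [h, vtx_mod hs'] at h2
  refine ⟨?_, ?_, h2.symm⟩
  · rw [← line_div (i := i) ha, ← h1, line_div ha']
  · rw [← line_mod (i := i) ha, ← h1, line_mod ha']

end Arithmetic

/-! ### Identification of vertices -/

/-- `(i, a)` and `(j, b)` are non-adjacent, where `g` lists the entries of the adjacency matrix. -/
def Cross (k n : ℕ) (g : ℕ → ℕ) (i a j b : ℕ) : Prop :=
  i < j ∧ j < k ∧ a < n ∧ b < n ∧ g ((i * n + a) * (k * n) + (j * n + b)) = 0

/-- The vertices before the identifications at crossings. -/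
def base (k n v : ℕ) : ℕ :=
  if v % width k n = 0 then k * n * width k n + v / width k n / n
  else if v % width k n = width k n - 1 then k * n * width k n + k + v / width k n / n
  else v

/-- The crossing of two lines, numbered as in the adjacency matrix, needs an identification. -/
def CrossAt (k n : ℕ) (g : ℕ → ℕ) (t : ℕ) : Prop :=
  t / (k * n) / n < t % (k * n) / n ∧ g t = 0

instance (k n : ℕ) (g : ℕ → ℕ) (t : ℕ) : Decidable (CrossAt k n g t) :=
  inferInstanceAs (Decidable (_ ∧ _))

/-- The time of the crossing number `t`. -/
def timeAt (k n t : ℕ) : ℕ :=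
  time k n (t / (k * n) / n) (t / (k * n) % n) (t % (k * n) / n) (t % (k * n) % n)

/-- The crossing number `t` on the line of the larger part. -/
def upperAt (k n t : ℕ) : ℕ :=
  vtx k n (t % (k * n) / n) (t % (k * n) % n)
    (pos k (t % (k * n) / n) (t % (k * n) % n) (timeAt k n t))

/-- The crossing number `t` on the line of the smaller part. -/
def lowerAt (k n t : ℕ) : ℕ :=
  vtx k n (t / (k * n) / n) (t / (k * n) % n)
    (pos k (t / (k * n) / n) (t / (k * n) % n) (timeAt k n t))

/-- The vertices after the identifications at the first `t` crossings. -/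
def table (k n : ℕ) (g : ℕ → ℕ) : ℕ → ℕ → ℕ
  | 0 => base k n
  | t + 1 => if CrossAt k n g t then
      Function.update (table k n g t) (upperAt k n t) (lowerAt k n t) else table k n g t

/-- The vertices after all identifications. -/
def rep (k n : ℕ) (g : ℕ → ℕ) : ℕ → ℕ := table k n g (k * n * (k * n))

theorem table_cases (k n : ℕ) (g : ℕ → ℕ) (v T : ℕ) :
    (table k n g T v = base k n v ∧ ∀ t < T, CrossAt k n g t → upperAt k n t ≠ v) ∨
    ∃ t < T, CrossAt k n g t ∧ upperAt k n t = v ∧ table k n g T v = lowerAt k n t := by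
  induction T with
  | zero => exact Or.inl ⟨rfl, by simp⟩
  | succ T ih =>
    by_cases hc : CrossAt k n g T
    · by_cases hv : upperAt k n T = v
      · refine Or.inr ⟨T, by omega, hc, hv, ?_⟩
        rw [table, if_pos hc, ← hv, Function.update_self]
      · rw [table, if_pos hc, Function.update_of_ne (Ne.symm hv)]
        rcases ih with ⟨h1, h2⟩ | ⟨t, ht, h⟩
        · refine Or.inl ⟨h1, fun t ht hct => ?_⟩
          rcases Nat.lt_succ_iff_lt_or_eq.mp ht with h | rfl
          · exact h2 t h hct
          · exact hv
        · exact Or.inr ⟨t, by omega, h⟩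
    · rw [table, if_neg hc]
      rcases ih with ⟨h1, h2⟩ | ⟨t, ht, h⟩
      · refine Or.inl ⟨h1, fun t ht hct => ?_⟩
        rcases Nat.lt_succ_iff_lt_or_eq.mp ht with h | rfl
        · exact h2 t h hct
        · exact absurd hct hc
      · exact Or.inr ⟨t, by omega, h⟩

/-! ### Identifications at different crossings do not interfere -/

section Identification

variable {k n : ℕ} {g : ℕ → ℕ} {i a j b : ℕ}

theorem line_lt (hi : i < k) (ha : a < n) : i * n + a < k * n := by
  have := Nat.mul_le_mul_right n (show i + 1 ≤ k from hi)
  rw [add_mul] at this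
  omega

theorem Cross.exists_at (h : Cross k n g i a j b) :
    ∃ t < k * n * (k * n), CrossAt k n g t ∧
      upperAt k n t = vtx k n j b (pos k j b (time k n i a j b)) ∧
      lowerAt k n t = vtx k n i a (pos k i a (time k n i a j b)) := by
  obtain ⟨hij, hj, ha, hb, hg⟩ := h
  have h1 := line_lt (hij.trans hj) ha
  have h2 := line_lt hj hb
  have d : ((i * n + a) * (k * n) + (j * n + b)) / (k * n) = i * n + a := by
    rw [mul_comm, Nat.mul_add_div (by omega), Nat.div_eq_of_lt h2, add_zero]
  have m : ((i * n + a) * (k * n) + (j * n + b)) % (k * n) = j * n + b := by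
    rw [mul_comm, Nat.mul_add_mod, Nat.mod_eq_of_lt h2]
  refine ⟨(i * n + a) * (k * n) + (j * n + b), ?_, ⟨?_, hg⟩, ?_, ?_⟩
  · have := Nat.mul_le_mul_right (k * n) (show i * n + a + 1 ≤ k * n from h1)
    rw [add_mul] at this
    omega
  · rw [d, m, line_div ha, line_div hb]; exact hij
  · rw [upperAt, timeAt, d, m, line_div ha, line_div hb, line_mod ha, line_mod hb]
  · rw [lowerAt, timeAt, d, m, line_div ha, line_div hb, line_mod ha, line_mod hb]

theorem CrossAt.exists_cross {t : ℕ} (h : CrossAt k n g t) (ht : t < k * n * (k * n)) :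
    ∃ i a j b, Cross k n g i a j b ∧
      upperAt k n t = vtx k n j b (pos k j b (time k n i a j b)) ∧
      lowerAt k n t = vtx k n i a (pos k i a (time k n i a j b)) := by
  have h0 : 0 < k * n := Nat.pos_of_ne_zero fun h => by simp [h] at ht
  have hn : 0 < n := Nat.pos_of_ne_zero fun h => by simp [h] at h0
  have hm : t % (k * n) < k * n := Nat.mod_lt _ h0
  refine ⟨_, _, _, _, ⟨h.1, ?_, Nat.mod_lt _ hn, Nat.mod_lt _ hn, ?_⟩, rfl, rfl⟩
  · exact (Nat.div_lt_iff_lt_mul hn).mpr hm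
  · rw [Nat.div_add_mod', Nat.div_add_mod', Nat.div_add_mod']
    exact h.2

theorem Cross.pos_bounds (h : Cross k n g i a j b) :
    (0 < pos k i a (time k n i a j b) ∧ pos k i a (time k n i a j b) + 2 < width k n) ∧
    (0 < pos k j b (time k n i a j b) ∧ pos k j b (time k n i a j b) + 2 < width k n) := by
  obtain ⟨hij, hj, ha, hb, -⟩ := h
  have h1 := time_pos (k := k) (i := i) (a := a) (j := j) hb
  have h2 := time_le (hij.trans hj) hj ha hb
  exact ⟨⟨pos_pos h1, pos_lt (hij.trans hj) ha h2⟩, pos_pos h1, pos_lt hj hb h2⟩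

/-- No other crossing overwrites this entry of the table. A second crossing on `(j, b)` at the same
position has the same time, so by `time_separates` its other line belongs to part `i` too, and then
the time determines `a`. -/
theorem rep_cross (h : Cross k n g i a j b) :
    rep k n g (vtx k n j b (pos k j b (time k n i a j b))) =
      vtx k n i a (pos k i a (time k n i a j b)) := by
  obtain ⟨t, ht, hc, hu, hl⟩ := h.exists_at
  rcases table_cases k n g (vtx k n j b (pos k j b (time k n i a j b))) (k * n * (k * n)) with
    ⟨-, h2⟩ | ⟨t', ht', hc', hu', h'⟩
  · exact absurd hu (h2 t ht hc)
  · rw [rep, h']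
    obtain ⟨i', a', j', b', hcr, hu'', hl'⟩ := hc'.exists_cross ht'
    rw [hu''] at hu'
    have B := h.pos_bounds
    have B' := hcr.pos_bounds
    obtain ⟨rfl, rfl, hp⟩ := vtx_inj hcr.2.2.2.1 h.2.2.2.1 (by omega) (by omega) hu'
    have hτ := pos_inj hp
    obtain rfl : i' = i := by
      have := time_separates hcr.2.2.1 hcr.2.2.2.1 h.2.2.1 h.2.2.2.1 hτ
      omega
    obtain rfl : a' = a := by
      have e1 := time_add (k := k) (i := i') (a := a') (j := j') hcr.2.2.2.1.le
      have e2 := time_add (k := k) (i := i') (a := a) (j := j') hcr.2.2.2.1.le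
      exact Nat.eq_of_mul_eq_mul_left (nu_pos h.1 h.2.1) (by omega)
    exact hl'

/-- The vertex at position `s` of the line `(i, a)`. -/
def pt (k n : ℕ) (g : ℕ → ℕ) (i a s : ℕ) : ℕ := rep k n g (vtx k n i a s)

theorem pt_cases {s : ℕ} (ha : a < n) (hs : s < width k n) :
    (s = 0 ∧ pt k n g i a s = k * n * width k n + i) ∨
    (s = width k n - 1 ∧ pt k n g i a s = k * n * width k n + k + i) ∨
    (0 < s ∧ s + 1 < width k n ∧
      (pt k n g i a s = vtx k n i a s ∨ ∃ i' a', Cross k n g i' a' i a ∧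
        s = pos k i a (time k n i' a' i a) ∧
        pt k n g i a s = vtx k n i' a' (pos k i' a' (time k n i' a' i a)))) := by
  have hW := width_ge k n
  rcases table_cases k n g (vtx k n i a s) (k * n * (k * n)) with ⟨h, -⟩ | ⟨t, ht, hc, hu, h⟩
  · have e : pt k n g i a s = base k n (vtx k n i a s) := h
    rw [e, base, vtx_mod hs, vtx_div hs, line_div ha]
    by_cases h0 : s = 0
    · simp [h0]
    by_cases h1 : s = width k n - 1
    · rw [if_neg h0, if_pos h1]
      exact Or.inr (Or.inl ⟨h1, rfl⟩)
    · rw [if_neg h0, if_neg h1]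
      exact Or.inr (Or.inr ⟨by omega, by omega, Or.inl rfl⟩)
  · obtain ⟨i', a', j', b', hcr, hu', hl'⟩ := hc.exists_cross ht
    rw [hu'] at hu
    have B := hcr.pos_bounds
    obtain ⟨rfl, rfl, rfl⟩ := vtx_inj hcr.2.2.2.1 ha (by omega) hs hu
    exact Or.inr (Or.inr ⟨by omega, by omega, Or.inr ⟨i', a', hcr, rfl, h.trans hl'⟩⟩)

/-- Identifications form no chains. If the vertex on the lower line were itself moved to a line of a
part `i' < i`, the equal times would give `i' + i = i + j`, contrary to `i' < i < j`. -/
theorem Cross.pt_lower (h : Cross k n g i a j b) :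
    pt k n g i a (pos k i a (time k n i a j b)) = vtx k n i a (pos k i a (time k n i a j b)) := by
  have B := h.pos_bounds
  rcases pt_cases (i := i) (g := g) h.2.2.1 (show pos k i a (time k n i a j b) < width k n by omega) with
    h' | h' | ⟨-, -, h' | ⟨i', a', hcr, hp, -⟩⟩
  · omega
  · omega
  · exact h'
  · have hτ := pos_inj hp
    have := time_separates h.2.2.1 h.2.2.2.1 hcr.2.2.1 hcr.2.2.2.1 hτ
    have h1 := h.1
    have h2 := hcr.1
    omega

/-- Lines of different parts have a common vertex only where they are made to cross. -/
theorem cross_of_pt_eq {s s' : ℕ} (hij : i < j) (hj : j < k) (ha : a < n) (hb : b < n)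
    (hs : s < width k n) (hs' : s' < width k n) (h : pt k n g i a s = pt k n g j b s') :
    Cross k n g i a j b := by
  have lt : ∀ i' a' s', i' < k → a' < n → s' < width k n →
    vtx k n i' a' s' < k * n * width k n := fun i' a' s' => vtx_lt
  have l1 := lt i a s (by omega) ha hs
  have l2 := lt j b s' hj hb hs'
  have aux : ∀ {i' a' j b}, Cross k n g i' a' j b →
      vtx k n i' a' (pos k i' a' (time k n i' a' j b)) < k * n * width k n := fun hcr => by
    have B := hcr.pos_bounds
    exact lt _ _ _ (hcr.1.trans hcr.2.1) hcr.2.2.1 (by omega)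
  -- Sources and targets are numbered above all line vertices, so only the four cases with two line
  -- vertices survive `omega`. The second of them is the desired crossing. In the last one both
  -- vertices moved to the same place of a third line, and equal times give `i = j`.
  rcases pt_cases (i := i) (g := g) ha hs with h1 | h1 | ⟨-, -, h1 | ⟨i₁, a₁, c₁, hp₁, h1⟩⟩ <;>
  rcases pt_cases (i := j) (g := g) hb hs' with h2 | h2 | ⟨-, -, h2 | ⟨i₂, a₂, c₂, hp₂, h2⟩⟩
  all_goals try have d₁ := aux c₁
  all_goals try have d₂ := aux c₂
  all_goals try omega
  · have := vtx_inj ha hb hs hs' (h1.symm.trans (h.trans h2))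
    omega
  · have B := c₂.pos_bounds
    obtain ⟨rfl, rfl, -⟩ := vtx_inj ha c₂.2.2.1 hs (by omega) (h1.symm.trans (h.trans h2))
    exact c₂
  · have B := c₁.pos_bounds
    have := vtx_inj c₁.2.2.1 hb (by omega) hs' (h1.symm.trans (h.trans h2))
    have := c₁.1
    omega
  · have B := c₁.pos_bounds
    have B' := c₂.pos_bounds
    obtain ⟨rfl, rfl, hp⟩ := vtx_inj c₁.2.2.1 c₂.2.2.1 (by omega) (by omega)
      (h1.symm.trans (h.trans h2))
    have := time_separates c₁.2.2.1 c₁.2.2.2.1 c₂.2.2.1 c₂.2.2.2.1 (pos_inj hp)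
    omega

end Identification

end Lines

end FineGrained

namespace FineGrained

namespace Lines

/-! ### Coordinates and potentials -/

/-- The time coordinate of position `s` on the line `(i, a)`. -/
noncomputable def tcoord (k i a s : ℕ) : ℚ :=
  ((s : ℚ) / 2 - 2 * (i + 1) * k.factorial * a) / (i + 1) ^ 2

/-- The space coordinate of position `s` on the line `(i, a)`. -/
noncomputable def ycoord (k n i a s : ℕ) : ℚ :=
  (i + 1) * tcoord k i a s + k.factorial * a - gap k n * (i + 1) ^ 2

/-- A linear function of the coordinates that measures the position on the lines of part `c`. -/
noncomputable def potential (k n c i a s : ℕ) : ℚ :=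
  2 * (2 * (c + 1) * ycoord k n i a s - (c + 1) ^ 2 * tcoord k i a s + 2 * gap k n * (c + 1) ^ 3)

theorem tcoord_pos (k i a τ : ℕ) : tcoord k i a (pos k i a τ) = τ := by
  rw [tcoord, pos]
  push_cast
  field_simp
  ring

theorem tcoord_succ (k i a s : ℕ) :
    tcoord k i a (s + 1) = tcoord k i a s + 1 / (2 * ((i : ℚ) + 1) ^ 2) := by
  rw [tcoord, tcoord]
  push_cast
  field_simp
  ring

/-- This identity dictates the form of `pos`. Substituting the equation of the line turns the
potential into `2 ((c + 1)² t + 2 (c + 1) k! a)`; the term `2 gap (c + 1)³` cancels the offset of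
the line. -/
theorem potential_self (k n c a s : ℕ) : potential k n c c a s = s := by
  rw [potential, ycoord, tcoord]
  field_simp
  ring

/-- A step on a line of slope `i + 1` takes time `1 / (2 (i + 1)²)`. With `r = (c + 1) / (i + 1)`
the potential gains `2r - r² = 1 - (1 - r)²`, which is maximal exactly for the slope of part `c`. -/
theorem potential_succ (k n c i a s : ℕ) :
    potential k n c i a (s + 1) =
      potential k n c i a s + 1 - (((i : ℚ) - c) / (i + 1)) ^ 2 := by
  rw [potential, potential, ycoord, ycoord, tcoord_succ]
  field_simp
  ring

theorem potential_succ_lt {c i : ℕ} (k n a s : ℕ) (h : i ≠ c) :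
    potential k n c i a (s + 1) < potential k n c i a s + 1 := by
  rw [potential_succ]
  have h1 : ((i : ℚ) - c) ≠ 0 := sub_ne_zero.mpr (by exact_mod_cast h)
  have h2 : ((i : ℚ) - c) / (i + 1) ≠ 0 := div_ne_zero h1 (by positivity)
  have := pow_pos (abs_pos.mpr h2) 2
  rw [sq_abs] at this
  linarith

variable {k n : ℕ} {g : ℕ → ℕ} {i a j b : ℕ}

theorem Cross.tcoord_eq (_h : Cross k n g i a j b) :
    tcoord k i a (pos k i a (time k n i a j b)) = tcoord k j b (pos k j b (time k n i a j b)) := by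
  rw [tcoord_pos, tcoord_pos]

/-- Equating the two line equations and dividing by `j - i` gives `time_add`, so `time` is the time
of the geometric crossing. Functions of the coordinates therefore descend to the identified
vertices. -/
theorem Cross.ycoord_eq (h : Cross k n g i a j b) :
    ycoord k n i a (pos k i a (time k n i a j b)) =
      ycoord k n j b (pos k j b (time k n i a j b)) := by
  rw [ycoord, ycoord, tcoord_pos, tcoord_pos]
  have e := time_add (k := k) (i := i) (a := a) (j := j) h.2.2.2.1.le
  have e' : (time k n i a j b : ℚ) + (k.factorial / (j - i) : ℕ) * b =
      gap k n * (i + j + 2) + (k.factorial / (j - i) : ℕ) * a := by exact_mod_cast e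
  have f' : ((k.factorial / (j - i) : ℕ) : ℚ) * (j - i) = k.factorial := by
    have := nu_mul h.1 h.2.1
    rw [← Nat.cast_sub h.1.le]
    exact_mod_cast this
  rw [← f']
  linear_combination ((i : ℚ) - j) * e'

/-- Extension of a function on the vertices of the lines to the sources and targets. -/
noncomputable def extend (k n : ℕ) (f : ℕ → ℕ → ℕ → ℚ) (lo hi : ℕ → ℚ) (w : ℕ) : ℚ :=
  if w < k * n * width k n then f (w / width k n / n) (w / width k n % n) (w % width k n)
  else if w < k * n * width k n + k then lo (w - k * n * width k n)
  else hi (w - (k * n * width k n + k))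

theorem extend_vtx {f : ℕ → ℕ → ℕ → ℚ} {lo hi : ℕ → ℚ} {s : ℕ} (hi' : i < k) (ha : a < n)
    (hs : s < width k n) : extend k n f lo hi (vtx k n i a s) = f i a s := by
  rw [extend, if_pos (vtx_lt hi' ha hs), vtx_div hs, vtx_mod hs, line_div ha, line_mod ha]

theorem extend_pt_zero {f : ℕ → ℕ → ℕ → ℚ} {lo hi : ℕ → ℚ} (hi' : i < k) (ha : a < n) :
    extend k n f lo hi (pt k n g i a 0) = lo i := by
  have hW := width_ge k n
  have h : pt k n g i a 0 = k * n * width k n + i := by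
    rcases pt_cases (i := i) (g := g) ha (show 0 < width k n by omega) with h | h | h <;> omega
  rw [extend, h, if_neg (by omega), if_pos (by omega), Nat.add_sub_cancel_left]

theorem extend_pt_last {f : ℕ → ℕ → ℕ → ℚ} {lo hi : ℕ → ℚ} {s : ℕ} (ha : a < n)
    (hs : s + 1 = width k n) : extend k n f lo hi (pt k n g i a s) = hi i := by
  have hW := width_ge k n
  have h : pt k n g i a s = k * n * width k n + k + i := by
    rcases pt_cases (i := i) (g := g) ha (show s < width k n by omega) with h | h | h <;> omega
  rw [extend, h, if_neg (by omega), if_neg (by omega), Nat.add_sub_cancel_left]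

/-- At an inner position, a function of the coordinates has the same value before and after the
identification. -/
theorem extend_pt {F : ℚ → ℚ → ℚ} {lo hi : ℕ → ℚ} {s : ℕ} (hi' : i < k) (ha : a < n)
    (hs0 : 0 < s) (hs : s + 1 < width k n) :
    extend k n (fun i a s => F (tcoord k i a s) (ycoord k n i a s)) lo hi (pt k n g i a s) =
      F (tcoord k i a s) (ycoord k n i a s) := by
  rcases pt_cases (i := i) (g := g) ha (show s < width k n by omega) with
    h | h | ⟨-, -, h | ⟨i', a', c, hp, h⟩⟩
  · omega
  · omega
  · rw [h, extend_vtx hi' ha (by omega)]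
  · have B := c.pos_bounds
    rw [h, extend_vtx (c.1.trans hi') c.2.2.1 (by omega), c.tcoord_eq, c.ycoord_eq, ← hp]

/-- The edges of the graph. -/
def IsEdge (k n : ℕ) (g : ℕ → ℕ) (x y : ℕ) : Prop :=
  ∃ i a s, i < k ∧ a < n ∧ s + 1 < width k n ∧ x = pt k n g i a s ∧ y = pt k n g i a (s + 1)

/-- A bound for the values of a function on the vertices of the lines. -/
noncomputable def valueBound (k n : ℕ) (f : ℕ → ℕ → ℕ → ℚ) : ℚ :=
  ∑ i ∈ Finset.range k, ∑ a ∈ Finset.range n, ∑ s ∈ Finset.range (width k n), |f i a s| + 1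

theorem lt_valueBound {f : ℕ → ℕ → ℕ → ℚ} {s : ℕ} (hi : i < k) (ha : a < n)
    (hs : s < width k n) : |f i a s| < valueBound k n f := by
  have h1 := Finset.single_le_sum (f := fun s => |f i a s|) (fun s _ => abs_nonneg _)
    (Finset.mem_range.mpr hs)
  have h2 := Finset.single_le_sum (f := fun a => ∑ s ∈ Finset.range (width k n), |f i a s|)
    (fun a _ => Finset.sum_nonneg fun s _ => abs_nonneg _) (Finset.mem_range.mpr ha)
  have h3 := Finset.single_le_sum
    (f := fun i => ∑ a ∈ Finset.range n, ∑ s ∈ Finset.range (width k n), |f i a s|)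
    (fun i _ => Finset.sum_nonneg fun a _ => Finset.sum_nonneg fun s _ => abs_nonneg _)
    (Finset.mem_range.mpr hi)
  have h4 := h1.trans (h2.trans h3)
  exact lt_of_le_of_lt h4 (lt_add_one _)

/-- A function that increases along all edges. -/
noncomputable def rank (k n : ℕ) : ℕ → ℚ :=
  extend k n (fun i a s => tcoord k i a s)
    (fun _ => -valueBound k n fun i a s => tcoord k i a s)
    (fun _ => valueBound k n fun i a s => tcoord k i a s)

theorem rank_pt {s : ℕ} (hi : i < k) (ha : a < n) (hs0 : 0 < s) (hs : s + 1 < width k n) :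
    rank k n (pt k n g i a s) = tcoord k i a s :=
  extend_pt (F := fun t _ => t) hi ha hs0 hs

/-- Time grows along every line and agrees on both lines at a crossing; sources get a value below
and targets a value above all times. This makes the graph acyclic. -/
theorem IsEdge.rank_lt {x y : ℕ} (h : IsEdge k n g x y) : rank k n x < rank k n y := by
  obtain ⟨i, a, s, hi, ha, hs, rfl, rfl⟩ := h
  have hW := width_ge k n
  have l0 := abs_lt.mp (lt_valueBound (f := fun i a s => tcoord k i a s) hi ha
    (show s < width k n by omega))
  have l1 := abs_lt.mp (lt_valueBound (f := fun i a s => tcoord k i a s) hi ha hs)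
  by_cases h0 : s = 0
  · subst h0
    rw [rank_pt (s := 0 + 1) hi ha (by omega) (by omega), rank, extend_pt_zero hi ha]
    exact l1.1
  · rw [rank_pt hi ha (by omega) hs]
    by_cases h1 : s + 1 + 1 = width k n
    · rw [rank, extend_pt_last ha h1]
      exact l0.2
    · rw [rank_pt hi ha (by omega) (by omega), tcoord_succ]
      have : (0 : ℚ) < 1 / (2 * ((i : ℚ) + 1) ^ 2) := by positivity
      linarith

/-- The potential of part `c`, on all vertices. -/
noncomputable def pot (k n c : ℕ) : ℕ → ℚ :=
  extend k n (potential k n c)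
    -- For part `c` the ends continue the count of positions. For the other parts a high value at
    -- the source and a low one at the target make the potential drop along the first and the last
    -- edge of their lines.
    (fun i => if i = c then 0 else valueBound k n (potential k n c))
    (fun i => if i = c then width k n - 1 else -valueBound k n (potential k n c))

theorem pot_pt {c s : ℕ} (hi : i < k) (ha : a < n) (hs0 : 0 < s) (hs : s + 1 < width k n) :
    pot k n c (pt k n g i a s) = potential k n c i a s :=
  extend_pt (F := fun t y => 2 * (2 * (c + 1) * y - (c + 1) ^ 2 * t + 2 * gap k n * (c + 1) ^ 3))
    hi ha hs0 hs

theorem pot_pt_self {c s : ℕ} (hc : c < k) (ha : a < n) (hs : s < width k n) :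
    pot k n c (pt k n g c a s) = s := by
  by_cases h0 : s = 0
  · subst h0
    rw [pot, extend_pt_zero hc ha, if_pos rfl, Nat.cast_zero]
  · by_cases h1 : s + 1 = width k n
    · rw [pot, extend_pt_last ha h1, if_pos rfl, ← h1]
      push_cast
      ring
    · rw [pot_pt hc ha (by omega) (by omega), potential_self]

theorem pot_edge_lt {c s : ℕ} (hi : i < k) (ha : a < n) (hs : s + 1 < width k n) (hic : i ≠ c) :
    pot k n c (pt k n g i a (s + 1)) < pot k n c (pt k n g i a s) + 1 := by
  have hW := width_ge k n
  have l0 := abs_lt.mp (lt_valueBound (f := potential k n c) hi ha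
    (show s < width k n by omega))
  have l1 := abs_lt.mp (lt_valueBound (f := potential k n c) hi ha hs)
  by_cases h0 : s = 0
  · subst h0
    rw [pot_pt (s := 0 + 1) hi ha (by omega) (by omega), pot, extend_pt_zero hi ha, if_neg hic]
    linarith [l1.2]
  · rw [pot_pt hi ha (by omega) hs]
    by_cases h1 : s + 1 + 1 = width k n
    · rw [pot, extend_pt_last ha h1, if_neg hic]
      linarith [l0.1]
    · rw [pot_pt hi ha (by omega) (by omega)]
      exact potential_succ_lt k n a s hic

theorem IsEdge.pot_le {x y : ℕ} (c : ℕ) (h : IsEdge k n g x y) :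
    pot k n c y ≤ pot k n c x + 1 := by
  obtain ⟨i, a, s, hi, ha, hs, rfl, rfl⟩ := h
  by_cases hic : i = c
  · subst hic
    rw [pot_pt_self hi ha hs, pot_pt_self hi ha (by omega)]
    push_cast
    rfl
  · exact (pot_edge_lt hi ha hs hic).le

theorem IsEdge.exists_of_pot_eq {x y c : ℕ} (h : IsEdge k n g x y)
    (hp : pot k n c y = pot k n c x + 1) :
    ∃ a s, c < k ∧ a < n ∧ s + 1 < width k n ∧ x = pt k n g c a s ∧ y = pt k n g c a (s + 1) := by
  obtain ⟨i, a, s, hi, ha, hs, rfl, rfl⟩ := h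
  by_cases hic : i = c
  · subst hic
    exact ⟨a, s, hi, ha, hs, rfl, rfl⟩
  · exact absurd hp (pot_edge_lt hi ha hs hic).ne

/-- Different lines of one part have no common vertex inside. -/
theorem pt_line_inj {a' s : ℕ} (hi : i < k) (ha : a < n) (ha' : a' < n) (hs0 : 0 < s)
    (hs : s + 1 < width k n) (h : pt k n g i a s = pt k n g i a' s) : a = a' := by
  -- Parallel lines reach the position `s` at different times, because of the summand with `a` in
  -- `pos`; and the time can be read off the identified vertex.
  have ht : tcoord k i a s = tcoord k i a' s := by
    rw [← rank_pt (g := g) hi ha hs0 hs, h, rank_pt hi ha' hs0 hs]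
  rw [tcoord, tcoord, div_left_inj' (by positivity), sub_right_inj] at ht
  have h2 : (2 * ((i : ℚ) + 1) * k.factorial) ≠ 0 := by
    have := Nat.factorial_pos k
    positivity
  exact_mod_cast mul_left_cancel₀ h2 ht

end Lines

end FineGrained

/-! ### The constructed instance of `k`-DSP and its shortest paths -/

namespace FineGrained

namespace Lines

/-- The number of vertices of the graph. -/
def numVertices (k n : ℕ) : ℕ := k * n * width k n + 2 * k

/-- The number of edges of the graph. -/
def numEdges (k n : ℕ) : ℕ := k * n * (width k n - 1)

/-- The line vertex, before identifications, in which the `e`-th edge begins. -/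
def edgeStart (k n e : ℕ) : ℕ := e / (width k n - 1) * width k n + e % (width k n - 1)

variable {k n : ℕ} {g : ℕ → ℕ}

theorem pt_lt {i a s : ℕ} (hi : i < k) (ha : a < n) (hs : s < width k n) :
    pt k n g i a s < numVertices k n := by
  rw [numVertices]
  rcases pt_cases (i := i) (g := g) ha hs with h | h | ⟨-, -, h | ⟨i', a', c, hp, h⟩⟩
  · omega
  · omega
  · have := vtx_lt hi ha hs
    omega
  · have B := c.pos_bounds
    have := vtx_lt (c.1.trans c.2.1) c.2.2.1 (show pos k i' a' (time k n i' a' i a) < width k n by omega)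
    omega

theorem edgeStart_eq_vtx {e : ℕ} (he : e < numEdges k n) :
    ∃ i a s, i < k ∧ a < n ∧ s + 1 < width k n ∧ edgeStart k n e = vtx k n i a s := by
  have hW := width_ge k n
  have h0 : e / (width k n - 1) < k * n := (Nat.div_lt_iff_lt_mul (by omega)).mpr he
  have hn : 0 < n := Nat.pos_of_ne_zero fun h => by simp [h] at h0
  have hs : e % (width k n - 1) < width k n - 1 := Nat.mod_lt _ (by omega)
  refine ⟨e / (width k n - 1) / n, e / (width k n - 1) % n, e % (width k n - 1),
    (Nat.div_lt_iff_lt_mul hn).mpr h0, Nat.mod_lt _ hn, by omega, ?_⟩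
  rw [vtx, Nat.div_add_mod', edgeStart]

theorem exists_edgeStart {i a s : ℕ} (hi : i < k) (ha : a < n) (hs : s + 1 < width k n) :
    ∃ e < numEdges k n, edgeStart k n e = vtx k n i a s := by
  have hW := width_ge k n
  refine ⟨(i * n + a) * (width k n - 1) + s, ?_, ?_⟩
  · have := Nat.mul_le_mul_right (width k n - 1) (show i * n + a + 1 ≤ k * n from line_lt hi ha)
    rw [add_mul] at this
    unfold numEdges
    omega
  · rw [edgeStart, vtx, mul_comm (i * n + a) (width k n - 1), Nat.mul_add_div (by omega),
      Nat.mul_add_mod, Nat.div_eq_of_lt (by omega), Nat.mod_eq_of_lt (by omega), add_zero]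

theorem edgeStart_inj {e e' : ℕ} (h : edgeStart k n e = edgeStart k n e') : e = e' := by
  have hW := width_ge k n
  have key : ∀ e, e = edgeStart k n e / width k n * (width k n - 1) +
      edgeStart k n e % width k n := by
    intro e
    have hs : e % (width k n - 1) < width k n := (Nat.mod_lt _ (by omega)).trans (by omega)
    rw [edgeStart, mul_comm _ (width k n), Nat.mul_add_div (by omega), Nat.mul_add_mod,
      Nat.div_eq_of_lt hs, Nat.mod_eq_of_lt hs, add_zero, Nat.div_add_mod']
  rw [key e, key e', h]

theorem rep_edgeStart_lt {e : ℕ} (he : e < numEdges k n) :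
    rep k n g (edgeStart k n e) < numVertices k n := by
  obtain ⟨i, a, s, hi, ha, hs, h⟩ := edgeStart_eq_vtx he
  rw [h]
  exact pt_lt hi ha (by omega)

theorem rep_edgeStart_succ_lt {e : ℕ} (he : e < numEdges k n) :
    rep k n g (edgeStart k n e + 1) < numVertices k n := by
  obtain ⟨i, a, s, hi, ha, hs, h⟩ := edgeStart_eq_vtx he
  rw [h]
  exact pt_lt hi ha hs

/-- The `e`-th edge. -/
def edge (k n : ℕ) (g : ℕ → ℕ) (e : Fin (numEdges k n)) :
    Fin (numVertices k n) × Fin (numVertices k n) :=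
  (⟨rep k n g (edgeStart k n e), rep_edgeStart_lt e.2⟩,
    ⟨rep k n g (edgeStart k n e + 1), rep_edgeStart_succ_lt e.2⟩)

theorem mem_ofFn_edge {x y : Fin (numVertices k n)} :
    (x, y) ∈ List.ofFn (edge k n g) ↔ IsEdge k n g x y := by
  rw [List.mem_ofFn]
  constructor
  · rintro ⟨e, he⟩
    obtain ⟨i, a, s, hi, ha, hs, h⟩ := edgeStart_eq_vtx e.2
    refine ⟨i, a, s, hi, ha, hs, ?_, ?_⟩
    · rw [← congrArg (fun p => (p.1 : ℕ)) he]; simp [edge, h, pt]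
    · rw [← congrArg (fun p => (p.2 : ℕ)) he]; simp [edge, h, pt, vtx, add_assoc]
  · rintro ⟨i, a, s, hi, ha, hs, hx, hy⟩
    obtain ⟨e, he, h⟩ := exists_edgeStart hi ha hs
    refine ⟨⟨e, he⟩, Prod.ext (Fin.ext ?_) (Fin.ext ?_)⟩
    · simp [edge, h, hx, pt]
    · simp [edge, h, hy, pt, vtx, add_assoc]

/-- Vertices at odd positions are not identified with other vertices. -/
theorem eq_of_pt_eq_of_odd {i a s i' a' s' : ℕ} (hi : i < k) (ha : a < n)
    (hs : s + 1 < width k n) (hodd : s % 2 = 1) (ha' : a' < n) (hs' : s' < width k n)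
    (h : pt k n g i a s = pt k n g i' a' s') : i = i' ∧ a = a' ∧ s = s' := by
  have h1 : pt k n g i a s = vtx k n i a s := by
    rcases pt_cases (i := i) (g := g) ha (show s < width k n by omega) with
      h | h | ⟨-, -, h | ⟨i₁, a₁, c, hp, -⟩⟩
    · omega
    · omega
    · exact h
    -- The factor `2` in `pos` places all identifications at even positions, so a vertex at an odd
    -- position is not moved.
    · have := pos_even k i a (time k n i₁ a₁ i a)
      omega
  have hlt := vtx_lt hi ha (show s < width k n by omega)
  rw [h1] at h
  rcases pt_cases (i := i') (g := g) ha' hs' with h' | h' | ⟨-, -, h' | ⟨i₁, a₁, c, hp, h'⟩⟩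
  · omega
  · omega
  · exact vtx_inj ha ha' (by omega) hs' (h.trans h')
  · have B := c.pos_bounds
    have := vtx_inj ha c.2.2.1 (by omega) (by omega) (h.trans h')
    have := pos_even k i₁ a₁ (time k n i₁ a₁ i' a')
    omega

/-- The list of edges must have no repetitions. One end of every edge is at an odd position, which
is never identified with another vertex and so determines the line and the edge. -/
theorem edge_injective (k n : ℕ) (g : ℕ → ℕ) : Function.Injective (edge k n g) := by
  intro e e' he
  obtain ⟨i, a, s, hi, ha, hs, h⟩ := edgeStart_eq_vtx e.2
  obtain ⟨i', a', s', hi', ha', hs', h'⟩ := edgeStart_eq_vtx e'.2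
  have hodd := width_odd k n
  have h1 : pt k n g i a s = pt k n g i' a' s' := by
    have := congrArg (fun p => (p.1 : ℕ)) he
    simpa [edge, h, h', pt] using this
  have h2 : pt k n g i a (s + 1) = pt k n g i' a' (s' + 1) := by
    have := congrArg (fun p => (p.2 : ℕ)) he
    simpa [edge, h, h', pt, vtx, add_assoc] using this
  refine Fin.ext (edgeStart_inj (k := k) (n := n) ?_)
  rw [h, h']
  rcases Nat.mod_two_eq_zero_or_one s with hp | hp
  · obtain ⟨rfl, rfl, hss⟩ := eq_of_pt_eq_of_odd hi ha (by omega) (by omega) ha' hs' h2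
    obtain rfl : s = s' := by omega
    rfl
  · obtain ⟨rfl, rfl, rfl⟩ := eq_of_pt_eq_of_odd hi ha hs hp ha' (by omega) h1
    rfl

/-- The instance of `k`-DSP that belongs to an instance of `k`-Clique with the entries `g` of the
adjacency matrix. -/
def dsp (k n : ℕ) (g : ℕ → ℕ) : DSPInstance k where
  n := numVertices k n
  edges := List.ofFn (edge k n g)
  nodup := List.nodup_ofFn.mpr (edge_injective k n g)
  acyclic := by
    have key : ∀ u v : Fin (numVertices k n),
        Relation.TransGen (fun u w => (u, w) ∈ List.ofFn (edge k n g)) u v →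
        rank k n u < rank k n v := by
      intro u v h
      induction h with
      | single h => exact (mem_ofFn_edge.mp h).rank_lt
      | tail _ h ih => exact ih.trans (mem_ofFn_edge.mp h).rank_lt
    exact fun v h => lt_irrefl _ (key v v h)
  source := fun i => ⟨k * n * width k n + i, by have := i.2; unfold numVertices; omega⟩
  target := fun i => ⟨k * n * width k n + k + i, by have := i.2; unfold numVertices; omega⟩

theorem pot_source (c : Fin k) : pot k n c ((dsp k n g).source c) = 0 := by
  have := c.2
  rw [pot, extend, dsp]
  simp

theorem pot_target (c : Fin k) : pot k n c ((dsp k n g).target c) = width k n - 1 := by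
  have := c.2
  rw [pot, extend, dsp]
  simp only
  rw [if_neg (by omega), if_neg (by omega), if_pos (by omega)]

theorem pot_getElem_le {P : List (Fin (dsp k n g).n)} (c : ℕ)
    (hP : P.IsChain fun a b => (a, b) ∈ (dsp k n g).edges) (m d : ℕ) (h : m + d < P.length) :
    pot k n c P[m + d] ≤ pot k n c P[m] + d := by
  induction d with
  | zero => simp
  | succ d ih =>
    have h1 := (mem_ofFn_edge.mp (List.isChain_iff_getElem.mp hP (m + d) (by omega))).pot_le c
    have h2 := ih (by omega)
    push_cast
    have : P[m + (d + 1)] = P[m + d + 1] := rfl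
    rw [this]
    linarith

theorem IsPath.ends {x : DSPInstance k} {P : List (Fin x.n)} {u v : Fin x.n}
    (h : x.IsPath P u v) : ∃ h0 : 0 < P.length, P[0] = u ∧ P[P.length - 1] = v := by
  obtain ⟨-, -, h1, h2⟩ := h
  rw [List.head?_eq_getElem?] at h1
  rw [List.getLast?_eq_getElem?] at h2
  obtain ⟨h0, h1⟩ := List.getElem?_eq_some_iff.mp h1
  obtain ⟨h0', h2⟩ := List.getElem?_eq_some_iff.mp h2
  exact ⟨h0, h1, h2⟩

/-- The potential of part `c` has to grow from `0` to `width - 1`, and no edge adds more than `1`.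
-/
theorem width_le_length {P : List (Fin (dsp k n g).n)} {c : Fin k}
    (h : (dsp k n g).IsPath P ((dsp k n g).source c) ((dsp k n g).target c)) :
    width k n ≤ P.length := by
  obtain ⟨h0, h1, h2⟩ := IsPath.ends h
  have h3 := pot_getElem_le (g := g) c h.1 0 (P.length - 1) (by omega)
  simp only [zero_add] at h3
  rw [h1, h2, pot_source, pot_target, Nat.cast_sub (by omega)] at h3
  have : (width k n : ℚ) ≤ P.length := by push_cast at h3; linarith
  exact_mod_cast this

/-- With so few edges each one must add exactly `1` to the potential of part `c`. So every edge lies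
on a line of part `c`, and the `s`-th one starts at position `s`. Consecutive edges meet in an inner
vertex, and different lines of one part have none in common. -/
theorem exists_line_of_isPath {P : List (Fin (dsp k n g).n)} {c : Fin k}
    (h : (dsp k n g).IsPath P ((dsp k n g).source c) ((dsp k n g).target c))
    (hlen : P.length ≤ width k n) :
    ∃ a < n, ∀ (s : ℕ) (hs : s < P.length), (P[s] : ℕ) = pt k n g c a s := by
  have hW := width_ge k n
  have hlen' : P.length = width k n := le_antisymm hlen (width_le_length h)
  obtain ⟨h0, h1, h2⟩ := IsPath.ends h
  have hpot : ∀ (s : ℕ) (hs : s < P.length), pot k n c P[s] = s := by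
    intro s hs
    have a1 := pot_getElem_le (g := g) c h.1 0 s (by omega)
    -- Counting back from the target gives the opposite inequality, so that the potential at index
    -- `s` is exactly `s`.
    have a2 := pot_getElem_le (g := g) c h.1 s (P.length - 1 - s) (by omega)
    have e : P[s + (P.length - 1 - s)]'(by omega) = P[P.length - 1] := by congr 1; omega
    simp only [zero_add] at a1
    rw [h1, pot_source] at a1
    rw [e, h2, pot_target, Nat.cast_sub (by omega), Nat.cast_sub (by omega)] at a2
    have hq : (P.length : ℚ) = width k n := by exact_mod_cast hlen'
    push_cast at a2
    linarith
  have hedge : ∀ (s : ℕ) (hs : s + 1 < P.length), ∃ a, a < n ∧ (P[s] : ℕ) = pt k n g c a s ∧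
      (P[s + 1] : ℕ) = pt k n g c a (s + 1) := by
    intro s hs
    obtain ⟨a, s', hc, ha, hs', e1, e2⟩ :=
      (mem_ofFn_edge.mp (List.isChain_iff_getElem.mp h.1 s hs)).exists_of_pot_eq (c := c) (by
        rw [hpot s (by omega), hpot (s + 1) hs]; push_cast; rfl)
    have : s = s' := by
      have e3 := hpot s (by omega)
      rw [e1, pot_pt_self hc ha (by omega)] at e3
      exact_mod_cast e3.symm
    subst this
    exact ⟨a, ha, e1, e2⟩
  obtain ⟨a, ha, e0, e1⟩ := hedge 0 (by omega)
  have main : ∀ (s : ℕ) (hs : s + 1 < P.length), (P[s] : ℕ) = pt k n g c a s ∧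
      (P[s + 1] : ℕ) = pt k n g c a (s + 1) := by
    intro s
    induction s with
    | zero => exact fun _ => ⟨e0, e1⟩
    | succ s ih =>
      intro hs
      obtain ⟨a', ha', e2, e3⟩ := hedge (s + 1) hs
      have e4 := (ih (by omega)).2
      obtain rfl := pt_line_inj c.2 ha ha' (by omega) (by omega) (e4.symm.trans e2)
      exact ⟨e2, e3⟩
  refine ⟨a, ha, fun s hs => ?_⟩
  rcases Nat.eq_zero_or_pos s with rfl | hs0
  · exact e0
  · obtain ⟨s, rfl⟩ := Nat.exists_eq_succ_of_ne_zero hs0.ne'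
    exact (main s hs).2

/-- The line `(c, a)` as a list of vertices. -/
def line (k n : ℕ) (g : ℕ → ℕ) (c : Fin k) (a : Fin n) : List (Fin (dsp k n g).n) :=
  List.ofFn fun s : Fin (width k n) => ⟨pt k n g c a s, pt_lt c.2 a.2 s.2⟩

theorem line_isPath (c : Fin k) (a : Fin n) :
    (dsp k n g).IsPath (line k n g c a) ((dsp k n g).source c) ((dsp k n g).target c) := by
  have hW := width_ge k n
  refine ⟨?_, ?_, ?_, ?_⟩
  · rw [List.isChain_iff_getElem]
    intro s hs
    refine mem_ofFn_edge.mpr ⟨c, a, s, c.2, a.2, ?_, ?_, ?_⟩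
    · simpa [line] using hs
    · simp [line]
    · simp [line]
  -- The potential of part `c` recovers the position, so a line never meets itself.
  · refine List.nodup_ofFn.mpr fun s s' hss => Fin.ext ?_
    have h1 : pt k n g c a s = pt k n g c a s' := congrArg Fin.val hss
    have h2 := pot_pt_self (g := g) c.2 a.2 s.2
    rw [h1, pot_pt_self c.2 a.2 s'.2] at h2
    exact_mod_cast h2.symm
  · rw [List.head?_eq_getElem?, List.getElem?_eq_some_iff]
    refine ⟨by simp [line]; omega, Fin.ext ?_⟩
    have h : pt k n g c a 0 = k * n * width k n + c := by
      rcases pt_cases (i := c) (g := g) a.2 (show 0 < width k n by omega) with h | h | h <;> omega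
    simpa [line, dsp] using h
  · rw [List.getLast?_eq_getElem?, List.getElem?_eq_some_iff]
    refine ⟨by simp [line]; omega, Fin.ext ?_⟩
    have h : pt k n g c a (width k n - 1) = k * n * width k n + k + c := by
      rcases pt_cases (i := c) (g := g) a.2 (show width k n - 1 < width k n by omega) with
        h | h | h <;> omega
    simpa [line, dsp] using h

/-- The shortest paths of part `i` are its lines, so a system of them is a choice of one vertex `c
i` per part. Two chosen lines meet exactly if a zero in the adjacency matrix made them cross. -/
theorem hasDisjointShortestPaths_iff :
    (dsp k n g).HasDisjointShortestPaths ↔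
      ∃ c : Fin k → Fin n, ∀ i j : Fin k, i < j →
        g ((i * n + c i) * (k * n) + (j * n + c j)) ≠ 0 := by
  have hW := width_ge k n
  constructor
  · rintro ⟨P, hP, hdisj⟩
    -- For `n = 0` there are no lines at all. The first edge of a given path provides one.
    have hn : 0 < k → 0 < n := by
      intro hk
      have h1 := width_le_length (hP ⟨0, hk⟩).1
      obtain ⟨i, a, s, -, ha, -⟩ :=
        mem_ofFn_edge.mp (List.isChain_iff_getElem.mp (hP ⟨0, hk⟩).1.1 0 (by omega))
      omega
    have key : ∀ i, ∃ a : Fin n, ∀ (s : ℕ), s < width k n → ∃ hs : s < (P i).length,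
        ((P i)[s] : ℕ) = pt k n g i a s := by
      intro i
      have h1 := (hP i).2 _ (line_isPath i ⟨0, hn (by have := i.2; omega)⟩)
      obtain ⟨a, ha, h⟩ := exists_line_of_isPath (hP i).1 (by simpa [line] using h1)
      have h2 := width_le_length (hP i).1
      exact ⟨⟨a, ha⟩, fun s hs => ⟨by omega, h s (by omega)⟩⟩
    choose a ha using key
    refine ⟨a, fun i j hij h0 => ?_⟩
    have c : Cross k n g i (a i) j (a j) := ⟨hij, j.2, (a i).2, (a j).2, h0⟩
    have B := c.pos_bounds
    obtain ⟨h1, e1⟩ := ha i (pos k i (a i) (time k n i (a i) j (a j))) (by omega)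
    obtain ⟨h2, e2⟩ := ha j (pos k j (a j) (time k n i (a i) j (a j))) (by omega)
    rw [c.pt_lower] at e1
    have e3 := e2.trans (rep_cross c)
    have lt := vtx_lt i.2 (a i).2
      (show pos k i (a i) (time k n i (a i) j (a j)) < width k n by omega)
    -- The common vertex is a line vertex, numbered below `k * n * width k n`, whereas sources and
    -- targets are numbered from there on. So it is not an endpoint.
    have := (hdisj i j hij.ne _ (List.getElem_mem h1) (by
      rw [show (P i)[_] = (P j)[_] from Fin.ext (e1.trans e3.symm)]
      exact List.getElem_mem h2)).1
    rcases this with h | h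
    · rw [h] at e1
      simp only [dsp] at e1
      omega
    · rw [h] at e1
      simp only [dsp] at e1
      omega
  · rintro ⟨c, hc⟩
    refine ⟨fun i => line k n g i (c i), fun i => ⟨line_isPath i (c i), fun Q hQ => ?_⟩, ?_⟩
    · simpa [line] using width_le_length hQ
    · intro i j hij v hv hv'
      exfalso
      obtain ⟨s, hs⟩ := List.mem_ofFn.mp hv
      obtain ⟨s', hs'⟩ := List.mem_ofFn.mp hv'
      have h : pt k n g i (c i) s = pt k n g j (c j) s' := congrArg Fin.val (hs.trans hs'.symm)
      rcases lt_or_gt_of_ne hij with hlt | hlt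
      · exact hc i j hlt (cross_of_pt_eq hlt j.2 (c i).2 (c j).2 s.2 s'.2 h).2.2.2.2
      · exact hc j i hlt (cross_of_pt_eq hlt i.2 (c j).2 (c i).2 s'.2 s.2 h.symm).2.2.2.2

end Lines

end FineGrained

namespace FineGrained

/-! ### Instances as lists of words -/

theorem length_rowMajor {r s : ℕ} (A : Matrix (Fin r) (Fin s) ℕ) :
    (rowMajor A).length = r * s := by
  simp [rowMajor, List.length_flatten, List.map_ofFn, Function.comp_def]

theorem getD_rowMajor {r s : ℕ} (A : Matrix (Fin r) (Fin s) ℕ) (i : Fin r) (j : Fin s) :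
    (rowMajor A).getD (i * s + j) 0 = A i j := by
  have hs : 0 < s := by have := j.2; omega
  have hd : ∀ (i : ℕ) (j : Fin s), (i * s + j) / s = i := fun i j => by
    rw [mul_comm, Nat.mul_add_div hs, Nat.div_eq_of_lt j.2, add_zero]
  have hm : ∀ (i : ℕ) (j : Fin s), (i * s + j) % s = j := fun i j => by
    rw [mul_comm, Nat.mul_add_mod, Nat.mod_eq_of_lt j.2]
  have h : rowMajor A = List.ofFn fun t : Fin (r * s) => A t.divNat t.modNat := by
    rw [List.ofFn_mul, rowMajor]
    congr 2
    funext i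
    congr 1
    funext j
    congr 1
    · ext
      simp [Fin.divNat, hd]
    · ext
      simp [Fin.modNat, hm]
  have hlt : (i : ℕ) * s + j < r * s := by
    have := Nat.mul_le_mul_right s (show (i : ℕ) + 1 ≤ r from i.2)
    rw [add_mul] at this
    have := j.2
    omega
  rw [h, List.getD_eq_getElem _ _ (by simpa using hlt), List.getElem_ofFn]
  congr 1
  · ext
    simp [Fin.divNat, hd]
  · ext
    simp [Fin.modNat, hm]

theorem getElem?_flatMap_pair {α : Type*} (f g : α → ℕ) (l : List α) (t : ℕ) :
    (l.flatMap fun e => [f e, g e])[t]? =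
      (l[t / 2]?).map fun e => if t % 2 = 0 then f e else g e := by
  induction l generalizing t with
  | nil => simp
  | cons a l ih =>
    match t with
    | 0 => simp
    | 1 => simp
    | t + 2 =>
      have h1 : (t + 2) / 2 = t / 2 + 1 := by omega
      have h2 : (t + 2) % 2 = t % 2 := by omega
      simp only [List.flatMap_cons, h1, h2, List.getElem?_cons_succ, ← ih]
      simp

/-- The entries of the adjacency matrix of a clique instance. -/
noncomputable def CliqueInstance.entries {k : ℕ} (x : CliqueInstance k) (t : ℕ) : ℕ :=
  (rowMajor x.adjacency).getD t 0

theorem CliqueInstance.entries_le {k : ℕ} (x : CliqueInstance k) (t : ℕ) : x.entries t ≤ 1 := by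
  have h : ∀ w ∈ rowMajor x.adjacency, w ≤ 1 := by
    intro w hw
    simp only [rowMajor, List.mem_flatten, List.mem_ofFn] at hw
    obtain ⟨_, ⟨i, rfl⟩, hw⟩ := hw
    obtain ⟨j, rfl⟩ := List.mem_ofFn.mp hw
    unfold CliqueInstance.adjacency
    split_ifs <;> simp
  rw [entries, List.getD_eq_getElem?_getD]
  rcases hg : (rowMajor x.adjacency)[t]? with _ | w
  · simp
  · exact h w (List.mem_of_getElem? hg)

theorem CliqueInstance.entries_ne_zero_iff {k : ℕ} (x : CliqueInstance k) (i j : Fin k)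
    (a b : Fin x.n) :
    x.entries ((i * x.n + a) * (k * x.n) + (j * x.n + b)) ≠ 0 ↔ x.G.Adj (i, a) (j, b) := by
  have h1 : ∀ (i : Fin k) (a : Fin x.n), ((finProdFinEquiv (i, a) : Fin (k * x.n)) : ℕ) =
      i * x.n + a := fun i a => by simp [finProdFinEquiv, add_comm, mul_comm]
  rw [← h1, ← h1, entries, getD_rowMajor, adjacency]
  simp

/-- Distinct members of a clique lie in distinct parts, so a clique of size `k` meets each of the
`k` parts exactly once. -/
theorem CliqueInstance.exists_clique_iff {k : ℕ} (x : CliqueInstance k) :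
    (∃ s : Finset (Fin k × Fin x.n), x.G.IsNClique k s) ↔
      ∃ c : Fin k → Fin x.n, ∀ i j : Fin k, i < j →
        x.entries ((i * x.n + c i) * (k * x.n) + (j * x.n + c j)) ≠ 0 := by
  classical
  simp only [CliqueInstance.entries_ne_zero_iff]
  constructor
  · rintro ⟨s, hs⟩
    have hinj : Set.InjOn Prod.fst (s : Set (Fin k × Fin x.n)) := by
      intro u hu v hv huv
      by_contra hne
      exact x.partite u v (hs.isClique hu hv hne) huv
    have himg : s.image Prod.fst = Finset.univ := by
      rw [← Finset.card_eq_iff_eq_univ, Finset.card_image_of_injOn hinj, hs.card_eq,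
        Fintype.card_fin]
    have hex : ∀ i : Fin k, ∃ a : Fin x.n, (i, a) ∈ s := by
      intro i
      have : i ∈ s.image Prod.fst := himg ▸ Finset.mem_univ i
      obtain ⟨⟨i', a⟩, hu, rfl⟩ := Finset.mem_image.mp this
      exact ⟨a, hu⟩
    choose c hc using hex
    exact ⟨c, fun i j hij => hs.isClique (hc i) (hc j) fun h => hij.ne (congrArg Prod.fst h)⟩
  · rintro ⟨c, hc⟩
    refine ⟨Finset.univ.image fun i => (i, c i), ?_, ?_⟩
    · intro u hu v hv huv
      obtain ⟨i, -, rfl⟩ := Finset.mem_image.mp hu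
      obtain ⟨j, -, rfl⟩ := Finset.mem_image.mp hv
      rcases lt_trichotomy i j with h | h | h
      · exact hc i j h
      · exact absurd (by rw [h]) huv
      · exact (hc j i h).symm
    · rw [Finset.card_image_of_injective _ fun i j h => congrArg Prod.fst h, Finset.card_univ,
        Fintype.card_fin]

theorem getD_encode_kClique {k : ℕ} (x : CliqueInstance k) (t : ℕ) :
    ((kClique k).encode x).getD t 0 = if t = 0 then x.n else x.entries (t - 1) := by
  change (x.n :: rowMajor x.adjacency).getD t 0 = _
  cases t <;> simp [CliqueInstance.entries]

theorem CliqueInstance.entries_of_le {k : ℕ} (x : CliqueInstance k) {t : ℕ}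
    (h : k * x.n * (k * x.n) ≤ t) : x.entries t = 0 := by
  rw [entries, List.getD_eq_default]
  rwa [length_rowMajor]

/-! ### The encoding of the constructed instance -/

namespace Lines

/-- The word number `a` of the encoding of the constructed instance of `k`-DSP. -/
def word (k n : ℕ) (g : ℕ → ℕ) (a : ℕ) : ℕ :=
  if a = 0 then numVertices k n
  else if a = 1 then numEdges k n
  else if a < 2 + 2 * k then k * n * width k n + (a - 2)
  else if a < 2 + 2 * k + 2 * numEdges k n then
    rep k n g (edgeStart k n ((a - (2 + 2 * k)) / 2) + (a - (2 + 2 * k)) % 2)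
  else 0

theorem getD_encode_dsp (k n : ℕ) (g : ℕ → ℕ) (a : ℕ) :
    (dsp k n g).encode.getD a 0 = word k n g a := by
  have hE : (dsp k n g).edges.length = numEdges k n := by simp [dsp]
  match a with
  | 0 => simp [DSPInstance.encode, word, dsp]
  | 1 => simp [DSPInstance.encode, word, hE]
  | a + 2 =>
    simp only [DSPInstance.encode, List.getD_cons_succ]
    rw [word, if_neg (by omega), if_neg (by omega)]
    rw [List.getD_eq_getElem?_getD]
    by_cases h1 : a < 2 * k
    · rw [if_pos (by omega), List.getElem?_append_left (by simp; omega)]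
      by_cases h2 : a < k
      · rw [List.getElem?_append_left (by simpa using h2), List.getElem?_ofFn]
        simp [h2, dsp]
      · rw [List.getElem?_append_right (by simp; omega), List.getElem?_ofFn]
        have h3 : a - k < k := by omega
        simp [h3, dsp]
        omega
    · rw [if_neg (by omega), List.getElem?_append_right (by simp; omega), getElem?_flatMap_pair]
      have h3 : a - ((List.ofFn fun i => ((dsp k n g).source i : ℕ)) ++
          List.ofFn fun i => ((dsp k n g).target i : ℕ)).length = a + 2 - (2 + 2 * k) := by
        simp; omega
      rw [h3]
      by_cases h4 : (a + 2 - (2 + 2 * k)) / 2 < numEdges k n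
      · rw [if_pos (by omega)]
        have h5 : (dsp k n g).edges[(a + 2 - (2 + 2 * k)) / 2]? = some (edge k n g ⟨_, h4⟩) :=
          List.getElem?_ofFn.trans (dif_pos h4)
        rw [h5]
        rcases Nat.mod_two_eq_zero_or_one (a + 2 - (2 + 2 * k)) with h6 | h6 <;>
          rw [h6] <;> rfl
      · rw [if_neg (by omega), List.getElem?_eq_none (by rw [hE]; omega)]
        rfl

end Lines

end FineGrained

namespace FineGrained

/-! ### Statements whose words are bounded -/

/-- All registers below `16` and all memory cells hold at most `b`. -/
structure Env (b : ℕ) (v m : ℕ → ℕ) : Prop where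
  two_le : 2 ≤ b
  var_le : ∀ x < 16, v x ≤ b
  mem_le : ∀ a, m a ≤ b

theorem Env.update {b : ℕ} {v m : ℕ → ℕ} (h : Env b v m) (x w : ℕ) (hw : w ≤ b) :
    Env b (Function.update v x w) m := by
  refine ⟨h.two_le, fun y hy => ?_, h.mem_le⟩
  by_cases hyx : y = x
  · subst hyx; simpa using hw
  · simpa [Function.update_of_ne hyx] using h.var_le y hy

theorem Env.of_mem {b : ℕ} {v m m' : ℕ → ℕ} (h : Env b v m) (hm : ∀ a, m' a ≤ b) : Env b v m' :=
  ⟨h.two_le, h.var_le, hm⟩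

/-- The expression can be evaluated with words of the given size and number of registers. -/
structure Ex.Fits (b S R : ℕ) (e : Ex) : Prop where
  wf : e.WF b
  height_le : e.height ≤ S
  depth_lt : 17 + e.depth < R

/-- The code takes `v, m` to `v', m'`, in time proportional to its length and to `b`. -/
def Transforms (b S R : ℕ) (c : Code) (v m v' m' : ℕ → ℕ) : Prop :=
  ∀ (p : Program) (l : ℕ) (ω : ℕ → Bool) (s : Config), HasCode p l (c l) → s.pc = l →
    St R v m s → Bounded (b ^ 2 ^ S + 1) s →
    ∃ t ≤ 2 * (c l).length * b, ∃ s', Reaches p ω (b ^ 2 ^ S + 1) s t s' ∧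
      s'.pc = l + (c l).length ∧ s'.coins = s.coins ∧ St R v' m' s'

theorem Transforms.seq {R b S : ℕ} {c₁ c₂ : Code} {v₁ m₁ v₂ m₂ v₃ m₃ : ℕ → ℕ}
    (h₁ : Transforms b S R c₁ v₁ m₁ v₂ m₂) (h₂ : Transforms b S R c₂ v₂ m₂ v₃ m₃) :
    Transforms b S R (c₁.seq c₂) v₁ m₁ v₃ m₃ := by
  intro p l ω s hc hl hs hB
  obtain ⟨t₁, ht₁, s₁, r₁, pc₁, co₁, st₁⟩ := h₁ p l ω s hc.left hl hs hB
  obtain ⟨t₂, ht₂, s₂, r₂, pc₂, co₂, st₂⟩ := h₂ p _ ω s₁ hc.right pc₁ st₁ r₁.bounded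
  refine ⟨t₁ + t₂, ?_, s₂, r₁.trans r₂, by simp [Code.seq, pc₂, add_assoc], co₂.trans co₁, st₂⟩
  rw [Code.seq, List.length_append, mul_add, add_mul]
  omega

theorem Transforms.assign {b S R : ℕ} {v m : ℕ → ℕ} (h : Env b v m) {x : ℕ} {e : Ex}
    (hx : x < 16) (he : e.Fits b S R) :
    Transforms b S R (Code.assign x e) v m (Function.update v x (e.eval v m)) m := by
  have h2 := h.two_le
  intro p l ω s hc hl hs hB
  obtain ⟨t, ht, r⟩ := Triple.assign hx (he.wf.safe h2 h.var_le h.mem_le he.height_le)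
    (by have := he.depth_lt; omega) p l ω s hc hl hs hB
  refine ⟨t, ht.trans ?_, r⟩
  rw [mul_assoc, Nat.mul_comm 2, mul_assoc]
  simpa [Code.assign] using Nat.le_mul_of_pos_right ((e.code 16).length + 1) (show 0 < b * 2 by omega)

theorem Transforms.store {b S R : ℕ} {v m : ℕ → ℕ} (h : Env b v m) {ea ev : Ex}
    (ha : ea.Fits b S R) (he : ev.Fits b S R) :
    Transforms b S R (Code.store ea ev) v m v
      (Function.update m (ea.eval v m) (ev.eval v m)) := by
  have h2 := h.two_le
  intro p l ω s hc hl hs hB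
  obtain ⟨t, ht, r⟩ := Triple.store (ha.wf.safe h2 h.var_le h.mem_le ha.height_le)
    (he.wf.safe h2 h.var_le h.mem_le he.height_le)
    (by have := ha.depth_lt; omega) he.depth_lt p l ω s hc hl hs hB
  refine ⟨t, ht.trans ?_, r⟩
  rw [mul_assoc, Nat.mul_comm 2, mul_assoc]
  exact Nat.le_mul_of_pos_right _ (show 0 < b * 2 by omega)

theorem Transforms.loop {b S R : ℕ} {v m : ℕ → ℕ} (h : Env b v m) {y : ℕ} {ea ev : Ex}
    (hy : y < 16) (hy0 : y ≠ 0) (ha : ea.Fits b S R) (he : ev.Fits b S R)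
    (hm : ∀ t ≤ v y, ∀ a, loopMem ea ev v m t a ≤ b) :
    Transforms b S R (Code.loop y ea ev) v m
      (Function.update v 0 (v y)) (loopMem ea ev v m (v y)) := by
  have h2 := h.two_le
  have hvy := h.var_le y hy
  have henv : ∀ t < v y, Env b (Function.update v 0 t) (loopMem ea ev v m t) := fun t ht =>
    (h.of_mem (hm t ht.le)).update 0 t (by omega)
  intro p l ω s hc hl hs hB
  have h3 : 1 < b ^ 2 ^ S + 1 := by
    have : 0 < b ^ 2 ^ S := Nat.pow_pos (by omega)
    omega
  obtain ⟨t, ht, r⟩ := Triple.loop hy hy0 h3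
    (fun t ht => ha.wf.safe h2 (henv t ht).var_le (henv t ht).mem_le ha.height_le)
    (fun t ht => he.wf.safe h2 (henv t ht).var_le (henv t ht).mem_le he.height_le)
    (by have := ha.depth_lt; omega) (by have := he.depth_lt; omega) p l ω s hc hl hs hB
  refine ⟨t, ht.trans ?_, r⟩
  have e : (Code.loop y ea ev l).length = (Code.store ea ev 0).length + 6 := by
    simp [Code.loop]
  rw [e]
  have := Nat.mul_le_mul_right ((Code.store ea ev 0).length + 5) hvy
  nlinarith

/-- The memory `m`, with the values of `f` written to the `t` cells from `A` on. -/
def segment (A t : ℕ) (f m : ℕ → ℕ) (a : ℕ) : ℕ :=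
  if A ≤ a ∧ a < A + t then f (a - A) else m a

theorem segment_le {A t b : ℕ} {f m : ℕ → ℕ} (hf : ∀ i < t, f i ≤ b) (hm : ∀ a, m a ≤ b) (a : ℕ) :
    segment A t f m a ≤ b := by
  unfold segment
  split_ifs with h
  · exact hf _ (by omega)
  · exact hm a

theorem loopMem_eq_segment {ea ev : Ex} {v m : ℕ → ℕ} {A R : ℕ} {f : ℕ → ℕ}
    (hA : ∀ t < R, ∀ m', ea.eval (Function.update v 0 t) m' = A + t)
    (hf : ∀ t < R, ev.eval (Function.update v 0 t) (segment A t f m) = f t) :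
    ∀ t ≤ R, loopMem ea ev v m t = segment A t f m := by
  intro t
  induction t with
  | zero =>
    intro _
    funext a
    rw [segment, if_neg (by omega)]
    rfl
  | succ t ih =>
    intro ht
    rw [loopMem, ih (by omega), hA t (by omega), hf t (by omega)]
    funext a
    by_cases h : a = A + t
    · subst h
      rw [Function.update_self, segment, if_pos (by omega), Nat.add_sub_cancel_left]
    · rw [Function.update_of_ne h, segment, segment]
      exact if_congr (by omega) rfl rfl

/-- A loop that writes the values of `f` to the cells from `A` on. -/
theorem Transforms.fill {b S R : ℕ} {v m : ℕ → ℕ} (h : Env b v m) {y : ℕ} {ea ev : Ex}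
    (hy : y < 16) (hy0 : y ≠ 0) (ha : ea.Fits b S R) (he : ev.Fits b S R) {A : ℕ} {f : ℕ → ℕ}
    (hA : ∀ t < v y, ∀ m', ea.eval (Function.update v 0 t) m' = A + t)
    (hf : ∀ t < v y, ev.eval (Function.update v 0 t) (segment A t f m) = f t)
    (hfb : ∀ t < v y, f t ≤ b) :
    Transforms b S R (Code.loop y ea ev) v m (Function.update v 0 (v y)) (segment A (v y) f m) := by
  have e := loopMem_eq_segment hA hf
  rw [← e (v y) le_rfl]
  refine Transforms.loop h hy hy0 ha he fun t ht a => ?_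
  rw [e t ht]
  exact segment_le (fun i hi => hfb i (by omega)) h.mem_le a

/-! ### Parameters and expressions of the reduction program -/

namespace Lines

/-- The number of the line vertices before identifications. -/
abbrev total (k n : ℕ) : ℕ := k * n * width k n

/-- The number of entries of the adjacency matrix. -/
abbrev area (k n : ℕ) : ℕ := k * n * (k * n)

/-- The place where the encoding of the new instance is assembled. -/
def away (k n : ℕ) : ℕ := 3 + 2 * k + 2 * total k n + area k n

/-- The factor of `n` in the width. -/
def widthFactor (k : ℕ) : ℕ := 2 * k.factorial * (k * k * (6 * k + 1) + 2 * k)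

/-- A bound for all words between the statements of the reduction program. -/
def wordBound (k n : ℕ) : ℕ := 2 * away k n + widthFactor k + 3 * k.factorial

/-- The registers hold the parameters of the reduction. -/
structure Params (k n : ℕ) (v : ℕ → ℕ) : Prop where
  v1 : v 1 = n
  v2 : v 2 = k * n
  v3 : v 3 = width k n
  v4 : v 4 = total k n
  v5 : v 5 = area k n
  v6 : v 6 = away k n
  v7 : v 7 = 2 * numEdges k n
  v8 : v 8 = 2 * k

theorem Params.update {k n : ℕ} {v : ℕ → ℕ} (h : Params k n v) (t : ℕ) :
    Params k n (Function.update v 0 t) := by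
  obtain ⟨h1, h2, h3, h4, h5, h6, h7, h8⟩ := h
  constructor <;> rw [Function.update_of_ne (by omega)] <;> assumption

open Ex in
/-- The vertex number `R[0]` before identifications. -/
def baseEx (k : ℕ) : Ex :=
  let s := var 0 % var 3
  let i := var 0 / var 3 / var 1
  bin .eq s (lit 0) * (var 4 + i) + bin .eq s (var 3 - lit 1) * (var 4 + lit k + i) +
    (lit 1 - (bin .eq s (lit 0) + bin .eq s (var 3 - lit 1))) * var 0

theorem eval_baseEx {k n t : ℕ} {v : ℕ → ℕ} (h : Params k n v) (m : ℕ → ℕ) :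
    (baseEx k).eval (Function.update v 0 t) m = base k n t := by
  have hW := width_ge k n
  have h' := h.update t
  simp only [baseEx, Ex.eval_add, Ex.eval_sub, Ex.eval_mul, Ex.eval_div, Ex.eval_mod, Ex.eval_eq,
    Ex.eval_var, Ex.eval_lit, h'.v1, h'.v3, h'.v4, Function.update_self, base]
  by_cases h0 : t % width k n = 0
  -- The expression selects by multiplication with indicators. The first and the last position
  -- differ because the width is at least `3`, so at most one indicator is `1`.
  · rw [if_pos h0, if_pos h0, if_neg (by omega)]; simp
  · rw [if_neg h0, if_neg h0]
    by_cases h1 : t % width k n = width k n - 1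
    · rw [if_pos h1, if_pos h1]; simp
    · rw [if_neg h1, if_neg h1]; simp

namespace CrossEx

open Ex

def i : Ex := var 0 / var 2 / var 1
def a : Ex := var 0 / var 2 % var 1
def j : Ex := var 0 % var 2 / var 1
def b : Ex := var 0 % var 2 % var 1

/-- The time of the crossing number `R[0]`. -/
def time (k : ℕ) : Ex :=
  lit (3 * k.factorial) * var 1 * (i + j + lit 2) + lit k.factorial / (j - i) * a -
    lit k.factorial / (j - i) * b

/-- The vertex of the crossing number `R[0]` on the line `(i, a)`. -/
def place (k : ℕ) (i a : Ex) : Ex :=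
  (i * var 1 + a) * var 3 + lit 2 * ((i + lit 1) * (i + lit 1) * time k +
    lit 2 * (i + lit 1) * lit k.factorial * a)

/-- Whether the crossing number `R[0]` needs an identification. -/
def cond : Ex := bin .lt i j * bin .eq (get (lit 1 + var 0)) (lit 0)

/-- The place of the crossing number `R[0]` in the table. -/
def address (k : ℕ) : Ex := var 5 + lit 1 + place k j b

/-- The new entry at this place. -/
def value (k : ℕ) : Ex := cond * place k i a + (lit 1 - cond) * get (address k)

end CrossEx

section Cross

variable {k n t : ℕ} {v : ℕ → ℕ}

theorem eval_place_lower (h : Params k n v) (m : ℕ → ℕ) :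
    (CrossEx.place k CrossEx.i CrossEx.a).eval (Function.update v 0 t) m = lowerAt k n t := by
  have h' := h.update t
  simp only [CrossEx.place, CrossEx.time, CrossEx.i, CrossEx.a, CrossEx.j, CrossEx.b,
    Ex.eval_add, Ex.eval_sub, Ex.eval_mul, Ex.eval_div, Ex.eval_mod, Ex.eval_var, Ex.eval_lit,
    h'.v1, h'.v2, h'.v3, Function.update_self]
  rfl

theorem eval_place_upper (h : Params k n v) (m : ℕ → ℕ) :
    (CrossEx.place k CrossEx.j CrossEx.b).eval (Function.update v 0 t) m = upperAt k n t := by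
  have h' := h.update t
  simp only [CrossEx.place, CrossEx.time, CrossEx.i, CrossEx.a, CrossEx.j, CrossEx.b,
    Ex.eval_add, Ex.eval_sub, Ex.eval_mul, Ex.eval_div, Ex.eval_mod, Ex.eval_var, Ex.eval_lit,
    h'.v1, h'.v2, h'.v3, Function.update_self]
  rfl

theorem eval_cond (h : Params k n v) {g m : ℕ → ℕ} (hm : m (1 + t) = g t) :
    CrossEx.cond.eval (Function.update v 0 t) m = if CrossAt k n g t then 1 else 0 := by
  have h' := h.update t
  simp only [CrossEx.cond, CrossEx.i, CrossEx.j, Ex.eval_lt, Ex.eval_eq,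
    Ex.eval_get, Ex.eval_add, Ex.eval_mul, Ex.eval_div, Ex.eval_mod, Ex.eval_var, Ex.eval_lit,
    h'.v1, h'.v2, Function.update_self, hm, CrossAt]
  split_ifs <;> simp_all

theorem eval_address (h : Params k n v) (m : ℕ → ℕ) :
    (CrossEx.address k).eval (Function.update v 0 t) m = area k n + 1 + upperAt k n t := by
  rw [CrossEx.address, Ex.eval_add, eval_place_upper h]
  simp only [Ex.eval_add, Ex.eval_var, Ex.eval_lit, (h.update t).v5]

theorem CrossAt.lt_total {g : ℕ → ℕ} (h : CrossAt k n g t) (ht : t < area k n) :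
    upperAt k n t < total k n ∧ lowerAt k n t < total k n := by
  obtain ⟨i, a, j, b, c, hu, hl⟩ := h.exists_cross ht
  have B := c.pos_bounds
  rw [hu, hl]
  exact ⟨vtx_lt c.2.1 c.2.2.2.1 (by omega), vtx_lt (c.1.trans c.2.1) c.2.2.1 (by omega)⟩

/-- The loop writes in every round; where no identification is needed it puts the old entry back.
The table stands behind the adjacency matrix, so the matrix entries remain readable. -/
theorem loopMem_cross (h : Params k n v) {g m : ℕ → ℕ} (hm : ∀ t, m (1 + t) = g t) :
    ∀ t ≤ area k n, loopMem (CrossEx.address k) (CrossEx.value k) v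
      (segment (area k n + 1) (total k n) (base k n) m) t =
      segment (area k n + 1) (total k n) (table k n g t) m := by
  intro t
  induction t with
  | zero => exact fun _ => rfl
  | succ t ih =>
    intro ht
    rw [loopMem, ih (by omega)]
    have hr : segment (area k n + 1) (total k n) (table k n g t) m (1 + t) = g t := by
      rw [segment, if_neg (by omega), hm]
    rw [CrossEx.value, Ex.eval_add, Ex.eval_mul, Ex.eval_mul, Ex.eval_sub, Ex.eval_get,
      eval_address h, eval_cond h hr, eval_place_lower h, Ex.eval_lit, table]
    by_cases hc : CrossAt k n g t
    · have hlt := hc.lt_total (show t < area k n by omega)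
      simp only [if_pos hc, one_mul, Nat.sub_self, zero_mul, add_zero]
      funext x
      by_cases hx : x = area k n + 1 + upperAt k n t
      · subst hx
        rw [Function.update_self, segment, if_pos (by omega), Nat.add_sub_cancel_left,
          Function.update_self]
      · rw [Function.update_of_ne hx, segment, segment]
        by_cases hx' : area k n + 1 ≤ x ∧ x < area k n + 1 + total k n
        · rw [if_pos hx', if_pos hx', Function.update_of_ne (by omega)]
        · rw [if_neg hx', if_neg hx']
    · simp only [if_neg hc, zero_mul, Nat.sub_zero, one_mul, zero_add, Function.update_eq_self]

theorem base_le {w : ℕ} (hw : w < total k n) : base k n w ≤ numVertices k n := by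
  have hW := width_ge k n
  have h1 : w / width k n < k * n := (Nat.div_lt_iff_lt_mul (by omega)).mpr hw
  have hn : 0 < n := Nat.pos_of_ne_zero fun h => by simp [h] at h1
  have h2 : w / width k n / n < k := (Nat.div_lt_iff_lt_mul hn).mpr h1
  have e : total k n = k * n * width k n := rfl
  rw [base, numVertices]
  split_ifs <;> omega

theorem table_le {g : ℕ → ℕ} {w : ℕ} (hw : w < total k n) (ht : t ≤ area k n) :
    table k n g t w ≤ numVertices k n := by
  rcases table_cases k n g w t with ⟨h, -⟩ | ⟨t', ht', hc, -, h⟩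
  · rw [h]
    exact base_le hw
  · have := (hc.lt_total (show t' < area k n by omega)).2
    have e : total k n = k * n * width k n := rfl
    rw [h, numVertices]
    omega

end Cross

/-! ### The reduction program -/

open Ex in
/-- The word number `R[0]` of the list of edges. -/
def edgeEx : Ex :=
  get (var 5 + lit 1 + (var 0 / lit 2 / (var 3 - lit 1) * var 3 + var 0 / lit 2 % (var 3 - lit 1) +
    var 0 % lit 2))

open Ex in
/-- Computes the parameters. -/
def setup (k : ℕ) : Code :=
  (Code.assign 1 (get (lit 0))).seq <|
  (Code.assign 2 (lit k * var 1)).seq <|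
  (Code.assign 3 (lit (widthFactor k) * var 1 + lit 3)).seq <|
  (Code.assign 4 (var 2 * var 3)).seq <|
  (Code.assign 5 (var 2 * var 2)).seq <|
  (Code.assign 6 (lit 3 + lit (2 * k) + lit 2 * var 4 + var 5)).seq <|
  (Code.assign 7 (lit 2 * (var 2 * (var 3 - lit 1)))).seq <|
  Code.assign 8 (lit (2 * k))

open Ex in
/-- Transforms a clique instance in the memory into the constructed instance of `k`-DSP. -/
def transform (k : ℕ) : Code :=
  (setup k).seq <|
  (Code.loop 4 (var 5 + lit 1 + var 0) (baseEx k)).seq <|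
  (Code.loop 5 (CrossEx.address k) (CrossEx.value k)).seq <|
  (Code.loop 8 (var 6 + lit 2 + var 0) (var 4 + var 0)).seq <|
  (Code.loop 7 (var 6 + lit 2 + var 8 + var 0) edgeEx).seq <|
  (Code.store (var 6) (var 4 + var 8)).seq <|
  (Code.store (var 6 + lit 1) (var 2 * (var 3 - lit 1))).seq <|
  (Code.loop 6 (var 0) (get (var 6 + var 0))).seq <|
  Code.loop 6 (var 6 + var 0) (lit 0)

/-- The height of the expressions in the program is at most this. -/
def maxHeight : ℕ := 40

/-- The program uses only the registers below this. -/
def numRegs : ℕ := 64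

section Bounds

variable (k n : ℕ)

theorem lit_le_wordBound : 3 ≤ wordBound k n ∧ 2 * k ≤ wordBound k n ∧
    widthFactor k ≤ wordBound k n ∧ 3 * k.factorial ≤ wordBound k n := by
  unfold wordBound away
  omega

theorem away_le_wordBound : 2 * away k n ≤ wordBound k n := by
  unfold wordBound
  omega

theorem total_le_away : 2 * total k n + 2 * k + 3 + area k n = away k n := by
  unfold away
  omega

theorem numEdges_le_total : numEdges k n ≤ total k n := by
  unfold numEdges
  exact Nat.mul_le_mul_left _ (Nat.sub_le _ _)

theorem numVertices_eq : numVertices k n = total k n + 2 * k := rfl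

theorem width_eq : width k n = widthFactor k * n + 3 := rfl

end Bounds

theorem setup_transforms {k n : ℕ} {m : ℕ → ℕ} (hk : 0 < k) (hm0 : m 0 = n)
    (hm : ∀ a, m a ≤ wordBound k n) :
    ∃ v, Env (wordBound k n) v m ∧ Params k n v ∧
      Transforms (wordBound k n) maxHeight numRegs (setup k) (fun _ => 0) m v m := by
  obtain ⟨l3, lk, lw, lf⟩ := lit_le_wordBound k n
  have ha := away_le_wordBound k n
  have ht := total_le_away k n
  have hE := numEdges_le_total k n
  have hn : n ≤ k * n := Nat.le_mul_of_pos_left n hk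
  have hkn : k * n ≤ area k n := Nat.le_mul_self _
  -- The `+ 3` is needed for `n = 0`, where the width is `3` although there are no line vertices.
  have hW : width k n ≤ total k n + 3 := by
    rcases Nat.eq_zero_or_pos n with h | h
    · subst h; simp [width]
    · exact (Nat.le_mul_of_pos_left _ (Nat.mul_pos hk h)).trans (Nat.le_add_right _ _)
  set b := wordBound k n
  have l1 : 1 ≤ b := by omega
  have l2 : 2 ≤ b := by omega
  have lk' : k ≤ b := by omega
  have E0 : Env b (fun _ => 0) m := ⟨l2, by simp, hm⟩
  have E1 := E0.update 1 n (by omega)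
  have E2 := E1.update 2 (k * n) (by omega)
  have E3 := E2.update 3 (width k n) (by omega)
  have E4 := E3.update 4 (total k n) (by omega)
  have E5 := E4.update 5 (area k n) (by omega)
  have E6 := E5.update 6 (away k n) (by omega)
  have E7 := E6.update 7 (2 * numEdges k n) (by omega)
  have E8 := E7.update 8 (2 * k) (by omega)
  refine ⟨_, E8, by constructor <;> simp, ?_⟩
  have step : ∀ {v : ℕ → ℕ} {x : ℕ} {e : Ex} {w : ℕ}, Env b v m → x < 16 →
      e.Fits b maxHeight numRegs → e.eval v m = w →
      Transforms b maxHeight numRegs (Code.assign x e) v m (Function.update v x w) m := by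
    rintro v x e w hE hx he rfl
    exact Transforms.assign hE hx he
  refine (step E0 (by omega) ?_ ?_).seq <| (step E1 (by omega) ?_ ?_).seq <|
    (step E2 (by omega) ?_ ?_).seq <| (step E3 (by omega) ?_ ?_).seq <|
    (step E4 (by omega) ?_ ?_).seq <| (step E5 (by omega) ?_ ?_).seq <|
    (step E6 (by omega) ?_ ?_).seq (step E7 (by omega) ?_ ?_)
  all_goals first
    | exact ⟨by simp [l1, l2, l3, lk, lw, lk'], Nat.le_of_ble_eq_true rfl,
        Nat.le_of_ble_eq_true rfl⟩
    | simp [hm0, width_eq, away, numEdges]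

theorem input_le_wordBound {k : ℕ} (hk : 0 < k) (x : CliqueInstance k) (a : ℕ) :
    ((kClique k).encode x).getD a 0 ≤ wordBound k x.n := by
  have l3 := (lit_le_wordBound k x.n).1
  have ha := away_le_wordBound k x.n
  have ht := total_le_away k x.n
  have hn : x.n ≤ k * x.n := Nat.le_mul_of_pos_left _ hk
  have hkn : k * x.n ≤ area k x.n := Nat.le_mul_self _
  rw [getD_encode_kClique]
  split_ifs
  · omega
  · exact (x.entries_le _).trans (by omega)

/-- The input occupies the cells up to `area`, and the table follows it. `away` lies behind both and
is also larger than the length of the new encoding. So the encoding can be assembled from `away` on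
and copied to the front without overlap, after which the workspace is erased. -/
theorem transform_transforms {k : ℕ} (hk : 0 < k) (x : CliqueInstance k) :
    ∃ v, Transforms (wordBound k x.n) maxHeight numRegs (transform k)
        (fun _ => 0) (fun a => ((kClique k).encode x).getD a 0) v (word k x.n x.entries) := by
  set n := x.n with hn_def
  set g := x.entries
  obtain ⟨l3, lk, lw, lf⟩ := lit_le_wordBound k n
  have ha := away_le_wordBound k n
  have ht := total_le_away k n
  have hE := numEdges_le_total k n
  have hV := numVertices_eq k n
  have hn : n ≤ k * n := Nat.le_mul_of_pos_left n hk
  have hkn : k * n ≤ area k n := Nat.le_mul_self _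
  set m₀ : ℕ → ℕ := fun a => ((kClique k).encode x).getD a 0 with hm₀
  have hm₀' : ∀ a, m₀ a = if a = 0 then n else g (a - 1) := getD_encode_kClique x
  have hmb : ∀ a, m₀ a ≤ wordBound k n := input_le_wordBound hk x
  obtain ⟨v, E, hv, t₀⟩ := setup_transforms hk (m := m₀) (n := n) (by simp [hm₀']) hmb
  set b := wordBound k n
  have l1 : 1 ≤ b := by omega
  have l2 : 2 ≤ b := by omega
  have lk' : k ≤ b := by omega
  have lf' : k.factorial ≤ b := by omega
  -- the table before identifications
  have t₁ := Transforms.fill (S := maxHeight) (R := numRegs) E (y := 4)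
    (ea := .var 5 + .lit 1 + .var 0) (ev := baseEx k) (A := area k n + 1) (f := base k n)
    (by omega) (by omega)
    ⟨by simp [l1], Nat.le_of_ble_eq_true rfl, Nat.le_of_ble_eq_true rfl⟩
    ⟨by simp [baseEx, l1, lk'], Nat.le_of_ble_eq_true rfl, Nat.le_of_ble_eq_true rfl⟩
    (fun t _ m' => by simp [hv.v5]) (fun t _ => eval_baseEx hv _)
    (fun t ht' => by
      rw [hv.v4] at ht'
      exact (base_le ht').trans (by omega))
  rw [hv.v4] at t₁
  have hv₁ := hv.update (total k n)
  have E₁ : Env b (Function.update v 0 (total k n))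
      (segment (area k n + 1) (total k n) (base k n) m₀) :=
    (E.of_mem (segment_le (fun i hi => (base_le hi).trans (by omega)) hmb)).update 0 _ (by omega)
  -- the identifications
  have hc := loopMem_cross hv₁ (g := g) (m := m₀) (fun t => by rw [hm₀', if_neg (by omega)]; simp)
  have t₂ := Transforms.loop (S := maxHeight) (R := numRegs) E₁ (y := 5)
    (ea := CrossEx.address k) (ev := CrossEx.value k) (by omega) (by omega)
    ⟨by simp [CrossEx.address, CrossEx.place, CrossEx.time, CrossEx.i, CrossEx.a, CrossEx.j,
        CrossEx.b, l1, l2, lf, lf'], Nat.le_of_ble_eq_true rfl, Nat.le_of_ble_eq_true rfl⟩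
    ⟨by simp [CrossEx.value, CrossEx.cond, CrossEx.address, CrossEx.place, CrossEx.time, CrossEx.i,
        CrossEx.a, CrossEx.j, CrossEx.b, l1, l2, lf, lf'], Nat.le_of_ble_eq_true rfl,
        Nat.le_of_ble_eq_true rfl⟩
    (fun t ht' => by
      rw [hv₁.v5] at ht'
      rw [hc t ht']
      exact segment_le (fun i hi => (table_le hi ht').trans (by omega)) hmb)
  rw [hv₁.v5, hc _ le_rfl] at t₂
  have hv₂ := hv₁.update (area k n)
  set m₂ := segment (area k n + 1) (total k n) (rep k n g) m₀ with hm₂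
  have E₂ : Env b (Function.update (Function.update v 0 (total k n)) 0 (area k n)) m₂ :=
    (E₁.of_mem (segment_le (fun i hi => (table_le hi le_rfl).trans (by omega)) hmb)).update 0 _
      (by omega)
  -- the sources and targets
  have t₃ := Transforms.fill (S := maxHeight) (R := numRegs) E₂ (y := 8)
    (ea := .var 6 + .lit 2 + .var 0) (ev := .var 4 + .var 0) (A := away k n + 2)
    (f := fun t => total k n + t) (by omega) (by omega)
    ⟨by simp [l2], Nat.le_of_ble_eq_true rfl, Nat.le_of_ble_eq_true rfl⟩
    ⟨by simp, Nat.le_of_ble_eq_true rfl, Nat.le_of_ble_eq_true rfl⟩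
    (fun t _ m' => by simp [hv.v6]) (fun t _ => by simp [hv.v4])
    (fun t ht' => by rw [hv₂.v8] at ht'; omega)
  rw [hv₂.v8] at t₃
  have hv₃ := hv₂.update (2 * k)
  set m₃ := segment (away k n + 2) (2 * k) (fun t => total k n + t) m₂ with hm₃
  have E₃ : Env b _ m₃ :=
    (E₂.of_mem (segment_le (fun i hi => by omega) E₂.mem_le)).update 0 (2 * k) (by omega)
  -- the edges
  have hedge : ∀ t < 2 * numEdges k n,
      edgeStart k n (t / 2) + t % 2 < total k n ∧
      rep k n g (edgeStart k n (t / 2) + t % 2) ≤ b := by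
    intro t ht'
    obtain ⟨i, a, s, hi, ha', hs, h⟩ := edgeStart_eq_vtx (show t / 2 < numEdges k n by omega)
    have h0 := vtx_lt hi ha' hs
    have h1 : vtx k n i a (s + 1) = vtx k n i a s + 1 := rfl
    have h2 : k * n * width k n = total k n := rfl
    have h3 : edgeStart k n (t / 2) + t % 2 < total k n := by omega
    exact ⟨h3, (table_le h3 le_rfl).trans (by omega)⟩
  have t₄ := Transforms.fill (S := maxHeight) (R := numRegs) E₃ (y := 7)
    (ea := .var 6 + .lit 2 + .var 8 + .var 0) (ev := edgeEx) (A := away k n + 2 + 2 * k)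
    (f := fun t => rep k n g (edgeStart k n (t / 2) + t % 2)) (by omega) (by omega)
    ⟨by simp [l2], Nat.le_of_ble_eq_true rfl, Nat.le_of_ble_eq_true rfl⟩
    ⟨by simp [edgeEx, l1, l2], Nat.le_of_ble_eq_true rfl, Nat.le_of_ble_eq_true rfl⟩
    (fun t _ m' => by simp [hv.v6, hv.v8])
    (fun t ht' => by
      rw [hv₃.v7] at ht'
      have h1 := (hedge t ht').1
      have h2 : t / 2 / (width k n - 1) * width k n + t / 2 % (width k n - 1) + t % 2 =
        edgeStart k n (t / 2) + t % 2 := rfl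
      simp only [edgeEx, Ex.eval_get, Ex.eval_add, Ex.eval_sub, Ex.eval_mul, Ex.eval_div,
        Ex.eval_mod, Ex.eval_var, Ex.eval_lit, (hv₃.update t).v5, (hv₃.update t).v3,
        Function.update_self, h2]
      rw [segment, if_neg (by omega), hm₃, segment, if_neg (by omega), hm₂, segment,
        if_pos (by omega), Nat.add_sub_cancel_left])
    (fun t ht' => by
      rw [hv₃.v7] at ht'
      exact (hedge t ht').2)
  rw [hv₃.v7] at t₄
  have hv₄ := hv₃.update (2 * numEdges k n)
  set m₄ := segment (away k n + 2 + 2 * k) (2 * numEdges k n)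
    (fun t => rep k n g (edgeStart k n (t / 2) + t % 2)) m₃ with hm₄
  have E₄ : Env b _ m₄ :=
    (E₃.of_mem (segment_le (fun i hi => (hedge i hi).2) E₃.mem_le)).update 0 (2 * numEdges k n)
      (by omega)
  -- the numbers of vertices and edges
  have t₅ := Transforms.store (S := maxHeight) (R := numRegs) E₄ (ea := .var 6)
    (ev := .var 4 + .var 8)
    ⟨by simp, Nat.le_of_ble_eq_true rfl, Nat.le_of_ble_eq_true rfl⟩
    ⟨by simp, Nat.le_of_ble_eq_true rfl, Nat.le_of_ble_eq_true rfl⟩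
  rw [Ex.eval_add, Ex.eval_var, Ex.eval_var, Ex.eval_var, hv₄.v4, hv₄.v6, hv₄.v8] at t₅
  have hupd : ∀ {m : ℕ → ℕ} (a w : ℕ), (∀ a, m a ≤ b) → w ≤ b →
      ∀ a', Function.update m a w a' ≤ b := by
    intro m a w hm hw a'
    by_cases h : a' = a
    · subst h; simpa using hw
    · simpa [Function.update_of_ne h] using hm a'
  have E₅ := E₄.of_mem (hupd (away k n) (total k n + 2 * k) E₄.mem_le (by omega))
  have t₆ := Transforms.store (S := maxHeight) (R := numRegs) E₅ (ea := .var 6 + .lit 1)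
    (ev := .var 2 * (.var 3 - .lit 1))
    ⟨by simp [l1], Nat.le_of_ble_eq_true rfl, Nat.le_of_ble_eq_true rfl⟩
    ⟨by simp [l1], Nat.le_of_ble_eq_true rfl, Nat.le_of_ble_eq_true rfl⟩
  rw [Ex.eval_add, Ex.eval_mul, Ex.eval_sub, Ex.eval_var, Ex.eval_var, Ex.eval_var, Ex.eval_lit,
    hv₄.v6, hv₄.v2, hv₄.v3, show k * n * (width k n - 1) = numEdges k n from rfl] at t₆
  have E₆ := E₅.of_mem (hupd (away k n + 1) (numEdges k n) E₅.mem_le (by omega))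
  set m₆ := Function.update (Function.update m₄ (away k n) (total k n + 2 * k)) (away k n + 1)
    (numEdges k n) with hm₆
  have hword : ∀ t < away k n, m₆ (away k n + t) = word k n g t := by
    intro t ht'
    rw [hm₆, word]
    by_cases h0 : t = 0
    · subst h0
      rw [Function.update_of_ne (by omega), if_pos rfl]
      simp [hV]
    by_cases h1 : t = 1
    · subst h1
      rw [if_neg h0, if_pos rfl, Function.update_self]
    rw [if_neg h0, if_neg h1, Function.update_of_ne (by omega), Function.update_of_ne (by omega),
      hm₄, segment]
    by_cases h2 : t < 2 + 2 * k
    · rw [if_pos h2, if_neg (by omega), hm₃, segment, if_pos (by omega)]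
      congr 1
      omega
    · rw [if_neg h2]
      by_cases h3 : t < 2 + 2 * k + 2 * numEdges k n
      · rw [if_pos (by omega), if_pos h3,
          show away k n + t - (away k n + 2 + 2 * k) = t - (2 + 2 * k) by omega]
      · rw [if_neg (by omega), if_neg h3, hm₃, segment, if_neg (by omega), hm₂, segment,
          if_neg (by omega), hm₀', if_neg (by omega)]
        exact x.entries_of_le (show area k n ≤ _ by omega)
  -- the copy
  have t₇ := Transforms.fill (S := maxHeight) (R := numRegs) E₆ (y := 6)
    (ea := .var 0) (ev := .get (.var 6 + .var 0)) (A := 0) (f := word k n g) (by omega) (by omega)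
    ⟨by simp, Nat.le_of_ble_eq_true rfl, Nat.le_of_ble_eq_true rfl⟩
    ⟨by simp, Nat.le_of_ble_eq_true rfl, Nat.le_of_ble_eq_true rfl⟩
    (fun t _ m' => by simp)
    (fun t ht' => by
      rw [hv₄.v6] at ht'
      simp only [Ex.eval_get, Ex.eval_add, Ex.eval_var, (hv₄.update t).v6, Function.update_self]
      rw [segment, if_neg (by omega), hword t ht'])
    (fun t ht' => by
      rw [hv₄.v6] at ht'
      rw [← hword t ht']
      exact E₆.mem_le _)
  rw [hv₄.v6] at t₇
  have hv₇ := hv₄.update (away k n)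
  have E₇ : Env b _ (segment 0 (away k n) (word k n g) m₆) :=
    (E₆.of_mem (segment_le (fun i hi => by rw [← hword i hi]; exact E₆.mem_le _) E₆.mem_le)).update
      0 (away k n) (by omega)
  have t₈ := Transforms.fill (S := maxHeight) (R := numRegs) E₇ (y := 6)
    (ea := .var 6 + .var 0) (ev := .lit 0) (A := away k n) (f := fun _ => 0) (by omega) (by omega)
    ⟨by simp, Nat.le_of_ble_eq_true rfl, Nat.le_of_ble_eq_true rfl⟩
    ⟨by simp, Nat.le_of_ble_eq_true rfl, Nat.le_of_ble_eq_true rfl⟩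
    (fun t _ m' => by simp [hv.v6]) (fun t _ => by simp) (fun t _ => by simp)
  rw [hv₇.v6] at t₈
  -- The simulated program expects zeros behind its input. The copy covers the cells below `away`,
  -- the erasing those below `2 * away`, and the cells beyond were zero from the start.
  have hfinal : segment (away k n) (away k n) (fun _ => 0)
      (segment 0 (away k n) (word k n g) m₆) = word k n g := by
    funext a
    rw [segment]
    by_cases h0 : a < away k n
    · rw [if_neg (by omega), segment, if_pos (by omega), Nat.sub_zero]
    · rw [show word k n g a = 0 by
        rw [word, if_neg (by omega), if_neg (by omega), if_neg (by omega), if_neg (by omega)]]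
      by_cases h1 : a < away k n + away k n
      · rw [if_pos (by omega)]
      · rw [if_neg (by omega), segment, if_neg (by omega), hm₆, Function.update_of_ne (by omega),
          Function.update_of_ne (by omega), hm₄, segment, if_neg (by omega), hm₃, segment,
          if_neg (by omega), hm₂, segment, if_neg (by omega), hm₀', if_neg (by omega)]
        exact x.entries_of_le (show area k n ≤ _ by omega)
  rw [hfinal] at t₈
  exact ⟨_, t₀.seq <| t₁.seq <| t₂.seq <| t₃.seq <| t₄.seq <| t₅.seq <| t₆.seq <| t₇.seq t₈⟩

end Lines

end FineGrained

namespace FineGrained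

/-! ### Programs behind other code -/

/-- The instruction, for a program that is moved by `L` places. -/
def Instr.shift (L : ℕ) : Instr → Instr
  | .jump l => .jump (l + L)
  | .jumpIfZero r l => .jumpIfZero r (l + L)
  | i => i

/-- The configuration, for a program that is moved by `L` places. -/
def Config.shift (L : ℕ) (s : Config) : Config := { s with pc := s.pc + L }

theorem Instr.exec_shift (L : ℕ) (ω : ℕ → Bool) (s : Config) (i : Instr) :
    (i.shift L).exec ω (s.shift L) = (i.exec ω s).shift L := by
  cases i with
  | jumpIfZero r l => by_cases h : s.reg r = 0 <;> simp [Instr.exec, Instr.shift, Config.shift, h,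
      add_right_comm]
  | _ => simp [Instr.exec, Instr.shift, Config.shift, add_right_comm]

/-- Shifting all jump targets makes a step commute with moving the program counter. A halted
configuration stays halted, since both lookups fail together. -/
theorem step_shift (p : Program) (cs : List Instr) (ω : ℕ → Bool) (s : Config) :
    step (cs ++ p.map (Instr.shift cs.length)) ω (s.shift cs.length) =
      (step p ω s).shift cs.length := by
  have h : (cs ++ p.map (Instr.shift cs.length))[(s.shift cs.length).pc]? =
      (p[s.pc]?).map (Instr.shift cs.length) := by
    rw [List.getElem?_append_right (by simp [Config.shift])]
    simp [Config.shift]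
  unfold step
  rw [h]
  rcases p[s.pc]? with _ | i
  · rfl
  · exact Instr.exec_shift _ ω s i

theorem iterate_step_shift (p : Program) (cs : List Instr) (ω : ℕ → Bool) (t : ℕ) (s : Config) :
    (step (cs ++ p.map (Instr.shift cs.length)) ω)^[t] (s.shift cs.length) =
      ((step p ω)^[t] s).shift cs.length := by
  induction t with
  | zero => rfl
  | succ t ih => rw [Function.iterate_succ_apply', ih, step_shift, Function.iterate_succ_apply']

theorem flip_mem_shift {p : Program} {L r : ℕ} (h : Instr.flip r ∈ p.map (Instr.shift L)) :
    Instr.flip r ∈ p := by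
  obtain ⟨i, hi, he⟩ := List.mem_map.mp h
  cases i <;> simp [Instr.shift] at he
  subst he
  exact hi

/-! ### The program for `k`-Clique and its resources -/

namespace Lines

theorem flip_notMem_transform (k l r : ℕ) : Instr.flip r ∉ transform k l := by
  simp [transform, setup, Code.seq, Code.assign, Code.loop, Code.store, Ex.flip_notMem_code]

/-- The code that is put in front of a program for `k`-DSP. -/
def prefixCode (k : ℕ) : List Instr := transform k 0 ++ Code.clear numRegs (transform k 0).length

/-- A program for `k`-Clique, from a program for `k`-DSP. -/
def cliqueProgram (k : ℕ) (p : Program) : Program :=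
  prefixCode k ++ p.map (Instr.shift (prefixCode k).length)

theorem flip_notMem_cliqueProgram {k : ℕ} {p : Program} (h : ∀ r, Instr.flip r ∉ p) (r : ℕ) :
    Instr.flip r ∉ cliqueProgram k p := by
  simp only [cliqueProgram, prefixCode, List.mem_append, not_or]
  refine ⟨⟨flip_notMem_transform k 0 r, by simp [Code.clear]⟩, fun h' => h r (flip_mem_shift h')⟩

/-- A bound for all words during the preparation. -/
def prefixBound (k n : ℕ) : ℕ := wordBound k n ^ 2 ^ maxHeight + 1

theorem prefix_reaches {k : ℕ} (hk : 0 < k) (p : Program) (x : CliqueInstance k) (ω : ℕ → Bool) :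
    ∃ t ≤ 2 * (transform k 0).length * wordBound k x.n + numRegs,
      Reaches (cliqueProgram k p) ω (prefixBound k x.n) (init ((kClique k).encode x)) t
        ((init ((kDSP k).encode (dsp k x.n x.entries))).shift (prefixCode k).length) := by
  obtain ⟨v, hv⟩ := transform_transforms hk x
  have l3 := (lit_le_wordBound k x.n).1
  have hb : wordBound k x.n ≤ wordBound k x.n ^ 2 ^ maxHeight := Nat.le_self_pow (by simp) _
  have hcode : HasCode (cliqueProgram k p) 0 (prefixCode k) := by
    intro i hi
    rw [cliqueProgram, zero_add, List.getElem?_append_left hi]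
  have hinit : Bounded (prefixBound k x.n) (init ((kClique k).encode x)) := fun a =>
    ⟨by simp only [init, prefixBound]; omega, by
      have := input_le_wordBound hk x a
      simp only [init, prefixBound]
      omega⟩
  obtain ⟨t, ht, s, r, pc, co, st⟩ := hv (cliqueProgram k p) 0 ω (init ((kClique k).encode x))
    hcode.left rfl ⟨fun _ _ => rfl, rfl, fun _ _ => rfl⟩ hinit
  have hc := hcode.right
  rw [zero_add] at hc pc
  have r' := Code.clear_reaches (ω := ω) hc pc r.bounded
  refine ⟨t + numRegs, by omega, ?_⟩
  change Reaches _ _ (wordBound k x.n ^ 2 ^ maxHeight + 1) _ _ _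
  convert r.trans r' using 1
  simp only [Config.shift, init, Config.mk.injEq, st.mem, co]
  refine ⟨by simp [prefixCode, Code.clear], funext fun y => ?_, funext fun a => ?_, trivial⟩
  · split_ifs with h
    · rfl
    · exact (st.zero y (by omega)).symm
  · exact getD_encode_dsp k x.n x.entries a

theorem run_cliqueProgram {k : ℕ} (hk : 0 < k) (p : Program) (x : CliqueInstance k)
    (ω : ℕ → Bool) :
    ∃ t₀ ≤ 2 * (transform k 0).length * wordBound k x.n + numRegs,
      (∀ t ≤ t₀, Bounded (prefixBound k x.n)
        (run (cliqueProgram k p) ((kClique k).encode x) ω t)) ∧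
      ∀ t, run (cliqueProgram k p) ((kClique k).encode x) ω (t₀ + t) =
        (run p ((kDSP k).encode (dsp k x.n x.entries)) ω t).shift (prefixCode k).length := by
  obtain ⟨t₀, ht₀, r⟩ := prefix_reaches hk p x ω
  refine ⟨t₀, ht₀, r.bdd, fun t => ?_⟩
  rw [run, add_comm, Function.iterate_add_apply, r.eq]
  exact iterate_step_shift p _ ω t _

theorem haltedAt_cliqueProgram {k : ℕ} {p : Program} {x : CliqueInstance k} {ω : ℕ → Bool}
    {t t' : ℕ} {input : List ℕ}
    (h : run (cliqueProgram k p) ((kClique k).encode x) ω t =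
      (run p input ω t').shift (prefixCode k).length) :
    HaltedAt (cliqueProgram k p) ((kClique k).encode x) ω t ↔ HaltedAt p input ω t' := by
  rw [HaltedAt, h, HaltedAt, cliqueProgram]
  simp [Config.shift, add_comm]

/-- The preparation tosses no coins, so the simulated program uses the same bits `ω`. Hence success
carries over for each `ω`, and the error probability does not grow. -/
theorem answers_cliqueProgram {k : ℕ} (hk : 0 < k) {p : Program} {x : CliqueInstance k}
    {ω : ℕ → Bool} (h : Answers (kDSP k) p (dsp k x.n x.entries) ω) :
    Answers (kClique k) (cliqueProgram k p) x ω := by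
  obtain ⟨t, hhalt, hcor⟩ := h
  obtain ⟨t₀, -, -, hrun⟩ := run_cliqueProgram hk p x ω
  refine ⟨t₀ + t, (haltedAt_cliqueProgram (hrun t)).mpr hhalt, ?_⟩
  rw [hrun t]
  exact Iff.trans hcor (hasDisjointShortestPaths_iff.trans x.exists_clique_iff.symm)

/-! ### Bounds in terms of the size -/

/-- The bound is a quadratic polynomial in `n` whose coefficients sum to `wordBound k 1`, and each
of `1`, `n`, `n²` is at most `(n + 1)²`. -/
theorem wordBound_le (k n : ℕ) : wordBound k n ≤ wordBound k 1 * (n + 1) ^ 2 := by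
  have h1 : 1 ≤ (n + 1) ^ 2 := Nat.one_le_pow _ _ (by omega)
  have h2 : n ≤ (n + 1) ^ 2 := by nlinarith
  have h3 : n ^ 2 ≤ (n + 1) ^ 2 := Nat.pow_le_pow_left (by omega) 2
  have e : ∀ n, wordBound k n = (6 + 4 * k + widthFactor k + 3 * k.factorial) * 1 +
      12 * k * n + (4 * k * widthFactor k + 2 * k ^ 2) * n ^ 2 := by
    intro n
    rw [wordBound, away, total, area, width_eq]
    ring
  have e1 : wordBound k 1 * (n + 1) ^ 2 = (6 + 4 * k + widthFactor k + 3 * k.factorial) *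
      (n + 1) ^ 2 + 12 * k * (n + 1) ^ 2 +
      (4 * k * widthFactor k + 2 * k ^ 2) * (n + 1) ^ 2 := by
    rw [e 1]
    ring
  rw [e n, e1]
  exact Nat.add_le_add (Nat.add_le_add (Nat.mul_le_mul_left _ h1) (Nat.mul_le_mul_left _ h2))
    (Nat.mul_le_mul_left _ h3)

theorem lt_two_pow_log (n : ℕ) : n + 1 ≤ 2 ^ (Nat.log 2 n + 1) :=
  Nat.lt_pow_succ_log_self (by omega) n

theorem wordBound_le_two_pow (k n : ℕ) :
    wordBound k n ≤ 2 ^ ((wordBound k 1 + 2) * (Nat.log 2 n + 1)) := by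
  have h1 := lt_two_pow_log n
  have h2 : wordBound k 1 ≤ 2 ^ (wordBound k 1 * (Nat.log 2 n + 1)) :=
    Nat.lt_two_pow_self.le.trans (Nat.pow_le_pow_right (by omega) (Nat.le_mul_of_pos_right _ (by omega)))
  calc wordBound k n ≤ wordBound k 1 * (n + 1) ^ 2 := wordBound_le k n
    _ ≤ 2 ^ (wordBound k 1 * (Nat.log 2 n + 1)) * (2 ^ (Nat.log 2 n + 1)) ^ 2 :=
        Nat.mul_le_mul h2 (Nat.pow_le_pow_left h1 2)
    _ = _ := by rw [← pow_mul, ← pow_add]; ring_nf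

theorem numVertices_le_wordBound (k n : ℕ) : numVertices k n ≤ wordBound k n := by
  have ha := away_le_wordBound k n
  have ht := total_le_away k n
  rw [numVertices_eq]
  omega

theorem le_numVertices {k : ℕ} (hk : 0 < k) (n : ℕ) : n ≤ numVertices k n := by
  have hW := width_ge k n
  have h1 : n ≤ k * n := Nat.le_mul_of_pos_left n hk
  have h2 : k * n ≤ k * n * width k n := Nat.le_mul_of_pos_right _ (by omega)
  unfold numVertices
  omega

theorem respectsWordSize_cliqueProgram {k : ℕ} (hk : 0 < k) {p : Program} {c : ℕ}
    (hp : RespectsWordSize (kDSP k) p c) :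
    ∃ c', RespectsWordSize (kClique k) (cliqueProgram k p) c' := by
  set d := wordBound k 1 + 2 with hd
  -- The first summand pays for the preparation, with words up to `wordBound ^ 2 ^ maxHeight`. The
  -- second pays for the simulated program, whose size parameter has a logarithm of at most `d * L`.
  refine ⟨(d * 2 ^ maxHeight + 1) + (d + 1) * c, fun x ω t a => ?_⟩
  obtain ⟨t₀, -, hbd, hrun⟩ := run_cliqueProgram hk p x ω
  change _ < 2 ^ (_ * (Nat.log 2 x.n + 1)) ∧ _ < 2 ^ (_ * (Nat.log 2 x.n + 1))
  set L := Nat.log 2 x.n + 1 with hL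
  have hw : wordBound k x.n ≤ 2 ^ (d * L) := wordBound_le_two_pow k x.n
  rcases le_total t t₀ with h | h
  · have hB : prefixBound k x.n ≤ 2 ^ ((d * 2 ^ maxHeight + 1 + (d + 1) * c) * L) := by
      calc prefixBound k x.n ≤ (2 ^ (d * L)) ^ 2 ^ maxHeight + 1 :=
            Nat.succ_le_succ (Nat.pow_le_pow_left hw _)
        _ = 2 ^ (d * L * 2 ^ maxHeight) + 1 := by rw [← pow_mul]
        _ ≤ 2 ^ (d * L * 2 ^ maxHeight) * 2 := by
            have : 0 < 2 ^ (d * L * 2 ^ maxHeight) := Nat.pow_pos (by omega)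
            omega
        _ = 2 ^ (d * L * 2 ^ maxHeight + 1) := (pow_succ _ _).symm
        _ ≤ _ := Nat.pow_le_pow_right (by omega) (by
            have e : (d * 2 ^ maxHeight + 1 + (d + 1) * c) * L =
              d * L * 2 ^ maxHeight + L + (d + 1) * c * L := by ring
            omega)
    exact ⟨((hbd t h) a).1.trans_le hB, ((hbd t h) a).2.trans_le hB⟩
  · obtain ⟨t', rfl⟩ := Nat.exists_eq_add_of_le h
    rw [hrun t']
    have h1 := hp (dsp k x.n x.entries) ω t' a
    change _ < 2 ^ (c * (Nat.log 2 (numVertices k x.n) + 1)) ∧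
      _ < 2 ^ (c * (Nat.log 2 (numVertices k x.n) + 1)) at h1
    have h2 : 2 ^ (c * (Nat.log 2 (numVertices k x.n) + 1)) ≤
        2 ^ ((d * 2 ^ maxHeight + 1 + (d + 1) * c) * L) := by
      refine Nat.pow_le_pow_right (by omega) ?_
      have h3 : Nat.log 2 (numVertices k x.n) ≤ d * L := by
        calc Nat.log 2 (numVertices k x.n) ≤ Nat.log 2 (2 ^ (d * L)) :=
              Nat.log_mono_right ((numVertices_le_wordBound k x.n).trans hw)
          _ = d * L := Nat.log_pow (by omega) _
      have h4 := Nat.mul_le_mul_left c (Nat.add_le_add h3 (show 1 ≤ L by omega))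
      have e : (d * 2 ^ maxHeight + 1 + (d + 1) * c) * L =
        (d * 2 ^ maxHeight + 1) * L + c * (d * L + L) := by ring
      omega
    exact ⟨h1.1.trans_le h2, h1.2.trans_le h2⟩

/-- The preparation takes `O(n²)` steps, which `n ^ (2 * β)` absorbs because `β ≥ 1`; the simulated
run has size parameter `O(n²)`. -/
theorem runsInTime_cliqueProgram {k : ℕ} (hk : 0 < k) {p : Program} {β : ℝ} (hβ : 1 ≤ β)
    (hp : RunsInTime (kDSP k) p fun n => (n : ℝ) ^ β) :
    RunsInTime (kClique k) (cliqueProgram k p) fun n => (n : ℝ) ^ (2 * β) := by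
  obtain ⟨hhalt, C, n₀, hC⟩ := hp
  refine ⟨fun x ω => ?_, ?_⟩
  · obtain ⟨t₀, -, -, hrun⟩ := run_cliqueProgram hk p x ω
    obtain ⟨t, ht⟩ := hhalt (dsp k x.n x.entries) ω
    exact ⟨t₀ + t, (haltedAt_cliqueProgram (hrun t)).mpr ht⟩
  -- The factor `4` comes from `(n + 1)² ≤ 4 n²`, valid for `n ≥ 1`; hence the maximum with `1` in
  -- the threshold.
  · set K : ℝ := 4 * wordBound k 1 with hK
    refine ⟨2 * (transform k 0).length * K + numRegs + |C| * K ^ β, max n₀ 1, fun x ω hx => ?_⟩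
    change max n₀ 1 ≤ x.n at hx
    change ∃ t : ℕ, (t : ℝ) ≤ _ * (x.n : ℝ) ^ (2 * β) ∧ _
    have hn1 : 1 ≤ x.n := (le_max_right _ _).trans hx
    have hn0 : n₀ ≤ numVertices k x.n := ((le_max_left _ _).trans hx).trans (le_numVertices hk x.n)
    obtain ⟨t₀, ht₀, -, hrun⟩ := run_cliqueProgram hk p x ω
    obtain ⟨t, ht, hhalt'⟩ := hC (dsp k x.n x.entries) ω hn0
    change (t : ℝ) ≤ C * (numVertices k x.n : ℝ) ^ β at ht
    refine ⟨t₀ + t, ?_, (haltedAt_cliqueProgram (hrun t)).mpr hhalt'⟩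
    have hnR : (1 : ℝ) ≤ x.n := by exact_mod_cast hn1
    have hw : (wordBound k x.n : ℝ) ≤ K * (x.n : ℝ) ^ 2 := by
      have h1 : wordBound k x.n ≤ 4 * wordBound k 1 * x.n ^ 2 := by
        refine (wordBound_le k x.n).trans ?_
        have : (x.n + 1) ^ 2 ≤ 4 * x.n ^ 2 := by nlinarith
        nlinarith [Nat.mul_le_mul_left (wordBound k 1) this]
      rw [hK]
      exact_mod_cast h1
    have hsq : (x.n : ℝ) ^ 2 ≤ (x.n : ℝ) ^ (2 * β) := by
      rw [← Real.rpow_natCast]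
      exact Real.rpow_le_rpow_of_exponent_le hnR (by push_cast; linarith)
    have h1le : (1 : ℝ) ≤ (x.n : ℝ) ^ (2 * β) := Real.one_le_rpow hnR (by linarith)
    have hK0 : 0 ≤ K := by positivity
    have hNw : (numVertices k x.n : ℝ) ≤ K * (x.n : ℝ) ^ 2 :=
      le_trans (by exact_mod_cast numVertices_le_wordBound k x.n) hw
    have hN : (numVertices k x.n : ℝ) ^ β ≤ K ^ β * (x.n : ℝ) ^ (2 * β) := by
      calc (numVertices k x.n : ℝ) ^ β ≤ (K * (x.n : ℝ) ^ 2) ^ β :=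
            Real.rpow_le_rpow (by positivity) hNw (by linarith)
        _ = K ^ β * (x.n : ℝ) ^ (2 * β) := by
            rw [Real.mul_rpow hK0 (by positivity), Real.rpow_mul (by positivity)]
            norm_num
    have ht₀' : (t₀ : ℝ) ≤ 2 * (transform k 0).length * wordBound k x.n + numRegs := by
      exact_mod_cast ht₀
    have hCle : C * (numVertices k x.n : ℝ) ^ β ≤ |C| * (K ^ β * (x.n : ℝ) ^ (2 * β)) :=
      mul_le_mul (le_abs_self C) hN (by positivity) (abs_nonneg C)
    have h5 : 2 * ((transform k 0).length : ℝ) * wordBound k x.n ≤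
        2 * (transform k 0).length * (K * (x.n : ℝ) ^ (2 * β)) :=
      mul_le_mul_of_nonneg_left (hw.trans (mul_le_mul_of_nonneg_left hsq hK0)) (by positivity)
    have h6 : (numRegs : ℝ) ≤ numRegs * (x.n : ℝ) ^ (2 * β) :=
      le_mul_of_one_le_right (by positivity) h1le
    push_cast
    linarith

/-- The reduction from `k`-Clique to `k`-DSP. -/
theorem solvableInTime_kClique {k : ℕ} (hk : 0 < k) {mode : Mode} {β : ℝ} (hβ : 1 ≤ β)
    (h : SolvableInTime mode (kDSP k) fun n => (n : ℝ) ^ β) :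
    SolvableInTime mode (kClique k) fun n => (n : ℝ) ^ (2 * β) := by
  obtain ⟨p, ⟨c, hc⟩, ht, hs⟩ := h
  refine ⟨cliqueProgram k p, respectsWordSize_cliqueProgram hk hc, runsInTime_cliqueProgram hk hβ ht,
    ?_⟩
  cases mode with
  | deterministic =>
    exact ⟨flip_notMem_cliqueProgram hs.1, fun x ω => answers_cliqueProgram hk (hs.2 _ ω)⟩
  | randomized =>
    exact fun x => (hs (dsp k x.n x.entries)).trans
      (MeasureTheory.measure_mono fun ω hω => answers_cliqueProgram hk hω)

end Lines

end FineGrained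

namespace FineGrained

/-! ### Dependence of a run on the coins and on the input -/

theorem run_succ (p : Program) (input : List ℕ) (ω : ℕ → Bool) (t : ℕ) :
    run p input ω (t + 1) = step p ω (run p input ω t) :=
  Function.iterate_succ_apply' _ _ _

theorem step_coins_le (p : Program) (ω : ℕ → Bool) (s : Config) :
    (step p ω s).coins ≤ s.coins + 1 := by
  unfold step
  rcases p[s.pc]? with _ | i
  · exact Nat.le_succ _
  · cases i <;> simp [Instr.exec]

theorem run_coins_le (p : Program) (input : List ℕ) (ω : ℕ → Bool) (t : ℕ) :
    (run p input ω t).coins ≤ t := by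
  induction t with
  | zero => exact le_rfl
  | succ t ih =>
    rw [run_succ]
    exact (step_coins_le p ω _).trans (Nat.succ_le_succ ih)

theorem step_congr_coins (p : Program) {ω ω' : ℕ → Bool} {s : Config}
    (h : ω s.coins = ω' s.coins) : step p ω s = step p ω' s := by
  unfold step
  rcases p[s.pc]? with _ | i
  · rfl
  · cases i <;> simp [Instr.exec, h]

theorem run_congr_coins (p : Program) (input : List ℕ) {ω ω' : ℕ → Bool} (t : ℕ)
    (h : ∀ i < t, ω i = ω' i) : run p input ω t = run p input ω' t := by
  induction t with
  | zero => rfl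
  | succ t ih =>
    rw [run_succ, run_succ, ih fun i hi => h i (by omega)]
    exact step_congr_coins p (h _ (Nat.lt_succ_of_le (run_coins_le p input ω' t)))

/-- The configuration after `t` steps depends on the first `t` coins only, so the event is the
preimage of a set in a finite space. -/
theorem measurableSet_of_run (p : Program) (input : List ℕ) (t : ℕ) (S : Config → Prop) :
    MeasurableSet {ω : ℕ → Bool | S (run p input ω t)} := by
  let restrict : (ℕ → Bool) → Fin t → Bool := fun ω i => ω i
  let extend : (Fin t → Bool) → ℕ → Bool := fun ω i => if h : i < t then ω ⟨i, h⟩ else false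
  have hr : Measurable restrict := measurable_pi_lambda _ fun i => measurable_pi_apply _
  have h : {ω : ℕ → Bool | S (run p input ω t)} =
      restrict ⁻¹' {ω | S (run p input (extend ω) t)} := by
    ext ω
    simp only [Set.mem_ofPred_eq, Set.mem_preimage]
    rw [run_congr_coins p input (ω' := extend (restrict ω)) t
      fun i hi => by simp [extend, restrict, hi]]
  rw [h]
  exact hr (Set.toFinite _).measurableSet

theorem run_eq_of_haltedAt {p : Program} {input : List ℕ} {ω : ℕ → Bool} {t t' : ℕ}
    (h : HaltedAt p input ω t) (ht : t ≤ t') : run p input ω t' = run p input ω t := by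
  induction t', ht using Nat.le_induction with
  | base => rfl
  | succ t' _ ih =>
    rw [run_succ, ih, step, List.getElem?_eq_none h]

/-- The memory cell that is read in the next step, if any. -/
def readCell (p : Program) (s : Config) : Option ℕ :=
  match p[s.pc]? with
  | some (.load _ x) => some (s.reg x)
  | _ => none

/-- Two configurations differ at most in the memory cells in `Z`. -/
structure AgreeOff (Z : Set ℕ) (s s' : Config) : Prop where
  pc : s.pc = s'.pc
  reg : s.reg = s'.reg
  coins : s.coins = s'.coins
  mem : ∀ a ∉ Z, s.mem a = s'.mem a

/-- The contents of the memory enter a step only through `load`; a `store` writes the same word to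
the same cell on both sides. -/
theorem AgreeOff.step {Z : Set ℕ} {s s' : Config} (h : AgreeOff Z s s') (p : Program)
    (ω : ℕ → Bool) (hr : ∀ a, readCell p s = some a → a ∉ Z) :
    AgreeOff Z (step p ω s) (step p ω s') := by
  obtain ⟨h1, h2, h3, h4⟩ := h
  unfold FineGrained.step
  unfold readCell at hr
  rw [← h1]
  generalize p[s.pc]? = o at hr ⊢
  rcases o with _ | i
  · exact ⟨h1, h2, h3, h4⟩
  · cases i with
    | load r x =>
      refine ⟨by simp [Instr.exec, h1], ?_, h3, h4⟩
      simp [Instr.exec, ← h2, h4 _ (hr _ rfl)]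
    | store x r =>
      refine ⟨by simp [Instr.exec, h1], h2, h3, fun a ha => ?_⟩
      simp only [Instr.exec, ← h2]
      by_cases hax : a = s.reg x
      · rw [hax, Function.update_self, Function.update_self]
      · rw [Function.update_of_ne hax, Function.update_of_ne hax, h4 a ha]
    | _ => exact ⟨by simp [Instr.exec, h1, h2], by simp [Instr.exec, h2, h3], by simp [Instr.exec, h3], h4⟩

theorem run_agreeOff {Z : Set ℕ} {p : Program} {input input' : List ℕ} {ω : ℕ → Bool}
    (hin : ∀ a ∉ Z, input.getD a 0 = input'.getD a 0) (T : ℕ)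
    (hr : ∀ t < T, ∀ a, readCell p (run p input ω t) = some a → a ∉ Z) :
    AgreeOff Z (run p input ω T) (run p input' ω T) := by
  induction T with
  | zero => exact ⟨rfl, rfl, rfl, hin⟩
  | succ T ih =>
    rw [run_succ, run_succ]
    exact (ih fun t ht => hr t (by omega)).step p ω (hr T (by omega))

/-! ### Instances of `k`-DSP that have to be read -/

/-- The graph on `m + 3` vertices whose edge number `i` goes from `2` to `i + 3`, except for the edge
number `j` from `0` to `1`. All paths are to go from `0` to `1`. -/
def starInstance (k m j : ℕ) : DSPInstance k where
  n := m + 3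
  edges := List.ofFn fun i : Fin m =>
    if (i : ℕ) = j then (⟨0, by omega⟩, ⟨1, by omega⟩) else (⟨2, by omega⟩, ⟨i + 3, by omega⟩)
  nodup := by
    refine List.nodup_ofFn.mpr fun i i' h => ?_
    ext
    split_ifs at h with h1 h2 h2
    · omega
    · simp at h
    · simp at h
    · simpa using h
  acyclic := by
    intro v hv
    have key : ∀ u w : Fin (m + 3), Relation.TransGen (fun u w => (u, w) ∈ List.ofFn fun i : Fin m =>
        if (i : ℕ) = j then ((⟨0, by omega⟩, ⟨1, by omega⟩) : Fin (m + 3) × Fin (m + 3))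
        else (⟨2, by omega⟩, ⟨i + 3, by omega⟩)) u w → u < w := by
      intro u w h
      have edge : ∀ u w : Fin (m + 3), ((u, w) ∈ List.ofFn fun i : Fin m =>
          if (i : ℕ) = j then ((⟨0, by omega⟩, ⟨1, by omega⟩) : Fin (m + 3) × Fin (m + 3))
          else (⟨2, by omega⟩, ⟨i + 3, by omega⟩)) → u < w := by
        intro u w h
        obtain ⟨i, hi⟩ := List.mem_ofFn.mp h
        split_ifs at hi <;> rw [Prod.mk.injEq] at hi <;> obtain ⟨rfl, rfl⟩ := hi <;>
          rw [Fin.lt_def] <;> simp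
      induction h with
      | single h => exact edge _ _ h
      | tail _ h ih => exact ih.trans (edge _ _ h)
    exact lt_irrefl _ (key v v hv)
  source := fun _ => ⟨0, by omega⟩
  target := fun _ => ⟨1, by omega⟩

theorem mem_edges_starInstance {k m j : ℕ} {u w : Fin (m + 3)} :
    (u, w) ∈ (starInstance k m j).edges ↔
      ∃ i : Fin m, ((i : ℕ) = j ∧ (u : ℕ) = 0 ∧ (w : ℕ) = 1) ∨
        ((i : ℕ) ≠ j ∧ (u : ℕ) = 2 ∧ (w : ℕ) = i + 3) := by
  refine List.mem_ofFn.trans (exists_congr fun i => ?_)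
  split_ifs with h <;> rw [Prod.mk.injEq, Fin.ext_iff, Fin.ext_iff] <;> dsimp only <;> omega

/-- All `k` pairs have the same ends, so the single edge from `0` to `1` serves every one of them;
sharing endpoints is allowed. Without this edge nothing leaves vertex `0`. -/
theorem starInstance_yes_iff {k m j : ℕ} (hk : 0 < k) :
    (starInstance k m j).HasDisjointShortestPaths ↔ j < m := by
  constructor
  · rintro ⟨P, hP, -⟩
    obtain ⟨⟨hc, -, h1, h2⟩, -⟩ := hP ⟨0, hk⟩
    generalize P ⟨0, hk⟩ = Q at hc h1 h2
    match Q with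
    | [] => simp at h1
    | [u] =>
      simp only [List.head?_cons, Option.some.injEq, List.getLast?_singleton] at h1 h2
      rw [h1] at h2
      simp [starInstance] at h2
    | u :: w :: Q =>
      simp only [List.head?_cons, Option.some.injEq] at h1
      obtain ⟨i, ⟨h, -⟩ | ⟨-, h, -⟩⟩ := mem_edges_starInstance.mp (List.isChain_cons_cons.mp hc).1
      · rw [← h]
        exact i.2
      · rw [h1] at h
        simp [starInstance] at h
  · intro hj
    have he : ((starInstance k m j).source ⟨0, hk⟩, (starInstance k m j).target ⟨0, hk⟩) ∈
        (starInstance k m j).edges :=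
      mem_edges_starInstance.mpr ⟨⟨j, hj⟩, Or.inl ⟨rfl, rfl, rfl⟩⟩
    have hne : (starInstance k m j).source ⟨0, hk⟩ ≠ (starInstance k m j).target ⟨0, hk⟩ := by
      simp [starInstance]
    refine ⟨fun _ => [(starInstance k m j).source ⟨0, hk⟩, (starInstance k m j).target ⟨0, hk⟩],
      fun i => ⟨⟨?_, ?_, rfl, rfl⟩, fun Q hQ => ?_⟩, fun i j _ v hv hv' => ?_⟩
    · simpa using he
    · simpa using hne
    · obtain ⟨-, -, h1, h2⟩ := hQ
      match Q with
      | [] => simp at h1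
      | [u] =>
        simp only [List.head?_cons, Option.some.injEq, List.getLast?_singleton] at h1 h2
        rw [h1] at h2
        exact absurd h2 hne
      | u :: w :: Q => simp
    · simp only [List.mem_cons, List.not_mem_nil, or_false] at hv
      exact ⟨hv, hv⟩

theorem getElem?_edges_starInstance {k m j i : ℕ} (h : i ≠ j) :
    (starInstance k m j).edges[i]? = (starInstance k m m).edges[i]? := by
  simp only [starInstance]
  refine List.getElem?_ofFn.trans (Eq.trans ?_ List.getElem?_ofFn.symm)
  by_cases hi : i < m
  · rw [dif_pos hi, dif_pos hi, if_neg h, if_neg hi.ne]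
  · rw [dif_neg hi, dif_neg hi]

/-- Two counts and `2k` terminals precede the edges, so edge `j` occupies the cells `2 (k + 1 + j)`
and `2 (k + 1 + j) + 1`. -/
theorem encode_starInstance_getD {k m j a : ℕ}
    (ha : a / 2 ≠ k + 1 + j) :
    ((kDSP k).encode (starInstance k m j)).getD a 0 =
      ((kDSP k).encode (starInstance k m m)).getD a 0 := by
  change (starInstance k m j).encode.getD a 0 = (starInstance k m m).encode.getD a 0
  match a with
  | 0 => rfl
  | 1 => simp [DSPInstance.encode, starInstance]
  | a + 2 =>
    simp only [DSPInstance.encode, List.getD_cons_succ]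
    rw [List.getD_eq_getElem?_getD, List.getD_eq_getElem?_getD]
    obtain ⟨L, hL⟩ : ∃ L, L = (List.ofFn fun i => ((starInstance k m m).source i : ℕ)) ++
      List.ofFn fun i => ((starInstance k m m).target i : ℕ) := ⟨_, rfl⟩
    have hlen : L.length = 2 * k := by simp [hL]; omega
    have happend : ∀ l : List ℕ, (L ++ l)[a]? = if a < 2 * k then L[a]? else l[a - 2 * k]? := by
      intro l
      rw [List.getElem?_append, hlen]
    have hm := happend ((starInstance k m m).edges.flatMap fun e => [(e.1 : ℕ), (e.2 : ℕ)])
    have hj := happend ((starInstance k m j).edges.flatMap fun e => [(e.1 : ℕ), (e.2 : ℕ)])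
    have heq : (L ++ (starInstance k m j).edges.flatMap fun e => [(e.1 : ℕ), (e.2 : ℕ)])[a]? =
        (L ++ (starInstance k m m).edges.flatMap fun e => [(e.1 : ℕ), (e.2 : ℕ)])[a]? := by
      rw [hm, hj]
      split_ifs
      · rfl
      · rw [getElem?_flatMap_pair, getElem?_flatMap_pair, getElem?_edges_starInstance (by omega)]
        rfl
    rw [hL] at heq
    exact congrArg (·.getD 0) heq

/-! ### The lower bound -/

instance : MeasureTheory.IsProbabilityMeasure coinMeasure := by
  unfold coinMeasure
  infer_instance

theorem Solves.two_thirds_le {P : Problem} {p : Program} {mode : Mode} (h : Solves P p mode)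
    (x : P.Instance) : 2 / 3 ≤ coinMeasure {ω | Answers P p x ω} := by
  cases mode with
  | deterministic =>
    have : {ω | Answers P p x ω} = Set.univ := Set.eq_univ_of_forall fun ω => h.2 x ω
    rw [this, MeasureTheory.measure_univ]
    exact ENNReal.div_le_of_le_mul (by norm_num)
  | randomized => exact h x

/-- A family of events of which at most `T` occur at once has total probability at most `T`. -/
theorem sum_measure_le_of_card_le {m T : ℕ} {R : Fin m → Set (ℕ → Bool)}
    (hR : ∀ j, MeasurableSet (R j)) (hT : ∀ ω, ∃ f : Fin m → ℕ, (∀ j, ω ∈ R j → f j < T) ∧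
      ∀ j j', ω ∈ R j → ω ∈ R j' → f j = f j' → j = j') :
    ∑ j, coinMeasure (R j) ≤ T := by
  classical
  calc ∑ j, coinMeasure (R j) = ∑ j, ∫⁻ ω, (R j).indicator 1 ω ∂coinMeasure := by
        simp_rw [MeasureTheory.lintegral_indicator_one (hR _)]
    _ = ∫⁻ ω, ∑ j, (R j).indicator 1 ω ∂coinMeasure :=
        (MeasureTheory.lintegral_finsetSum _ fun j _ => measurable_one.indicator (hR j)).symm
    _ ≤ ∫⁻ _, (T : ENNReal) ∂coinMeasure := by
        refine MeasureTheory.lintegral_mono fun ω => ?_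
        obtain ⟨f, hf, hinj⟩ := hT ω
        have h1 : ∑ j, (R j).indicator (1 : (ℕ → Bool) → ENNReal) ω =
            ((Finset.univ.filter fun j => ω ∈ R j).card : ENNReal) := by
          rw [Finset.card_filter]
          push_cast
          exact Finset.sum_congr rfl fun j _ => by simp [Set.indicator_apply]
        rw [h1]
        have h2 : (Finset.univ.filter fun j => ω ∈ R j).card ≤ (Finset.range T).card :=
          Finset.card_le_card_of_injOn f
            (fun j hj => by simpa using hf j (by simpa using hj))
            (fun j hj j' hj' h => hinj j j' (by simpa using hj) (by simpa using hj') h)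
        rw [Finset.card_range] at h2
        exact Nat.cast_le.mpr h2
    _ = T := by simp

/-- A program for `k`-DSP needs linear time. -/
theorem le_three_mul_of_solves {k m T : ℕ} (hk : 0 < k) {p : Program} {mode : Mode}
    (hs : Solves (kDSP k) p mode)
    (hT : ∀ j ω, HaltedAt p ((kDSP k).encode (starInstance k m j)) ω T) : m ≤ 3 * T := by
  have hans : ∀ j, {ω | Answers (kDSP k) p (starInstance k m j) ω} =
      {ω | (run p ((kDSP k).encode (starInstance k m j)) ω T).reg 0 ≠ 0 ↔ j < m} := by
    intro j
    ext ω
    have e : ∀ s : Config, (kDSP k).Correct (starInstance k m j) s ↔ (s.reg 0 ≠ 0 ↔ j < m) :=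
      fun s => iff_congr Iff.rfl (starInstance_yes_iff hk)
    simp only [Set.mem_ofPred_eq]
    constructor
    · rintro ⟨t, ht, hc⟩
      rw [e] at hc
      rcases le_total t T with h | h
      · rwa [run_eq_of_haltedAt ht h]
      · rwa [← run_eq_of_haltedAt (hT j ω) h]
    · exact fun h => ⟨T, hT j ω, (e _).mpr h⟩
  set A : ℕ → Set (ℕ → Bool) := fun j =>
    {ω | (run p ((kDSP k).encode (starInstance k m j)) ω T).reg 0 ≠ 0 ↔ j < m} with hA
  have hA23 : ∀ j, 2 / 3 ≤ coinMeasure (A j) := fun j => by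
    have := hs.two_thirds_le (starInstance k m j)
    rwa [hans j] at this
  -- All reading events refer to the one no-instance `j = m`, so that they can be counted within a
  -- single run.
  set R : Fin m → Set (ℕ → Bool) := fun j => {ω | ∃ t < T, ∃ a,
    readCell p (run p ((kDSP k).encode (starInstance k m m)) ω t) = some a ∧
      a / 2 = k + 1 + j} with hR
  have hRm : ∀ j, MeasurableSet (R j) := by
    intro j
    have : R j = ⋃ t ∈ Set.Iio T, {ω | ∃ a,
        readCell p (run p ((kDSP k).encode (starInstance k m m)) ω t) = some a ∧
          a / 2 = k + 1 + j} := by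
      ext ω
      simp [hR]
    rw [this]
    exact MeasurableSet.biUnion (Set.to_countable _) fun t _ => measurableSet_of_run p _ t fun s =>
      ∃ a, readCell p s = some a ∧ a / 2 = k + 1 + j
  -- If edge `j` is never read, the runs on the no-instance and on the yes-instance `j` agree and
  -- cannot both be correct.
  have hsub : ∀ j : Fin m, A m ∩ A j ⊆ R j := by
    rintro j ω ⟨h1, h2⟩
    by_contra hω
    have hag := run_agreeOff (Z := {a | a / 2 = k + 1 + j}) (p := p) (ω := ω)
      (input := (kDSP k).encode (starInstance k m m))
      (input' := (kDSP k).encode (starInstance k m j))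
      (fun a ha => (encode_starInstance_getD ha).symm) T
      (fun t ht a ha haZ => hω ⟨t, ht, a, ha, haZ⟩)
    simp only [hA, Set.mem_ofPred_eq, lt_irrefl, iff_false, not_not] at h1
    simp only [hA, Set.mem_ofPred_eq, j.2, iff_true] at h2
    rw [← hag.reg] at h2
    exact h2 h1
  -- Two events of probability at least `2 / 3` overlap with probability at least `1 / 3`.
  have hR13 : ∀ j, 1 / 3 ≤ coinMeasure (R j) := by
    intro j
    have hAm : MeasurableSet (A m) := measurableSet_of_run p _ T fun s => s.reg 0 ≠ 0 ↔ m < m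
    have h1 := MeasureTheory.measure_union_add_inter' (μ := coinMeasure) hAm (A j)
    have h2 : coinMeasure (A m ∪ A j) ≤ 1 := MeasureTheory.prob_le_one
    have h3 := MeasureTheory.measure_mono (μ := coinMeasure) (hsub j)
    have h4 : (1 : ENNReal) + 1 / 3 ≤ 1 + coinMeasure (R j) := by
      calc (1 : ENNReal) + 1 / 3 = 2 / 3 + 2 / 3 := by
            rw [← ENNReal.add_div, ENNReal.eq_div_iff (by norm_num) (by norm_num), mul_add,
              ENNReal.mul_div_cancel (by norm_num) (by norm_num)]
            norm_num
        _ ≤ coinMeasure (A m) + coinMeasure (A j) := add_le_add (hA23 m) (hA23 j)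
        _ = coinMeasure (A m ∪ A j) + coinMeasure (A m ∩ A j) := h1.symm
        _ ≤ 1 + coinMeasure (R j) := add_le_add h2 h3
    exact (ENNReal.add_le_add_iff_left (by norm_num)).mp h4
  have hsum : ∑ j, coinMeasure (R j) ≤ T := by
    refine sum_measure_le_of_card_le hRm fun ω => ?_
    classical
    -- The witness is a time at which edge `j` is read. A step reads at most one cell and a cell
    -- belongs to one edge, so different edges have different times.
    refine ⟨fun j => if h : ω ∈ R j then h.choose else 0, fun j hj => ?_, fun j j' hj hj' h => ?_⟩
    · simp only [dif_pos hj]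
      exact hj.choose_spec.1
    · simp only [dif_pos hj, dif_pos hj'] at h
      obtain ⟨-, a, h1, h2⟩ := hj.choose_spec
      obtain ⟨-, a', h1', h2'⟩ := hj'.choose_spec
      rw [h, h1'] at h1
      obtain rfl : a' = a := by simpa using h1
      ext
      omega
  have h5 : (m : ENNReal) * (1 / 3) ≤ T := by
    refine le_trans ?_ hsum
    have := Finset.sum_le_sum fun (j : Fin m) (_ : j ∈ Finset.univ) => hR13 j
    simpa using this
  have h6 : (m : ENNReal) ≤ 3 * T := by
    have := mul_le_mul_right h5 3
    rw [mul_comm (m : ENNReal), ← mul_assoc, ENNReal.mul_div_cancel (by norm_num) (by norm_num),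
      one_mul] at this
    exact this
  exact_mod_cast h6

theorem not_solvableInTime_kDSP {k : ℕ} (hk : 0 < k) (mode : Mode) {β : ℝ} (hβ : β < 1) :
    ¬ SolvableInTime mode (kDSP k) fun n => (n : ℝ) ^ β := by
  rintro ⟨p, -, ⟨-, C, n₀, hC⟩, hs⟩
  -- A negative exponent is replaced by `0`, so that `N ^ γ ≥ 1`.
  set γ := max β 0 with hγ
  have hγ1 : γ < 1 := max_lt hβ one_pos
  have hlim : Filter.Tendsto (fun N : ℕ => (N : ℝ) ^ (1 - γ)) Filter.atTop Filter.atTop :=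
    (tendsto_rpow_atTop (by linarith)).comp tendsto_natCast_atTop_atTop
  -- From `m ≤ 3 |C| N ^ γ` and `3 ≤ 3 N ^ γ` follows `N = m + 3 ≤ (3 |C| + 3) N ^ γ`, which is
  -- false for this `N`.
  obtain ⟨N, hN, hN3, hN0⟩ := ((hlim.eventually_gt_atTop (3 * |C| + 3)).and
    ((Filter.eventually_ge_atTop 3).and (Filter.eventually_ge_atTop n₀))).exists
  obtain ⟨m, rfl⟩ := Nat.exists_eq_add_of_le' hN3
  have hone : (1 : ℝ) ≤ ((m + 3 : ℕ) : ℝ) := by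
    push_cast
    linarith [Nat.cast_nonneg (α := ℝ) m]
  have hT : ∀ j ω, HaltedAt p ((kDSP k).encode (starInstance k m j)) ω
      ⌊|C| * ((m + 3 : ℕ) : ℝ) ^ γ⌋₊ := by
    intro j ω
    obtain ⟨t, ht, hh⟩ := hC (starInstance k m j) ω hN0
    change (t : ℝ) ≤ C * ((m + 3 : ℕ) : ℝ) ^ β at ht
    have h1 : (t : ℝ) ≤ |C| * ((m + 3 : ℕ) : ℝ) ^ γ :=
      ht.trans (mul_le_mul (le_abs_self C)
        (Real.rpow_le_rpow_of_exponent_le hone (le_max_left _ _)) (by positivity) (abs_nonneg C))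
    have h2 := run_eq_of_haltedAt hh (Nat.le_floor h1)
    rw [HaltedAt, h2]
    exact hh
  have h3 := le_three_mul_of_solves hk hs hT
  have h4 : (m : ℝ) ≤ 3 * (|C| * ((m + 3 : ℕ) : ℝ) ^ γ) := by
    have h5 : (m : ℝ) ≤ 3 * (⌊|C| * ((m + 3 : ℕ) : ℝ) ^ γ⌋₊ : ℝ) := by exact_mod_cast h3
    linarith [Nat.floor_le (show 0 ≤ |C| * ((m + 3 : ℕ) : ℝ) ^ γ by positivity)]
  have h6 : (1 : ℝ) ≤ ((m + 3 : ℕ) : ℝ) ^ γ := Real.one_le_rpow hone (le_max_right _ _)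
  have h7 : ((m + 3 : ℕ) : ℝ) = ((m + 3 : ℕ) : ℝ) ^ (1 - γ) * ((m + 3 : ℕ) : ℝ) ^ γ := by
    rw [← Real.rpow_add (by linarith)]
    simp
  have h8 : (3 * |C| + 3) * ((m + 3 : ℕ) : ℝ) ^ γ < ((m + 3 : ℕ) : ℝ) := by
    conv_rhs => rw [h7]
    exact mul_lt_mul_of_pos_right hN (by linarith)
  have h9 : ((m + 3 : ℕ) : ℝ) = m + 3 := by push_cast; rfl
  linarith

end FineGrained

/-! ### The corollary -/

theorem corollary7 (mode : FineGrained.Mode) (hypothesis : FineGrained.KCliqueHypothesis mode)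
    (k : ℕ) (hk : 3 ≤ k) :
    FineGrained.RequiresTime mode (FineGrained.kDSP k)
      (fun n => FineGrained.cliqueTime ((n : ℝ) ^ (1 / 2 : ℝ)) k) := by
  intro ε hε h
  unfold FineGrained.cliqueTime at h
  set τ := FineGrained.matMulExponent ⌊(k : ℚ) / 3⌋₊ ⌈((k : ℚ) - 1) / 3⌉₊ ⌈(k : ℚ) / 3⌉₊ with hτ
  have e : (fun n : ℕ => (((n : ℝ) ^ (1 / 2 : ℝ)) ^ τ) ^ (1 - ε)) =
      fun n : ℕ => (n : ℝ) ^ (1 / 2 * τ * (1 - ε)) := by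
    funext n
    rw [← Real.rpow_mul (by positivity), ← Real.rpow_mul (by positivity), mul_assoc]
  rw [e] at h
  -- Since `ε` is arbitrary, the exponent may fall below `1`. That case is excluded unconditionally,
  -- and only the other one uses the reduction.
  rcases lt_or_ge (1 / 2 * τ * (1 - ε)) 1 with hβ | hβ
  · exact FineGrained.not_solvableInTime_kDSP (by omega) mode hβ h
  · refine hypothesis k hk ε hε ?_
    have h' := FineGrained.Lines.solvableInTime_kClique (by omega) hβ h
    have e' : (fun n : ℕ => FineGrained.cliqueTime (n : ℝ) k ^ (1 - ε)) =
        fun n : ℕ => (n : ℝ) ^ (2 * (1 / 2 * τ * (1 - ε))) := by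
      funext n
      rw [FineGrained.cliqueTime, ← hτ, ← Real.rpow_mul (by positivity)]
      congr 1
      ring
    rw [e']
    exact h'
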